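/- **Setting.** A temporal graph $\mathcal G=(V,\mathcal E)$ consists of a finite vertex set $V$ and a finite set $\mathcal E$ of temporal edges $(u,v,t)$, where $\{u,v\}$ is an unordered pair of distinct vertices and $t\in\mathbb N$ is a timestamp. Write $\mathcal E_{[a,b]}=\{(u,v,t)\in\mathcal E: a\le t\le b\}$ and $\mathcal G_{[a,b]}=(V,\mathcal E_{[a,b]})$. For $k\ge 1$, the temporal $k$-core $\mathcal T_{[a,b]}=\mathcal T_{[a,b]}(\mathcal G)$ is the (possibly empty) maximal induced subgraph of $\mathcal G_{[a,b]}$ in which every vertex has at least $k$ distinct neighbours. The support time of an edge $\{u,v\}$ in a temporal graph is its smallest timestamp there. The $k$-core time $\sigma_x$ of a vertex or edge $\{u,v\}$ is the least $t$ such that it belongs to the $k$-core of the static graph underlying $\mathcal G_{[x,t]}$ ($+\infty$ if there is none). **Algorithm.** Let $T_s\le T_e$, $\Delta=T_e-T_s+1$, and let $\mathcal G$ be given by the list, for each timestamp $t$, of the edges with timestamp $t$. $\texttt{CoreT}$ first stores $\mathcal G_0=\mathcal G_{[T_s,T_e]}$ (its non-isolated vertices, its static edges, and for each static edge the ascending list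 of its timestamps). It calls $\texttt{CoreT\_Init}$ and then $\texttt{CoreT\_List}$ with start time $x=T_s$; then for $x=T_s+1,\dots,T_e$ it calls $\texttt{CoreT\_Update}$ (from $x-1$ to $x$) and $\texttt{CoreT\_List}$ (with start time $x$). * $\texttt{CoreT\_Init}$ gives every vertex $v$ the key $d(v)$, the $k$-th smallest support time among the edges from $v$ to remaining vertices ($+\infty$ if there are fewer than $k$). Starting from $t=+\infty$, it repeatedly removes a vertex $v$ with the largest value of $\min(t,d(v))$, sets $t\leftarrow\min(t,d(v))$ and $\sigma(v)\leftarrow t$, and updates the keys of the neighbours of $v$. Finally $\sigma(u,v)\leftarrow\max\{\sigma(u),\sigma(v),\mathrm{Sup}(u,v)\}$. * $\texttt{CoreT\_Update}$ removes all temporal edges with timestamp $x-1$; each such edge whose value $\sigma(u,v)$ is smaller than its new support time ($+\infty$ if no timestamp is left) gets that as its new value and enters a set $S$. While $S\ne\emptyset$, it removes from $S$ an element with the largest $\sigma$. If this is a vertex $s$, every incident edge $(s,v)$ with $\sigma(s,v)<\max\{\sigma(s),\sigma(v)\}$ is raised to this maximum and enters $S$; if it is an edge, each of its endpoints $v$ whose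 $\sigma(v)$ is smaller than the $k$-th smallest $\sigma$ among its incident edges is raised to that value and enters $S$. * $\texttt{CoreT\_List}$ runs through $t_e=x,\dots,T_e$, maintaining by additions $V^*=\{u:\sigma(u)\le t_e\}$ and $\mathcal E^*=\{(u,v,t): \sigma(u,v)\le t_e,\ t\le t_e\}$ as linked lists; it outputs (the heads of) $(V^*,\mathcal E^*)$ unless the interval from the smallest to the largest timestamp in $\mathcal E^*$ (or "no edges") is already marked in a table kept throughout the run, and marks it. The sets ordered by time values are kept in buckets indexed by $T_s,\dots,T_e,+\infty$, the incidence lists are sorted by bucket sort, and the $k$-th smallest values are maintained by pointers into the sorted incidence lists. Running time is the number of steps on a unit-cost random access machine whose fresh memory cells hold a default value. **Theorem.** There is an absolute constant $C$ such that for all $\mathcal G$, $k\ge1$ and $T_s\le T_e$: 1. $\texttt{CoreT}$ terminates, and its output consists of exactly the temporal $k$-cores $\mathcal T_{[t_s,t_e]}(\mathcal G)$ with $[t_s,t_e]\subseteq[T_s,T_e]$, each distinct one output exactly once (the empty one too, if it occurs). 2. It makes one $\texttt{CoreT\_Init}$ call, $\Delta-1$ $\texttt{CoreT\_Update}$ calls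 and $\Delta$ $\texttt{CoreT\_List}$ calls, in the order Init, List, followed by $\Delta-1$ times Update, List. 3. If every timestamp in $[T_s,T_e]$ is the timestamp of at least one temporal edge, then each of these calls takes at most $C\,|\mathcal E_{[T_s,T_e]}|$ steps, and the whole run takes at most $C\,\Delta\,|\mathcal E_{[T_s,T_e]}|$ steps. -/

import Mathlib

/-! ### Temporal graphs and temporal `k`-cores -/

/-- A finite temporal graph with vertices drawn from `V`: a temporal edge is an unordered pair of
distinct vertices together with a timestamp. -/
@[ext]
structure TemporalGraph (V : Type) : Type where
  verts : Finset V
  edges : Finset (Sym2 V × ℕ)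
  incident : ∀ a ∈ edges, ∀ v ∈ a.1, v ∈ verts
  loopless : ∀ a ∈ edges, ¬ a.1.IsDiag

namespace TemporalGraph

variable {V : Type}

/-- The subgraph relation. -/
instance : LE (TemporalGraph V) where
  le H G := H.verts ⊆ G.verts ∧ H.edges ⊆ G.edges

/-- The projected graph over the time interval `[ts, te]`. -/
def proj (G : TemporalGraph V) (ts te : ℕ) : TemporalGraph V where
  verts := G.verts
  edges := G.edges.filter (fun a => ts ≤ a.2 ∧ a.2 ≤ te)
  incident a ha v hv := G.incident a (Finset.mem_filter.1 ha).1 v hv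
  loopless a ha := G.loopless a (Finset.mem_filter.1 ha).1

/-- `H` is an induced subgraph of `G`. -/
def IsInducedSubgraph (H G : TemporalGraph V) : Prop :=
  H.verts ⊆ G.verts ∧ ∀ a, a ∈ H.edges ↔ a ∈ G.edges ∧ ∀ v ∈ a.1, v ∈ H.verts

/-- The set of neighbours of `v`; parallel edges count once. -/
def neighbors (G : TemporalGraph V) (v : V) : Set V :=
  {u | ∃ t, (s(v, u), t) ∈ G.edges}

/-- `H` is a temporal `k`-core of `G` over `[ts, te]`: a maximal induced subgraph of the projected
graph in which every vertex has at least `k` neighbours. -/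
def IsTemporalKCore (G : TemporalGraph V) (k ts te : ℕ) (H : TemporalGraph V) : Prop :=
  Maximal (fun H : TemporalGraph V =>
    H.IsInducedSubgraph (G.proj ts te) ∧ ∀ v ∈ H.verts, k ≤ (H.neighbors v).ncard) H

end TemporalGraph

/-! ### Programs with a step counter

A program is run on a unit-cost random access machine.  It returns its result together with the
number of steps, or never returns (`none`). An array is a function from addresses to contents; all
cells of a fresh array hold a fixed default value. One step is charged for each read or write of an
array cell, and for each test at the head of a loop; the constantly many operations on single
registers (comparing or copying two values, putting an element in front of a linked list,
inspecting its first cell) between two charged steps are absorbed in the constant. -/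

abbrev Timed := StateT ℕ Option

namespace Timed

variable {ι α σ : Type}

/-- Spend one step. -/
def tick : Timed Unit := modify (fun n => n + 1)

/-- Read one array cell. -/
def read (A : ι → α) (i : ι) : Timed α := do
  tick
  pure (A i)

/-- Write one array cell. -/
def write [DecidableEq ι] (A : ι → α) (i : ι) (a : α) : Timed (ι → α) := do
  tick
  pure (Function.update A i a)

/-- Put `a` in front of the linked list that is stored in cell `i` of an array of lists. -/
def push [DecidableEq ι] (A : ι → List α) (i : ι) (a : α) : Timed (ι → List α) := do
  let l ← read A i
  write A i (a :: l)

/-- `for a in l do body`, acting on the state `s`. -/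
def forEach (l : List α) (s : σ) (body : α → σ → Timed σ) : Timed σ :=
  match l with
  | [] => do
    tick
    pure s
  | a :: l => do
    tick
    let s₁ ← body a s
    forEach l s₁ body

/-- `while cond do body`, acting on the state `s`; it may fail to terminate. -/
def whileDo (cond : σ → Bool) (body : σ → Timed σ) (s : σ) : Timed σ := do
  tick
  if cond s then
    let s₁ ← body s
    whileDo cond body s₁
  else
    pure s
  partial_fixpoint

end Timed

namespace CoreT

open Timed

variable {V : Type} [LinearOrder V]

/-! ### Stored graphs and sorted incidence lists -/

/-- A stored temporal graph: the non-isolated vertices, the detemporalized edges, and for each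
detemporalized edge the ascending list of its timestamps. -/
structure Store (V : Type) : Type where
  verts : List V
  edges : List (Sym2 V)
  times : Sym2 V → List ℕ

/-- A timestamp or `+∞` (written `⊤`). -/
abbrev Time := WithTop ℕ

/-- Core times of vertices and of detemporalized edges. -/
structure CoreTimes (V : Type) : Type where
  vert : V → Time
  edge : Sym2 V → Time

/-- The endpoint of `e` other than `v`. -/
def other (e : Sym2 V) (v : V) : V := if v = e.inf then e.sup else e.inf

/-- The timestamps `a, a + 1, …, b` in ascending order. -/
def interval (a b : ℕ) : List ℕ := List.range' a (b + 1 - a)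

/-- The possible core times of a query on `[Ts, Te]`, in descending order. -/
def levels (Ts Te : ℕ) : List Time := ⊤ :: (interval Ts Te).reverse.map WithTop.some

/-- The first entry of an ascending list of timestamps, i.e. the support time of its edge. -/
def firstTime : List ℕ → Time
  | [] => ⊤
  | t :: _ => WithTop.some t

/-- For every vertex the list of its incident edges in ascending order of their keys, by one
bucket sort. -/
def sortedIncidence (lv : List Time) (edges : List (Sym2 V)) (key : Sym2 V → Time) :
    Timed (V → List (Sym2 V)) := do
  let bucket ← forEach edges ((fun _ => []) : Time → List (Sym2 V)) fun e b => do
    let c ← read key e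
    push b c e
  forEach lv ((fun _ => []) : V → List (Sym2 V)) fun c inc => do
    let es ← read bucket c
    forEach es inc fun e inc => do
      let inc ← push inc e.inf e
      push inc e.sup e

/-! ### The `k`-th smallest key at a vertex

The incident edges of `v` are scanned in ascending order of their keys, and edges can only be
deleted; the key of an edge stays fixed until it is deleted. The scanned edges contain exactly `k` edges that are not deleted, unless
the list is exhausted; hence `val v`, the key of the last scanned edge (`⊤` when the list is
exhausted too early), is the `k`-th smallest key among the edges at `v` that are not deleted. -/

structure Kth (V : Type) : Type where
  rest : V → List (Sym2 V)
  scanned : V × Sym2 V → Bool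
  deleted : Sym2 V → Bool
  val : V → Time

/-- Scan the first `j` edges of the list of unscanned edges `l` of `v`. -/
def Kth.scan (key : Sym2 V → Time) (v : V) : ℕ → List (Sym2 V) → Kth V → Timed (Kth V)
  | 0, l, K => do
    let rest ← write K.rest v l
    pure { K with rest := rest }
  | _ + 1, [], K => do
    let rest ← write K.rest v []
    let val ← write K.val v ⊤
    pure { K with rest := rest, val := val }
  | j + 1, e :: l, K => do
    let scanned ← write K.scanned (v, e) true
    let c ← read key e
    let val ← write K.val v c
    Kth.scan key v j l { K with scanned := scanned, val := val }

/-- Set up the structure for all vertices, from their sorted incidence lists. -/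
def Kth.make (k : ℕ) (key : Sym2 V → Time) (verts : List V) (inc : V → List (Sym2 V)) :
    Timed (Kth V) :=
  forEach verts ⟨fun _ => [], fun _ => false, fun _ => false, fun _ => ⊤⟩ fun v K => do
    let l ← read inc v
    Kth.scan key v k l K

/-- Scan on to the next edge of `v` in the list `l` of unscanned edges that is not deleted. -/
def Kth.next (key : Sym2 V → Time) (v : V) : List (Sym2 V) → Kth V → Timed (Kth V)
  | [], K => do
    let rest ← write K.rest v []
    let val ← write K.val v ⊤
    pure { K with rest := rest, val := val }
  | e :: l, K => do
    let del ← read K.deleted e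
    if del then
      Kth.next key v l K
    else
      let scanned ← write K.scanned (v, e) true
      let c ← read key e
      let rest ← write K.rest v l
      let val ← write K.val v c
      pure { K with rest := rest, scanned := scanned, val := val }

/-- Account at the endpoint `v` for the deletion of the edge `e`. -/
def Kth.drop (key : Sym2 V → Time) (K : Kth V) (v : V) (e : Sym2 V) : Timed (Kth V) := do
  let sc ← read K.scanned (v, e)
  if sc then
    let l ← read K.rest v
    Kth.next key v l K
  else
    pure K

/-! ### `CoreT_Init` -/

structure InitState (V : Type) : Type where
  queue : Time → List V
  removed : V → Bool
  kth : Kth V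
  t : Time
  core : V → Time

/-- Compute all core times for the start time `Ts`. The vertex with the largest `k`-degree time
(`kth.val`) is removed repeatedly, and `t` is the minimum of the `k`-degree times seen so far. The
vertices sit in buckets that are emptied from the highest to the lowest; a vertex with `k`-degree
time above `t` is filed under `t`, because all those vertices receive the core time `t`. -/
def init (k Ts Te : ℕ) (G : Store V) : Timed (CoreTimes V) := do
  let sup ← forEach G.edges ((fun _ => ⊤) : Sym2 V → Time) fun e sup => do
    let l ← read G.times e
    write sup e (firstTime l)
  let inc ← sortedIncidence (levels Ts Te) G.edges sup
  let kth ← Kth.make k sup G.verts inc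
  let queue ← forEach G.verts ((fun _ => []) : Time → List V) fun v q => do
    let d ← read kth.val v
    push q d v
  let s₀ : InitState V := ⟨queue, fun _ => false, kth, ⊤, fun _ => ⊤⟩
  let s ← forEach (levels Ts Te) s₀ fun c s =>
    whileDo (fun s => !(s.queue c).isEmpty) (fun s => do
      match ← read s.queue c with
      | [] => pure s
      | v :: q => do
        let queue ← write s.queue c q
        let s := { s with queue := queue }
        let rem ← read s.removed v
        if rem then
          pure s
        else
          let d ← read s.kth.val v
          let t := min s.t d
          let core ← write s.core v t
          let removed ← write s.removed v true
          let es ← read inc v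
          forEach es { s with t := t, core := core, removed := removed } fun e s => do
            let del ← read s.kth.deleted e
            if del then
              pure s
            else
              let u := other e v
              let deleted ← write s.kth.deleted e true
              let kth ← Kth.drop sup { s.kth with deleted := deleted } u e
              let d ← read kth.val u
              let queue ← push s.queue (min s.t d) u
              pure { s with kth := kth, queue := queue }) s
  let edge ← forEach G.edges ((fun _ => ⊤) : Sym2 V → Time) fun e edge => do
    let a ← read s.core e.inf
    let b ← read s.core e.sup
    let c ← read sup e
    write edge e (max (max a b) c)
  pure ⟨s.core, edge⟩

/-! ### `CoreT_Update` -/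

structure UpdateState (V : Type) : Type where
  queue : Time → List (V ⊕ Sym2 V)
  vert : V → Time
  edge : Sym2 V → Time
  kth : Kth V

/-- From the core times for the start time `x` to those for `x + 1`; `snap x` lists the edges with
timestamp `x`, which are removed first. Then the vertices and edges whose tentative core time has
grown are processed in descending order of it, from buckets; an entry whose tentative core time has
changed since it was filed is stale and skipped.

The keys in `kth` are the tentative core times of the edges. An edge that is raised during the
propagation is deleted there: its new value is at least the value `c` that is
processed from then on, so that the `k`-th smallest tentative core time at a vertex, as far as it
does not exceed `c`, is the smaller one of `c` and `kth.val`; a `k`-th smallest value above `c` has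
been assigned to the vertex before. -/
def update (k Ts Te : ℕ) (snap : ℕ → List (Sym2 V)) (x : ℕ) (σ : CoreTimes V) (G : Store V) :
    Timed (CoreTimes V × Store V) := do
  let gone ← read snap x
  let (times, edge, queue) ← forEach gone
    ((G.times, σ.edge, fun _ => []) :
      (Sym2 V → List ℕ) × (Sym2 V → Time) × (Time → List (V ⊕ Sym2 V)))
    fun e (times, edge, queue) => do
    let l ← read times e
    let times ← write times e l.tail
    let sup := firstTime l.tail
    let old ← read edge e
    if old < sup then
      let edge ← write edge e sup
      let queue ← push queue sup (Sum.inr e)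
      pure (times, edge, queue)
    else
      pure (times, edge, queue)
  let inc ← sortedIncidence (levels Ts Te) G.edges edge
  let kth ← Kth.make k edge G.verts inc
  let s₀ : UpdateState V := ⟨queue, σ.vert, edge, kth⟩
  let s ← forEach (levels Ts Te) s₀ fun c s =>
    whileDo (fun s => !(s.queue c).isEmpty) (fun s => do
      match ← read s.queue c with
      | [] => pure s
      | Sum.inl v :: q => do
        let queue ← write s.queue c q
        let s := { s with queue := queue }
        let a ← read s.vert v
        if a ≠ c then
          pure s
        else
          let es ← read inc v
          forEach es s fun e s => do
            let b ← read s.vert (other e v)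
            let δ := max a b
            let old ← read s.edge e
            if old < δ then
              let edge ← write s.edge e δ
              let queue ← push s.queue δ (Sum.inr e)
              let del ← read s.kth.deleted e
              if del then
                pure { s with edge := edge, queue := queue }
              else
                let deleted ← write s.kth.deleted e true
                let kth ← Kth.drop edge { s.kth with deleted := deleted } e.inf e
                let kth ← Kth.drop edge kth e.sup e
                pure { s with edge := edge, queue := queue, kth := kth }
            else
              pure s
      | Sum.inr e :: q => do
        let queue ← write s.queue c q
        let s := { s with queue := queue }
        let a ← read s.edge e
        if a ≠ c then
          pure s
        else
          forEach [e.inf, e.sup] s fun v s => do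
            let d ← read s.kth.val v
            let δ := min c d
            let old ← read s.vert v
            if old < δ then
              let vert ← write s.vert v δ
              let queue ← push s.queue δ (Sum.inl v)
              pure { s with vert := vert, queue := queue }
            else
              pure s) s
  let edges ← forEach G.edges [] fun e es => do
    let l ← read times e
    pure (if l.isEmpty then es else e :: es)
  pure (⟨s.vert, s.edge⟩, ⟨G.verts, edges, times⟩)

/-! ### `CoreT_List` -/

/-- A reported subgraph: its vertices and its temporal edges, as linked lists. -/
abbrev Answer (V : Type) := List V × List (Sym2 V × ℕ)

/-- The subgraphs reported so far, and the table of the tightest time intervals (from the earliest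
to the latest timestamp; `none` for a subgraph without edges) encountered so far. -/
structure Report (V : Type) : Type where
  seen : Option (ℕ × ℕ) → Bool
  out : List (Answer V)

/-- The tightest time interval after a temporal edge with timestamp `t` is added. -/
def extend (t : ℕ) : Option (ℕ × ℕ) → Option (ℕ × ℕ)
  | none => some (t, t)
  | some (a, b) => some (min a t, max b t)

/-- Report all temporal `k`-cores with start time `x` that have not been reported yet. The sets of
vertices and temporal edges only grow with the end time `te`, and each of the linked lists that hold
them shares its cells with the previous one. -/
def list (Te x : ℕ) (σ : CoreTimes V) (G : Store V) (R : Report V) : Timed (Report V) := do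
  let vb ← forEach G.verts ((fun _ => []) : Time → List V) fun v b => do
    let c ← read σ.vert v
    push b c v
  let eb ← forEach G.edges ((fun _ => []) : Time → List (Sym2 V × ℕ)) fun e b => do
    let c ← read σ.edge e
    let l ← read G.times e
    forEach l b fun t b => push b (max c (WithTop.some t)) (e, t)
  let s₀ : Answer V × Option (ℕ × ℕ) × Report V := (([], []), none, R)
  let s ← forEach (interval x Te) s₀ fun te (A, tti, R) => do
    let newV ← read vb (WithTop.some te)
    let vs ← forEach newV A.1 fun v vs => pure (v :: vs)
    let newE ← read eb (WithTop.some te)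
    let (es, tti) ← forEach newE (A.2, tti) fun a (es, tti) => pure (a :: es, extend a.2 tti)
    let old ← read R.seen tti
    if old then
      pure ((vs, es), tti, R)
    else
      let seen ← write R.seen tti true
      pure ((vs, es), tti, ⟨seen, (vs, es) :: R.out⟩)
  pure s.2.2

/-! ### `CoreT` -/

/-- Names of the three procedures. -/
inductive Procedure
  | init
  | update
  | list

/-- Run one call of a procedure and also return the number of steps it takes. -/
def call {α : Type} (name : Procedure) (p : Timed α) : Timed (α × Procedure × ℕ) := do
  let before ← get
  let a ← p
  let after ← get
  pure (a, name, after - before)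

/-- Store the projected graph over `[Ts, Te]`, given the list of the edges of each timestamp. -/
def refine (snap : ℕ → List (Sym2 V)) (Ts Te : ℕ) : Timed (Store V) := do
  let (G, _) ← forEach (interval Ts Te).reverse
    ((⟨[], [], fun _ => []⟩, fun _ => false) : Store V × (V → Bool)) fun t s => do
    let es ← read snap t
    forEach es s fun e s => do
      let l ← read s.1.times e
      let times ← write s.1.times e (t :: l)
      let edges := if l.isEmpty then e :: s.1.edges else s.1.edges
      forEach [e.inf, e.sup] (⟨s.1.verts, edges, times⟩, s.2) fun v s => do
        let old ← read s.2 v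
        if old then
          pure s
        else
          let mark ← write s.2 v true
          pure (⟨v :: s.1.verts, s.1.edges, s.1.times⟩, mark)
  pure G

/-- The result of a run: the reported subgraphs, and the log of all procedure calls in order, each
with its number of steps. -/
structure Result (V : Type) : Type where
  out : List (Answer V)
  calls : List (Procedure × ℕ)

structure MainState (V : Type) : Type where
  σ : CoreTimes V
  G : Store V
  R : Report V
  calls : List (Procedure × ℕ)

/-- The algorithm `CoreT`, on a temporal graph that is given by the list `snap t` of the edges with
timestamp `t`, for each `t`. -/
def run (k Ts Te : ℕ) (snap : ℕ → List (Sym2 V)) : Timed (Result V) := do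
  let G ← refine snap Ts Te
  let (σ, c₁) ← call Procedure.init (init k Ts Te G)
  let (R, c₂) ← call Procedure.list (list Te Ts σ G ⟨fun _ => false, []⟩)
  let s ← forEach (interval (Ts + 1) Te) (⟨σ, G, R, [c₁, c₂]⟩ : MainState V) fun x s => do
    let ((σ, G), c₁) ← call Procedure.update (update k Ts Te snap (x - 1) s.σ s.G)
    let (R, c₂) ← call Procedure.list (list Te x σ G s.R)
    pure ⟨σ, G, R, s.calls ++ [c₁, c₂]⟩
  pure ⟨s.R.out, s.calls⟩

/-- `snap` lists the temporal edges of `G` by timestamp, each of them once. -/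
def Lists (snap : ℕ → List (Sym2 V)) (G : TemporalGraph V) : Prop :=
  ∀ t, (snap t).Nodup ∧ ∀ e, e ∈ snap t ↔ (e, t) ∈ G.edges

end CoreT

/-! Call a vertex set cohesive at time `c` if each of its vertices has at least `k` incident edges
with support time at most `c` that stay inside the set. Cohesive sets are closed under union, so the
`k`-core at time `c` is the largest one (`cohesive_inCore`). A core time is therefore pinned down by
two bounds: no cohesive set at an earlier time contains the vertex, and some cohesive set at that
time does.

`CoreT_Init` (`InitInv`). When `v` is removed with value `c`, all vertices removed before have core
time at least `c`. A cohesive set at a time below `c` that contains `v` thus uses only remaining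
vertices and undeleted edges, and would force the `k`-degree time of `v` below `c`. Conversely, no
remaining vertex then has minimum of `t` and its `k`-degree time above `c`, so the remaining
vertices are cohesive at every time from `c` up to the old value of `t`.

`CoreT_Update` (`UpdateInv`). Let `τ` be the new core times. The tentative values start at the old
core times, only grow, and never exceed `τ`. A violated local condition is always witnessed by a
queue entry. When the queues are empty, all local conditions hold, so the vertices with value at
most `t` are cohesive at every `t`; hence the values are also at least `τ` (`UpdateInv.isCoreTime`).
The delicate point is that a raised edge is simply deleted from the structure for the `k`-th
smallest keys. This is harmless because its value is at least every level still to be processed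
(`UpdateInv.val_le`, `UpdateInv.settleVert`).

`CoreT_List`. Core times describe each temporal `k`-core (`CoreTimes.Correct.isAnswer`), and a core
is determined by its tightest time interval: if two cores share it, the vertices of either one
induce a candidate in the interval of the other (`IsTemporalKCore.eq_of_isTightest`). So the table
of marked intervals suppresses exactly the repetitions.

Running time. Each procedure has one rule `wp_...` that yields termination, correctness and a step
bound together. In the two bucket loops the step counter plus a potential stays below a fixed
budget. The potential pays for queue entries, for the one expansion of each vertex, and for the
unscanned parts of the incidence lists, which have total length at most twice the number of edges.
The remaining cost is one term per time level, and this is linear in the number of temporal edges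
when every timestamp occurs (`card_interval_le`). -/

set_option linter.unusedSectionVars false

/-! ### Weakest preconditions for programs with a step counter -/

namespace Timed

variable {ι α β σ : Type}

/-- Started with the step counter at `n`, the program `p` returns, and its result and the final
value of the counter satisfy `Q`. -/
def wp (p : Timed α) (n : ℕ) (Q : α → ℕ → Prop) : Prop :=
  ∃ a m, p.run n = some (a, m) ∧ Q a m

theorem wp_mono {p : Timed α} {n : ℕ} {Q Q' : α → ℕ → Prop} (h : wp p n Q)
    (hQ : ∀ a m, Q a m → Q' a m) : wp p n Q' := by
  obtain ⟨a, m, hp, h⟩ := h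
  exact ⟨a, m, hp, hQ a m h⟩

@[simp] theorem wp_pure (a : α) (n : ℕ) (Q : α → ℕ → Prop) :
    wp (pure a : Timed α) n Q ↔ Q a n := by
  constructor
  · rintro ⟨b, m, h, hQ⟩
    cases h
    exact hQ
  · exact fun h => ⟨a, n, rfl, h⟩

@[simp] theorem wp_bind (p : Timed α) (f : α → Timed β) (n : ℕ) (Q : β → ℕ → Prop) :
    wp (p >>= f) n Q ↔ wp p n fun a m => wp (f a) m Q := by
  constructor
  · rintro ⟨b, m, h, hQ⟩
    simp only [StateT.run_bind, Option.bind_eq_bind, Option.bind_eq_some_iff] at h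
    obtain ⟨⟨a, l⟩, h₁, h₂⟩ := h
    exact ⟨a, l, h₁, b, m, h₂, hQ⟩
  · rintro ⟨a, l, h₁, b, m, h₂, hQ⟩
    refine ⟨b, m, ?_, hQ⟩
    simp only [StateT.run_bind, Option.bind_eq_bind, Option.bind_eq_some_iff]
    exact ⟨(a, l), h₁, h₂⟩

@[simp] theorem wp_tick (n : ℕ) (Q : Unit → ℕ → Prop) : wp tick n Q ↔ Q () (n + 1) := by
  constructor
  · rintro ⟨b, m, h, hQ⟩
    cases h
    exact hQ
  · exact fun h => ⟨(), n + 1, rfl, h⟩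

@[simp] theorem wp_get (n : ℕ) (Q : ℕ → ℕ → Prop) : wp (get : Timed ℕ) n Q ↔ Q n n := by
  constructor
  · rintro ⟨b, m, h, hQ⟩
    cases h
    exact hQ
  · exact fun h => ⟨n, n, rfl, h⟩

@[simp] theorem wp_read (A : ι → α) (i : ι) (n : ℕ) (Q : α → ℕ → Prop) :
    wp (read A i) n Q ↔ Q (A i) (n + 1) := by
  simp only [read, wp_bind, wp_tick, wp_pure]

@[simp] theorem wp_write [DecidableEq ι] (A : ι → α) (i : ι) (a : α) (n : ℕ)
    (Q : (ι → α) → ℕ → Prop) : wp (write A i a) n Q ↔ Q (Function.update A i a) (n + 1) := by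
  simp only [write, wp_bind, wp_tick, wp_pure]

@[simp] theorem wp_push [DecidableEq ι] (A : ι → List α) (i : ι) (a : α) (n : ℕ)
    (Q : (ι → List α) → ℕ → Prop) :
    wp (push A i a) n Q ↔ Q (Function.update A i (a :: A i)) (n + 2) := by
  simp [push]

/-- The invariant `I` of a loop over a list refers to the elements that are still to come. -/
theorem wp_forEach {l : List α} {s : σ} {body : α → σ → Timed σ} {n : ℕ} {Q : σ → ℕ → Prop}
    (I : List α → σ → ℕ → Prop) (h₀ : I l s n)
    (step : ∀ p a r s n, l = p ++ a :: r → I (a :: r) s n → wp (body a s) (n + 1) (I r))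
    (final : ∀ s n, I [] s n → Q s (n + 1)) : wp (forEach l s body) n Q := by
  suffices H : ∀ r p s n, l = p ++ r → I r s n → wp (forEach r s body) n Q from H l [] s n rfl h₀
  intro r
  induction r with
  | nil =>
    intro p s n _ h
    simp only [forEach, wp_bind, wp_tick, wp_pure]
    exact final s n h
  | cons a r ih =>
    intro p s n hl h
    simp only [forEach, wp_bind, wp_tick]
    exact wp_mono (step p a r s n hl h) fun s m hs => ih (p ++ [a]) s m (by simp [hl]) hs

/-- A loop terminates if its invariant bounds the step counter, which every round advances. -/
theorem wp_whileDo {cond : σ → Bool} {body : σ → Timed σ} {s : σ} {n : ℕ} {Q : σ → ℕ → Prop}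
    (I : σ → ℕ → Prop) (B : ℕ) (bound : ∀ s n, I s n → n ≤ B) (h₀ : I s n)
    (step : ∀ s n, cond s = true → I s n → wp (body s) (n + 1) fun s' n' => n < n' ∧ I s' n')
    (final : ∀ s n, cond s = false → I s n → Q s (n + 1)) :
    wp (whileDo cond body s) n Q := by
  induction hd : B - n using Nat.strong_induction_on generalizing s n with
  | _ d ih =>
    rw [whileDo]
    simp only [wp_bind, wp_tick]
    by_cases hc : cond s = true
    · simp only [hc, if_true, wp_bind]
      refine wp_mono (step s n hc h₀) fun s' n' h => ?_
      have := bound s' n' h.2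
      exact ih (B - n') (by omega) h.2 rfl
    · simp only [hc, Bool.false_eq_true, if_false, wp_pure]
      exact final s n (by simpa using hc) h₀

end Timed

/-! ### Auxiliary facts on pairs and lists -/

namespace CoreT

open Timed

section Aux

variable {V : Type} [LinearOrder V]

theorem mk_inf_sup (e : Sym2 V) : s(e.inf, e.sup) = e := by
  induction e with
  | _ a b => rcases le_total a b with h | h <;> simp [h]

theorem mem_iff_inf_or_sup (e : Sym2 V) (v : V) : v ∈ e ↔ v = e.inf ∨ v = e.sup := by
  conv_lhs => rw [← mk_inf_sup e]
  exact Sym2.mem_iff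

theorem inf_mem (e : Sym2 V) : e.inf ∈ e := (mem_iff_inf_or_sup e _).2 (.inl rfl)

theorem sup_mem (e : Sym2 V) : e.sup ∈ e := (mem_iff_inf_or_sup e _).2 (.inr rfl)

theorem inf_ne_sup {e : Sym2 V} (h : ¬ e.IsDiag) : e.inf ≠ e.sup := by
  rw [← mk_inf_sup e] at h
  simpa using h

theorem other_mem (e : Sym2 V) (v : V) : other e v ∈ e := by
  unfold other
  split_ifs
  exacts [sup_mem e, inf_mem e]

theorem other_ne {e : Sym2 V} (h : ¬ e.IsDiag) (v : V) : other e v ≠ v := by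
  unfold other
  split_ifs with hv
  · rw [hv]
    exact (inf_ne_sup h).symm
  · exact fun h => hv h.symm

theorem mem_iff_eq_or_other {e : Sym2 V} {v : V} (hv : v ∈ e) (u : V) :
    u ∈ e ↔ u = v ∨ u = other e v := by
  rw [mem_iff_inf_or_sup] at hv ⊢
  unfold other
  split_ifs with h
  · rw [h]
  · rw [hv.resolve_left h, or_comm]

variable {α β : Type}

/-- Each element lies in at most one of the listed buckets. Emptying all buckets once therefore
costs no more than the length of the list. -/
theorem sum_length_buckets_le [DecidableEq β] (f : α → β) (l : List α) {lv : List β}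
    (hlv : lv.Nodup) : (lv.map fun c => (l.filter fun a => f a = c).length).sum ≤ l.length := by
  induction l with
  | nil => simp
  | cons a l ih =>
    have h : ∀ c, ((a :: l).filter fun a => f a = c).length =
        (if f a = c then 1 else 0) + (l.filter fun a => f a = c).length := by
      intro c
      by_cases h : f a = c <;> simp [h, add_comm]
    simp only [h, List.sum_map_add, List.length_cons]
    have : (lv.map fun c => if f a = c then 1 else 0).sum ≤ 1 := by
      have h₁ : (lv.map fun c => if f a = c then 1 else 0).sum = lv.count (f a) := by
        clear h ih hlv
        induction lv with
        | nil => rfl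
        | cons c lv ih =>
          rw [List.map_cons, List.sum_cons, ih, List.count_cons, add_comm]
          simp only [beq_iff_eq, @eq_comm _ c]
      rw [h₁]
      exact List.nodup_iff_count_le_one.1 hlv _
    omega

theorem mem_interval {a b t : ℕ} : t ∈ interval a b ↔ a ≤ t ∧ t ≤ b := by
  simp only [interval, List.mem_range'_1]
  omega

theorem mem_levels {Ts Te : ℕ} {c : Time} :
    c ∈ levels Ts Te ↔ ∀ t : ℕ, c = WithTop.some t → Ts ≤ t ∧ t ≤ Te := by
  unfold levels
  induction c using WithTop.recTopCoe with
  | top => simp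
  | coe c =>
    simp only [List.mem_cons, List.mem_map, List.mem_reverse, mem_interval]
    constructor
    · rintro (h | ⟨t, ht, h⟩) u hu
      · simp at h
      · have := WithTop.coe_injective (h.trans hu)
        omega
    · intro h
      exact .inr ⟨c, h c rfl, rfl⟩

theorem levels_sorted (Ts Te : ℕ) : (levels Ts Te).Pairwise (· > ·) := by
  unfold levels interval
  rw [List.pairwise_cons, List.pairwise_map, List.pairwise_reverse]
  refine ⟨?_, ?_⟩
  · simp only [List.mem_map, gt_iff_lt, forall_exists_index, and_imp]
    rintro _ t _ rfl
    exact WithTop.coe_lt_top t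
  · exact (List.pairwise_lt_range' (s := Ts) (n := Te + 1 - Ts)).imp fun h =>
      WithTop.coe_lt_coe.2 h

theorem levels_nodup (Ts Te : ℕ) : (levels Ts Te).Nodup :=
  (levels_sorted Ts Te).imp fun h => ne_of_gt h

theorem levels_length (Ts Te : ℕ) : (levels Ts Te).length = Te + 1 - Ts + 1 := by
  simp [levels, interval]

end Aux

end CoreT

namespace CoreT

open Timed

variable {V : Type} [LinearOrder V]

/-! ### Bucket sort -/

/-- Four steps per element: the loop head, one read, and a push, which is a read and a write.
Prepending reverses the order inside each bucket. -/
theorem wp_buckets {α β : Type} [DecidableEq β] (f : α → β) (l : List α) (n : ℕ)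
    (Q : (β → List α) → ℕ → Prop)
    (h : Q (fun c => (l.filter fun a => f a = c).reverse) (n + 4 * l.length + 1)) :
    wp (forEach l ((fun _ => []) : β → List α) fun a b => do
      let c ← read f a
      push b c a) n Q := by
  refine wp_forEach (fun r b m => ∃ p, l = p ++ r ∧
    b = (fun c => (p.filter fun a => f a = c).reverse) ∧ m + 4 * r.length = n + 4 * l.length)
    ⟨[], rfl, rfl, rfl⟩ ?_ ?_
  · rintro _ a r b m - ⟨p, hl, rfl, hm⟩
    simp only [wp_bind, wp_read, wp_push]
    refine ⟨p ++ [a], by simp [hl], ?_, by simp at hm; omega⟩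
    funext c
    by_cases hc : f a = c
    · subst hc
      simp [List.filter_append]
    · simp [List.filter_append, hc, Ne.symm hc]
  · rintro b m ⟨p, hl, rfl, hm⟩
    simp only [List.append_nil] at hl
    subst hl
    simp only [List.length_nil, mul_zero, add_zero] at hm
    exact hm ▸ h

/-- `inc` holds for every vertex the list of its incident edges in ascending order of `key`. -/
structure IsSortedIncidence (edges : List (Sym2 V)) (key : Sym2 V → Time)
    (inc : V → List (Sym2 V)) : Prop where
  nodup : ∀ v, (inc v).Nodup
  sorted : ∀ v, (inc v).Pairwise fun e e' => key e ≤ key e'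
  mem : ∀ v e, e ∈ inc v ↔ e ∈ edges ∧ v ∈ e

/-- The levels are visited in descending order and edges are prepended, so every incidence list
comes out ascending. An edge costs 4 steps for the bucket phase and 5 for the loop head and two
pushes; a level costs 3 for the outer head, the read and the end of the inner loop. -/
theorem wp_sortedIncidence {lv : List Time} {edges : List (Sym2 V)} {key : Sym2 V → Time} {n : ℕ}
    {Q : (V → List (Sym2 V)) → ℕ → Prop} (hlv : lv.Pairwise (· > ·)) (nodup : edges.Nodup)
    (loopless : ∀ e ∈ edges, ¬ e.IsDiag) (hkey : ∀ e ∈ edges, key e ∈ lv)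
    (h : ∀ inc m, IsSortedIncidence edges key inc →
      m ≤ n + 9 * edges.length + 3 * lv.length + 2 → Q inc m) :
    wp (sortedIncidence lv edges key) n Q := by
  rw [sortedIncidence, wp_bind]
  refine wp_buckets _ _ _ _ ?_
  let bucket : Time → List (Sym2 V) := fun c => (edges.filter fun e => key e = c).reverse
  have mem_bucket : ∀ c e, e ∈ bucket c ↔ e ∈ edges ∧ key e = c := by simp [bucket]
  have hsum := sum_length_buckets_le key edges (hlv.imp fun h => ne_of_gt h : lv.Nodup)
  refine wp_forEach (fun r inc m => (∀ v, (inc v).Nodup) ∧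
    (∀ v, (inc v).Pairwise fun e e' => key e ≤ key e') ∧
    (∀ v e, e ∈ inc v ↔ e ∈ edges ∧ v ∈ e ∧ key e ∉ r) ∧
    m + (3 * r.length + 5 * (r.map fun c => (edges.filter fun e => key e = c).length).sum) ≤
      n + 9 * edges.length + 3 * lv.length + 1) ?_ ?_ ?_
  · refine ⟨by simp, by simp, fun v e => ?_, by omega⟩
    simpa using fun he _ => hkey e he
  · rintro p c r inc m hl ⟨h₁, h₂, h₃, hm⟩
    simp only [wp_bind, wp_read]
    -- Keys already distributed belong to levels visited earlier, hence to larger ones.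
    have hbound : ∀ d, d ∉ c :: r → d ∈ lv → c ≤ d := by
      intro d hd hd'
      rw [hl, List.mem_append] at hd'
      rw [hl] at hlv
      exact ((List.pairwise_append.1 hlv).2.2 d (hd'.resolve_right hd) c (by simp)).le
    have hc : c ∉ r := by
      rw [hl] at hlv
      intro hc
      exact absurd ((List.pairwise_cons.1 (List.pairwise_append.1 hlv).2.1).1 c hc) (lt_irrefl _)
    refine wp_forEach (fun b inc m => (∀ v, (inc v).Nodup) ∧
      (∀ v, (inc v).Pairwise fun e e' => key e ≤ key e') ∧
      (∀ v e, e ∈ inc v ↔ e ∈ edges ∧ v ∈ e ∧ key e ∉ r ∧ e ∉ b) ∧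
      m + 1 + (3 * r.length + 5 * (b.length +
        (r.map fun c => (edges.filter fun e => key e = c).length).sum)) ≤
      n + 9 * edges.length + 3 * lv.length + 1) ⟨h₁, h₂, fun v e => ?_, ?_⟩ ?_ ?_
    · change e ∈ inc v ↔ e ∈ edges ∧ v ∈ e ∧ key e ∉ r ∧ e ∉ bucket c
      rw [h₃, mem_bucket, List.mem_cons]
      tauto
    · simp only [List.length_cons, List.map_cons, List.sum_cons, List.length_reverse] at hm ⊢
      omega
    · rintro q e b inc m hb ⟨h₁, h₂, h₃, hm⟩
      simp only [wp_bind, wp_push]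
      have he : e ∈ edges ∧ key e = c := (mem_bucket c e).1 (by simp [bucket, hb])
      have hne := inf_ne_sup (loopless e he.1)
      have hb' : (q ++ e :: b).Nodup := hb ▸ (List.nodup_reverse.2 (nodup.filter _))
      have heb : e ∉ b := (List.nodup_cons.1 (List.nodup_append.1 hb').2.1).1
      have hval : ∀ v, Function.update (Function.update inc e.inf (e :: inc e.inf)) e.sup
          (e :: Function.update inc e.inf (e :: inc e.inf) e.sup) v =
          if v ∈ e then e :: inc v else inc v := by
        intro v
        rw [Function.update_of_ne hne.symm]
        by_cases h₁ : v = e.sup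
        · subst h₁
          simp [sup_mem]
        · rw [Function.update_of_ne h₁]
          by_cases h₂ : v = e.inf
          · subst h₂
            simp [inf_mem]
          · rw [Function.update_of_ne h₂, if_neg]
            rw [mem_iff_inf_or_sup]
            tauto
      refine ⟨fun v => ?_, fun v => ?_, fun v e' => ?_, ?_⟩
      · rw [hval]
        split_ifs with hv
        · refine List.nodup_cons.2 ⟨fun h => ?_, h₁ v⟩
          exact ((h₃ v e).1 h).2.2.2 (by simp)
        · exact h₁ v
      · rw [hval]
        split_ifs with hv
        · refine List.pairwise_cons.2 ⟨fun e' h => ?_, h₂ v⟩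
          obtain ⟨he', -, hr, -⟩ := (h₃ v e').1 h
          rw [he.2]
          by_cases hd : key e' = c
          · exact hd.ge
          · exact hbound _ (by simp [hd, hr]) (hkey _ he')
        · exact h₂ v
      · rw [hval]
        by_cases hee : e' = e
        · subst hee
          split_ifs with hv
          · simp [hv, he, heb, hc]
          · simp [h₃, hv]
        · split_ifs with hv
          · simp [h₃, hee]
          · simp [h₃, hee]
      · simp only [List.length_cons] at hm
        omega
    · rintro inc m ⟨h₁, h₂, h₃, hm⟩
      refine ⟨h₁, h₂, fun v e => by simp [h₃], ?_⟩
      simp only [List.length_nil] at hm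
      omega
  · rintro inc m ⟨h₁, h₂, h₃, hm⟩
    refine h inc _ ⟨h₁, h₂, fun v e => by simp [h₃]⟩ ?_
    simp only [List.length_nil, List.map_nil, List.sum_nil] at hm
    omega

/-- Double counting: an edge has at most two endpoints. -/
theorem IsSortedIncidence.sum_length_le {edges : List (Sym2 V)} {key : Sym2 V → Time}
    {inc : V → List (Sym2 V)} (h : IsSortedIncidence edges key inc) (nodup : edges.Nodup)
    (verts : Finset V) : ∑ v ∈ verts, (inc v).length ≤ 2 * edges.length := by
  have h₁ : ∀ v ∈ verts, (inc v).length =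
      ∑ e ∈ edges.toFinset, if v ∈ e.toFinset then 1 else 0 := by
    intro v _
    rw [← List.toFinset_card_of_nodup (h.nodup v), Finset.sum_boole, Nat.cast_id]
    congr 1
    ext e
    simp [h.mem]
  rw [Finset.sum_congr rfl h₁, Finset.sum_comm]
  calc _ ≤ ∑ e ∈ edges.toFinset, 2 := by
        refine Finset.sum_le_sum fun e _ => ?_
        rw [Finset.sum_boole, Nat.cast_id]
        refine (Finset.card_le_card (t := e.toFinset) ?_).trans ?_
        · intro v
          simp
        · rw [← mk_inf_sup e, Sym2.toFinset_mk_eq]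
          exact Finset.card_le_two
    _ = 2 * edges.length := by
        rw [Finset.sum_const, List.toFinset_card_of_nodup nodup, smul_eq_mul, mul_comm]

end CoreT

namespace CoreT

open Timed

variable {V : Type} [LinearOrder V]

/-! ### The `k`-th smallest key -/

open Classical in
/-- The number of edges in `E` at `v` that satisfy `P`. -/
noncomputable def deg (E : Finset (Sym2 V)) (v : V) (P : Sym2 V → Prop) : ℕ :=
  (E.filter fun e => v ∈ e ∧ P e).card

theorem deg_mono {E : Finset (Sym2 V)} {v : V} {P P' : Sym2 V → Prop}
    (h : ∀ e ∈ E, v ∈ e → P e → P' e) : deg E v P ≤ deg E v P' := by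
  classical
  refine Finset.card_le_card fun e he => ?_
  simp only [Finset.mem_filter] at he ⊢
  exact ⟨he.1, he.2.1, h e he.1 he.2.1 he.2.2⟩

theorem exists_of_deg_lt {E : Finset (Sym2 V)} {v : V} {P P' : Sym2 V → Prop}
    (h : deg E v P' < deg E v P) : ∃ e ∈ E, v ∈ e ∧ P e ∧ ¬ P' e := by
  by_contra! H
  exact absurd (deg_mono (fun e he hv hP => H e he hv hP)) h.not_ge

theorem exists_of_deg_pos {E : Finset (Sym2 V)} {v : V} {P : Sym2 V → Prop}
    (h : 0 < deg E v P) : ∃ e ∈ E, v ∈ e ∧ P e := by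
  classical
  obtain ⟨e, he⟩ := Finset.card_pos.1 h
  simp only [Finset.mem_filter] at he
  exact ⟨e, he⟩

/-- The data kept by `Kth` for a vertex with sorted incidence list `l` are correct, if the edges
that satisfy `del` are deleted. -/
def IsKth (k : ℕ) (key : Sym2 V → Time) (l : List (Sym2 V)) (del : Sym2 V → Bool)
    (rest : List (Sym2 V)) (scanned : Sym2 V → Bool) (val : Time) : Prop :=
  ∃ p, l = p ++ rest ∧ (∀ e ∈ l, del e = false → (scanned e = true ↔ e ∈ p)) ∧
    (((p.filter fun e => !del e).length = k ∧
        (∃ e ∈ p, del e = false ∧ key e = val) ∧ ∀ e ∈ p, key e ≤ val) ∨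
      (rest = [] ∧ val = ⊤ ∧ (p.filter fun e => !del e).length < k))

/-- The data kept by `K` for the vertex `v` are correct. -/
def Kth.ValidAt (k : ℕ) (key : Sym2 V → Time) (inc : V → List (Sym2 V)) (del : Sym2 V → Bool)
    (K : Kth V) (v : V) : Prop :=
  IsKth k key (inc v) del (K.rest v) (fun e => K.scanned (v, e)) (K.val v)

/-- `K` and `K'` hold the same data for the vertex `v`. -/
def Kth.SameAt (K K' : Kth V) (v : V) : Prop :=
  K'.rest v = K.rest v ∧ (∀ e, K'.scanned (v, e) = K.scanned (v, e)) ∧ K'.val v = K.val v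

theorem Kth.ValidAt.of_sameAt {k : ℕ} {key : Sym2 V → Time} {inc : V → List (Sym2 V)}
    {del del' : Sym2 V → Bool} {K K' : Kth V} {v : V} (h : K.ValidAt k key inc del v)
    (hK : K.SameAt K' v) (hdel : ∀ e ∈ inc v, del' e = del e) : K'.ValidAt k key inc del' v := by
  obtain ⟨p, hl, hs, h⟩ := h
  have hf : p.filter (fun e => !del' e) = p.filter (fun e => !del e) :=
    List.filter_congr fun e he => by rw [hdel e (by simp [hl, he])]
  unfold Kth.ValidAt IsKth
  rw [hK.1, hK.2.2]
  refine ⟨p, hl, fun e he hd => ?_, ?_⟩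
  · change K'.scanned (v, e) = true ↔ e ∈ p
    rw [hK.2.1]
    exact hs e he (hdel e he ▸ hd)
  · rw [hf]
    refine h.imp (fun h => ⟨h.1, ?_, h.2.2⟩) id
    obtain ⟨e, he, hd, hk⟩ := h.2.1
    exact ⟨e, he, by rw [hdel e (by simp [hl, he]), hd], hk⟩

theorem Kth.ValidAt.rest_length_le {k : ℕ} {key : Sym2 V → Time} {inc : V → List (Sym2 V)}
    {del : Sym2 V → Bool} {K : Kth V} {v : V} (h : K.ValidAt k key inc del v) :
    (K.rest v).length ≤ (inc v).length := by
  obtain ⟨p, hl, -⟩ := h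
  simp [hl]

theorem Kth.ValidAt.val_eq {k : ℕ} {key : Sym2 V → Time} {inc : V → List (Sym2 V)}
    {del : Sym2 V → Bool} {K : Kth V} {v : V} (h : K.ValidAt k key inc del v) :
    K.val v = ⊤ ∨ ∃ e ∈ inc v, key e = K.val v := by
  obtain ⟨p, hl, -, ⟨-, ⟨e, he, -, hk⟩, -⟩ | h⟩ := h
  · exact .inr ⟨e, by simp [hl, he], hk⟩
  · exact .inl h.2.1

/-- This is the only interface through which the pointer structure enters the correctness proofs. If
`val` exceeds `t`, sortedness puts all live edges with key at most `t` into the scanned prefix. That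
prefix has `k` live edges of which one has key `val`, or it is the whole list and has fewer than
`k`. The bound `t` must be finite, since `val = ⊤` also stands for an exhausted list. -/
theorem Kth.ValidAt.val_le_iff {k : ℕ} {edges : List (Sym2 V)} {key : Sym2 V → Time}
    {inc : V → List (Sym2 V)} {del : Sym2 V → Bool} {K : Kth V} {v : V}
    (h : K.ValidAt k key inc del v) (hinc : IsSortedIncidence edges key inc) (t : ℕ) :
    K.val v ≤ WithTop.some t ↔
      k ≤ deg edges.toFinset v fun e => del e = false ∧ key e ≤ WithTop.some t := by
  classical
  obtain ⟨p, hl, -, h⟩ := h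
  have hnd := hinc.nodup v
  have hsort := hinc.sorted v
  have hmem := hinc.mem v
  rw [hl] at hnd hsort
  have hnd' : (p.filter fun e => !del e).Nodup := (List.nodup_append.1 hnd).1.filter _
  constructor
  · intro hv
    unfold deg
    obtain ⟨hk, -, hle⟩ | ⟨-, hv', -⟩ := h
    · rw [← hk, ← List.toFinset_card_of_nodup hnd']
      refine Finset.card_le_card fun e => ?_
      simp only [List.mem_toFinset, List.mem_filter, Finset.mem_filter, Bool.not_eq_true']
      rintro ⟨hp, hd⟩
      have := (hmem e).1 (by simp [hl, hp])
      exact ⟨this.1, this.2, hd, (hle e hp).trans hv⟩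
    · rw [hv'] at hv
      exact absurd hv (by simp)
  · intro hk
    by_contra hv
    push Not at hv
    obtain ⟨hk', ⟨e₀, he₀, hd₀, hk₀⟩, hle⟩ | ⟨hr, -, hk'⟩ := h
    · have : (deg edges.toFinset v fun e => del e = false ∧ key e ≤ WithTop.some t) <
          (p.filter fun e => !del e).toFinset.card := by
        unfold deg
        refine Finset.card_lt_card (Finset.ssubset_iff_of_subset ?_ |>.2 ⟨e₀, ?_, ?_⟩)
        · intro e
          simp only [List.mem_toFinset, List.mem_filter, Finset.mem_filter, Bool.not_eq_true']
          rintro ⟨he, hve, hd, ht⟩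
          refine ⟨?_, hd⟩
          have := (hmem e).2 ⟨he, hve⟩
          rw [hl, List.mem_append] at this
          refine this.resolve_right fun hr => ?_
          have := (List.pairwise_append.1 hsort).2.2 e₀ he₀ e hr
          exact absurd (hv.trans_le (hk₀ ▸ this)) ht.not_gt
        · simp [he₀, hd₀]
        · simp only [Finset.mem_filter, not_and]
          exact fun _ _ _ => hk₀ ▸ hv.not_ge
      rw [List.toFinset_card_of_nodup hnd'] at this
      omega
    · have : (deg edges.toFinset v fun e => del e = false ∧ key e ≤ WithTop.some t) ≤
          (p.filter fun e => !del e).toFinset.card := by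
        unfold deg
        refine Finset.card_le_card fun e => ?_
        simp only [List.mem_toFinset, List.mem_filter, Finset.mem_filter, Bool.not_eq_true']
        rintro ⟨he, hve, hd, ht⟩
        refine ⟨?_, hd⟩
        have := (hmem e).2 ⟨he, hve⟩
        simpa [hl, hr] using this
      rw [List.toFinset_card_of_nodup hnd'] at this
      omega

/-- Induction over the unscanned list, with `p` the prefix scanned so far and `j` the number of
edges still to scan. Nothing is known about `val` while `p` is empty; `1 ≤ k` excludes stopping
there. -/
theorem wp_scan {k : ℕ} {key : Sym2 V → Time} {inc : V → List (Sym2 V)} {v : V} {n : ℕ}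
    {Q : Kth V → ℕ → Prop} (nodup : (inc v).Nodup)
    (sorted : (inc v).Pairwise fun e e' => key e ≤ key e') {j : ℕ} {p r : List (Sym2 V)}
    {K : Kth V} (hl : inc v = p ++ r) (hs : ∀ e ∈ inc v, (K.scanned (v, e) = true ↔ e ∈ p))
    (hj : p.length + j = k) (hk : 1 ≤ k)
    (hv : p ≠ [] → (∃ e ∈ p, key e = K.val v) ∧ ∀ e ∈ p, key e ≤ K.val v)
    (h : ∀ K' m, K'.deleted = K.deleted → K'.ValidAt k key inc (fun _ => false) v →
      (∀ w, w ≠ v → K.SameAt K' w) → m ≤ n + 3 * r.length + 2 → Q K' m) :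
    wp (Kth.scan key v j r K) n Q := by
  induction r generalizing j p K n with
  | nil =>
    cases j with
    | zero =>
      simp only [Kth.scan, wp_bind, wp_write, wp_pure]
      have hp : p ≠ [] := by
        rintro rfl
        simp at hj
        omega
      refine h _ _ rfl ⟨p, by simpa using hl, fun e he _ => hs e he, .inl ⟨?_, ?_, (hv hp).2⟩⟩
        (fun w hw => ⟨by simp [hw], by simp, rfl⟩) (by omega)
      · simpa using hj
      · obtain ⟨e, he, hk⟩ := (hv hp).1
        exact ⟨e, he, rfl, hk⟩
    | succ j =>
      simp only [Kth.scan, wp_bind, wp_write, wp_pure]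
      refine h _ _ rfl ⟨p, by simpa using hl, fun e he _ => hs e he, .inr ⟨?_, ?_, ?_⟩⟩
        (fun w hw => ⟨by simp [hw], by simp, by simp [hw]⟩) (by omega)
      · simp
      · simp
      · simp
        omega
  | cons e r ih =>
    cases j with
    | zero =>
      simp only [Kth.scan, wp_bind, wp_write, wp_pure]
      have hp : p ≠ [] := by
        rintro rfl
        simp at hj
        omega
      refine h _ _ rfl ⟨p, by simpa using hl, fun e he _ => hs e he, .inl ⟨?_, ?_, (hv hp).2⟩⟩
        (fun w hw => ⟨by simp [hw], by simp, rfl⟩) (by omega)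
      · simpa using hj
      · obtain ⟨e, he, hk⟩ := (hv hp).1
        exact ⟨e, he, rfl, hk⟩
    | succ j =>
      simp only [Kth.scan, wp_bind, wp_write, wp_read]
      rw [hl] at sorted nodup
      have hle : ∀ e' ∈ p, key e' ≤ key e := fun e' he' =>
        (List.pairwise_append.1 sorted).2.2 e' he' e (by simp)
      refine ih (p := p ++ [e]) (by simp [hl]) ?_ (by simp; omega) ?_ ?_
      · intro e' he'
        by_cases hee : e' = e
        · simp [hee]
        · simp [hee, hs e' he']
      · intro _
        simp only [Function.update_self]
        refine ⟨⟨e, by simp, rfl⟩, fun e' he' => ?_⟩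
        rw [List.mem_append, List.mem_singleton] at he'
        obtain he' | rfl := he'
        exacts [hle e' he', le_rfl]
      · intro K' m h₁ h₂ h₃ h₄
        refine h K' m h₁ h₂ (fun w hw => ?_) ?_
        · obtain ⟨ha, hb, hc⟩ := h₃ w hw
          exact ⟨ha, fun e => (hb e).trans (by simp [hw]), hc.trans (by simp [hw])⟩
        · simp only [List.length_cons]
          omega

theorem wp_make {k : ℕ} (hk : 1 ≤ k) {edges : List (Sym2 V)} {key : Sym2 V → Time}
    {verts : List V} {inc : V → List (Sym2 V)} (hinc : IsSortedIncidence edges key inc)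
    (nodup : verts.Nodup) {n : ℕ} {Q : Kth V → ℕ → Prop}
    (h : ∀ K m, K.deleted = (fun _ => false) →
      (∀ v ∈ verts, K.ValidAt k key inc (fun _ => false) v) →
      m ≤ n + 3 * (∑ v ∈ verts.toFinset, (inc v).length) + 4 * verts.length + 1 → Q K m) :
    wp (Kth.make k key verts inc) n Q := by
  rw [List.sum_toFinset _ nodup] at h
  refine wp_forEach (fun r K m => K.deleted = (fun _ => false) ∧
    (∀ v ∈ verts, v ∉ r → K.ValidAt k key inc (fun _ => false) v) ∧
    (∀ v ∈ r, ∀ e, K.scanned (v, e) = false) ∧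
    m + (3 * (r.map fun v => (inc v).length).sum + 4 * r.length) ≤
      n + 3 * (verts.map fun v => (inc v).length).sum + 4 * verts.length) ?_ ?_ ?_
  · exact ⟨rfl, fun v hv hv' => absurd hv hv', by simp, by omega⟩
  · rintro p v r K m hl ⟨hd, h₁, h₂, hm⟩
    simp only [wp_bind, wp_read]
    have hvr : v ∉ r := by
      rw [hl] at nodup
      exact (List.nodup_cons.1 (List.nodup_append.1 nodup).2.1).1
    refine wp_scan (k := k) (hinc.nodup v) (hinc.sorted v) (p := []) rfl ?_ (by simp) hk (by simp)
      ?_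
    · intro e _
      simp [h₂ v (by simp)]
    · intro K' m' h₃ h₄ h₅ h₆
      refine ⟨h₃.trans hd, fun w hw hwr => ?_, fun w hw e => ?_, ?_⟩
      · by_cases hwv : w = v
        · exact hwv ▸ h₄
        · exact (h₁ w hw (by simp [hwv, hwr])).of_sameAt (h₅ w hwv) fun _ _ => rfl
      · rw [(h₅ w (fun h => hvr (h ▸ hw))).2.1]
        exact h₂ w (by simp [hw]) e
      · simp only [List.map_cons, List.sum_cons, List.length_cons] at hm
        omega
  · rintro K m ⟨hd, h₁, -, hm⟩
    simp only [List.map_nil, List.sum_nil, List.length_nil] at hm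
    exact h K _ hd (fun v hv => h₁ v hv (by simp)) (by omega)

/-- The scan resumes when the prefix has lost one live edge. A skipped deleted edge costs one step
and leaves the unscanned list for good, so the counter plus the length of that list grows by at most
5. The program may read keys from a newer array `key'`; it has to agree with `key` only on live
edges, because only their keys are read. -/
theorem wp_next {k : ℕ} {key : Sym2 V → Time} {inc : V → List (Sym2 V)} {v : V} {n : ℕ}
    {Q : Kth V → ℕ → Prop} (nodup : (inc v).Nodup) {key' : Sym2 V → Time}
    (sorted : (inc v).Pairwise fun e e' => key e ≤ key e') {p r : List (Sym2 V)}
    {K : Kth V} (hl : inc v = p ++ r)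
    (hs : ∀ e ∈ inc v, K.deleted e = false → (K.scanned (v, e) = true ↔ e ∈ p))
    (hkey : ∀ e ∈ inc v, K.deleted e = false → key' e = key e)
    (hp : (p.filter fun e => !K.deleted e).length < k)
    (hp' : r ≠ [] → (p.filter fun e => !K.deleted e).length + 1 = k)
    (h : ∀ K' m, K'.deleted = K.deleted → K'.ValidAt k key inc K.deleted v →
      (∀ w, w ≠ v → K.SameAt K' w) → n ≤ m → m + (K'.rest v).length ≤ n + 5 + r.length → Q K' m) :
    wp (Kth.next key' v r K) n Q := by
  induction r generalizing p n with
  | nil =>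
    simp only [Kth.next, wp_bind, wp_write, wp_pure]
    exact h _ _ rfl ⟨p, by simpa using hl, fun e he hd => hs e he hd, .inr ⟨by simp, by simp, hp⟩⟩
      (fun w hw => ⟨by simp [hw], by simp, by simp [hw]⟩) (by omega) (by simp)
  | cons e r ih =>
    simp only [Kth.next, wp_bind, wp_read]
    by_cases hd : K.deleted e = true
    · simp only [hd, if_true]
      have hf : (p ++ [e]).filter (fun e => !K.deleted e) = p.filter fun e => !K.deleted e := by
        simp [hd]
      refine ih (p := p ++ [e]) (by simp [hl]) ?_ (by rw [hf]; exact hp)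
        (fun _ => by rw [hf]; exact hp' (by simp)) ?_
      · intro e' he' hd'
        have : e' ≠ e := by
          rintro rfl
          simp [hd] at hd'
        simp [hs e' he' hd', this]
      · intro K' m h₁ h₂ h₃ h₄ h₅
        refine h K' m h₁ h₂ h₃ (by omega) ?_
        simp only [List.length_cons]
        omega
    · simp only [hd, Bool.false_eq_true, if_false, wp_bind, wp_write, wp_read, wp_pure]
      simp only [Bool.not_eq_true] at hd
      have hk := hkey e (by simp [hl]) hd
      rw [hl] at sorted nodup
      have hle : ∀ e' ∈ p, key e' ≤ key e := fun e' he' =>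
        (List.pairwise_append.1 sorted).2.2 e' he' e (by simp)
      refine h _ _ rfl ⟨p ++ [e], by simp [hl], fun e' he' hd' => ?_, .inl ⟨?_, ?_, ?_⟩⟩
        (fun w hw => ⟨by simp [hw], by simp [hw], by simp [hw]⟩) (by omega) ?_
      · by_cases hee : e' = e
        · simp [hee]
        · simp [hee, hs e' he' hd']
      · simpa [hd] using hp' (by simp)
      · exact ⟨e, by simp, hd, by simp [hk]⟩
      · intro e' he'
        simp only [Function.update_self, hk]
        rw [List.mem_append, List.mem_singleton] at he'
        obtain he' | rfl := he'
        exacts [hle e' he', le_rfl]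
      · simp only [Function.update_self, List.length_cons]
        omega

/-- Deleting an unscanned edge does not affect the prefix. Deleting a scanned one leaves `k - 1`
live edges in it (or fewer, if the list is exhausted), and the next live edge takes over. The bound
is that of `wp_next` plus two reads. -/
theorem wp_drop {k : ℕ} {edges : List (Sym2 V)} {key : Sym2 V → Time}
    {inc : V → List (Sym2 V)} (hinc : IsSortedIncidence edges key inc) {v : V} {e : Sym2 V} {n : ℕ}
    {Q : Kth V → ℕ → Prop} {K : Kth V} {del : Sym2 V → Bool} {key' : Sym2 V → Time}
    (hkey : ∀ e ∈ inc v, K.deleted e = false → key' e = key e) (he : e ∈ inc v)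
    (hde : del e = false) (hK : K.deleted = Function.update del e true)
    (valid : K.ValidAt k key inc del v)
    (h : ∀ K' m, K'.deleted = K.deleted → K'.ValidAt k key inc K.deleted v →
      (∀ w, w ≠ v → K.SameAt K' w) → n ≤ m →
      m + (K'.rest v).length ≤ n + 7 + (K.rest v).length → Q K' m) :
    wp (Kth.drop key' K v e) n Q := by
  simp only [Kth.drop, wp_bind, wp_read]
  have nodup := hinc.nodup v
  obtain ⟨p, hl, hs, hp⟩ := valid
  have hs' : ∀ e ∈ inc v, K.deleted e = false → (K.scanned (v, e) = true ↔ e ∈ p) := by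
    intro e' he' hd
    rw [hK] at hd
    by_cases hee : e' = e
    · simp [hee] at hd
    · rw [Function.update_of_ne hee] at hd
      exact hs e' he' hd
  by_cases hsc : K.scanned (v, e) = true
  · simp only [hsc, if_true, wp_bind, wp_read]
    have hep : e ∈ p := (hs e he hde).1 hsc
    -- The list has no repetitions, so exactly one live edge disappears from the prefix.
    have hf : (p.filter fun e => !K.deleted e).length + 1 = (p.filter fun e => !del e).length := by
      obtain ⟨a, b, rfl⟩ := List.append_of_mem hep
      rw [hl] at nodup
      have hnd := (List.nodup_append.1 nodup).1
      have hea : e ∉ a := fun ha => (List.nodup_append.1 hnd).2.2 e ha e (by simp) rfl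
      have heb : e ∉ b := (List.nodup_cons.1 (List.nodup_append.1 hnd).2.1).1
      have ha : a.filter (fun e => !K.deleted e) = a.filter (fun e => !del e) :=
        List.filter_congr fun x hx => by
          rw [hK, Function.update_of_ne (ne_of_mem_of_not_mem hx hea)]
      have hb : b.filter (fun e => !K.deleted e) = b.filter (fun e => !del e) :=
        List.filter_congr fun x hx => by
          rw [hK, Function.update_of_ne (ne_of_mem_of_not_mem hx heb)]
      have hKe : K.deleted e = true := by simp [hK]
      simp only [List.filter_append, List.filter_cons, hKe, hde, ha, hb, Bool.not_true,
        Bool.not_false, if_true, Bool.false_eq_true, if_false, List.length_append, List.length_cons]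
      omega
    refine wp_next (k := k) nodup (hinc.sorted v) hl hs' hkey ?_ ?_ ?_
    · obtain hp | hp := hp
      · have := hp.1
        omega
      · have := hp.2.2
        omega
    · intro hr
      obtain hp | hp := hp
      · have := hp.1
        omega
      · exact absurd hp.1 hr
    · intro K' m h₁ h₂ h₃ h₄ h₅
      exact h K' m h₁ h₂ h₃ (by omega) (by omega)
  · simp only [hsc, Bool.false_eq_true, if_false, wp_pure]
    have hep : e ∉ p := fun hp => hsc ((hs e he hde).2 hp)
    have hf : p.filter (fun e => !K.deleted e) = p.filter (fun e => !del e) :=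
      List.filter_congr fun x hx => by
        rw [hK, Function.update_of_ne (ne_of_mem_of_not_mem hx hep)]
    refine h K _ rfl ⟨p, hl, hs', .inl ?_⟩ (fun w _ => ⟨rfl, fun _ => rfl, rfl⟩) (by omega)
      (by omega)
    obtain ⟨hk, ⟨x, hx, hd, hkx⟩, hle⟩ | hp := hp
    · rw [hf]
      refine ⟨hk, ⟨x, hx, ?_, hkx⟩, hle⟩
      rw [hK, Function.update_of_ne (ne_of_mem_of_not_mem hx hep)]
      exact hd
    -- In an exhausted list every edge has been scanned, contrary to the case assumption.
    · rw [hl, hp.1, List.append_nil] at he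
      exact absurd he hep

end CoreT

namespace CoreT

open Timed

variable {V : Type} [LinearOrder V]

/-! ### Cores of static graphs -/

/-- Every vertex of `W` has at least `k` incident edges with support time at most `c` that stay
inside `W`. -/
def Cohesive (k : ℕ) (E : Finset (Sym2 V)) (sup : Sym2 V → Time) (c : Time) (W : Set V) : Prop :=
  ∀ v ∈ W, k ≤ deg E v fun e => sup e ≤ c ∧ ∀ u ∈ e, u ∈ W

/-- `v` is in the `k`-core of the graph of the edges with support time at most `c`. -/
def InCore (k : ℕ) (E : Finset (Sym2 V)) (sup : Sym2 V → Time) (c : Time) (v : V) : Prop :=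
  ∃ W, Cohesive k E sup c W ∧ v ∈ W

/-- `σ` assigns to every vertex its `k`-core time. -/
def IsCoreTime (k : ℕ) (E : Finset (Sym2 V)) (sup : Sym2 V → Time) (σ : V → Time) : Prop :=
  ∀ (c : ℕ) (v : V), σ v ≤ WithTop.some c ↔ InCore k E sup (WithTop.some c) v

variable {k : ℕ} {E : Finset (Sym2 V)} {sup : Sym2 V → Time}

/-- The union of all cohesive sets is cohesive: enlarging the set only adds admissible edges. -/
theorem cohesive_inCore (c : Time) : Cohesive k E sup c {v | InCore k E sup c v} := by
  rintro v ⟨W, hW, hv⟩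
  exact (hW v hv).trans (deg_mono fun e _ _ h => ⟨h.1, fun u hu => ⟨W, hW, h.2 u hu⟩⟩)

theorem Cohesive.mono {E' : Finset (Sym2 V)} {sup' : Sym2 V → Time} {c c' : Time} {W : Set V}
    (h : Cohesive k E sup c W) (hE : ∀ e ∈ E, sup e ≤ c → e ∈ E' ∧ sup' e ≤ c') :
    Cohesive k E' sup' c' W := by
  classical
  intro v hv
  refine (h v hv).trans (Finset.card_le_card fun e he => ?_)
  simp only [Finset.mem_filter] at he ⊢
  have := hE e he.1 he.2.2.1
  exact ⟨this.1, he.2.1, this.2, he.2.2.2⟩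

theorem InCore.mono {E' : Finset (Sym2 V)} {sup' : Sym2 V → Time} {c c' : Time} {v : V}
    (h : InCore k E sup c v) (hE : ∀ e ∈ E, sup e ≤ c → e ∈ E' ∧ sup' e ≤ c') :
    InCore k E' sup' c' v := by
  obtain ⟨W, hW, hv⟩ := h
  exact ⟨W, hW.mono hE, hv⟩

/-- Since `k` is positive, core vertices are not isolated; this is why storing the non-isolated
vertices suffices. -/
theorem InCore.exists_edge (hk : 1 ≤ k) {c : Time} {v : V} (h : InCore k E sup c v) :
    ∃ e ∈ E, v ∈ e ∧ sup e ≤ c := by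
  obtain ⟨W, hW, hv⟩ := h
  obtain ⟨e, he, hve, hs, -⟩ := exists_of_deg_pos (hk.trans (hW v hv))
  exact ⟨e, he, hve, hs⟩

/-- Membership in the core is monotone in `c`, so the least finite `c` works. This supplies the
target values for the propagation loop before they have been computed. -/
theorem exists_isCoreTime (k : ℕ) (E : Finset (Sym2 V)) (sup : Sym2 V → Time) :
    ∃ σ, IsCoreTime k E sup σ := by
  classical
  refine ⟨fun v => if h : ∃ c : ℕ, InCore k E sup (WithTop.some c) v then
    WithTop.some (Nat.find h) else ⊤, fun c v => ?_⟩
  dsimp only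
  split_ifs with h
  · rw [WithTop.coe_le_coe, Nat.find_le_iff]
    constructor
    · rintro ⟨m, hm, h⟩
      exact h.mono fun e he hs => ⟨he, hs.trans (WithTop.coe_le_coe.2 hm)⟩
    · exact fun h => ⟨c, le_rfl, h⟩
  · exact ⟨fun h => absurd h (by simp), fun h' => absurd ⟨c, h'⟩ h⟩

/-- No edge has support time before `Ts`, and past `Te` no finite support time is added, so the core
no longer changes. Hence all core times are indices of buckets. -/
theorem IsCoreTime.mem_levels (hk : 1 ≤ k) {σ : V → Time} (h : IsCoreTime k E sup σ)
    {Ts Te : ℕ} (hsup : ∀ e ∈ E, sup e ∈ levels Ts Te) (v : V) : σ v ∈ levels Ts Te := by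
  rw [CoreT.mem_levels]
  intro t ht
  have hc := (h t v).1 ht.le
  have hTs : Ts ≤ t := by
    obtain ⟨e, he, -, hs⟩ := hc.exists_edge hk
    obtain ⟨u, hu⟩ := WithTop.ne_top_iff_exists.1 (ne_top_of_le_ne_top (by simp) hs)
    have := CoreT.mem_levels.1 (hsup e he) u hu.symm
    rw [← hu, WithTop.coe_le_coe] at hs
    exact this.1.trans hs
  refine ⟨hTs, ?_⟩
  by_contra! hlt
  have : InCore k E sup (WithTop.some Te) v := hc.mono fun e he hs => by
    obtain ⟨u, hu⟩ := WithTop.ne_top_iff_exists.1 (ne_top_of_le_ne_top (by simp) hs)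
    refine ⟨he, ?_⟩
    rw [← hu]
    exact WithTop.coe_le_coe.2 (CoreT.mem_levels.1 (hsup e he) u hu.symm).2
  have := (h Te v).2 this
  rw [ht, WithTop.coe_le_coe] at this
  omega

theorem Kth.ValidAt.val_mem {inc : V → List (Sym2 V)} {key : Sym2 V → Time}
    {edges : List (Sym2 V)} {del : Sym2 V → Bool} {K : Kth V} {v : V}
    (h : K.ValidAt k key inc del v) (hinc : IsSortedIncidence edges key inc)
    {Ts Te : ℕ} (hkey : ∀ e ∈ edges, key e ∈ levels Ts Te) : K.val v ∈ levels Ts Te := by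
  obtain h | ⟨e, he, h⟩ := h.val_eq
  · rw [h]
    simp [levels]
  · exact h ▸ hkey e ((hinc.mem v e).1 he).1

/-- Core times and `Kth.val` are characterised only by their finite upper bounds; this turns such
characterisations into inequalities in `Time`. -/
theorem le_of_forall_coe {a b : Time} (h : ∀ t : ℕ, b ≤ WithTop.some t → a ≤ WithTop.some t) :
    a ≤ b := by
  induction b using WithTop.recTopCoe with
  | top => exact le_top
  | coe t => exact h t le_rfl

/-- More deletions can only raise the `k`-th smallest key, so old queue entries are underestimates.
-/
theorem Kth.ValidAt.val_le_val {inc : V → List (Sym2 V)} {key : Sym2 V → Time}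
    {edges : List (Sym2 V)} {del del' : Sym2 V → Bool} {K K' : Kth V} {v : V}
    (h : K.ValidAt k key inc del v) (h' : K'.ValidAt k key inc del' v)
    (hinc : IsSortedIncidence edges key inc) (hdel : ∀ e, del' e = false → del e = false) :
    K.val v ≤ K'.val v := by
  refine le_of_forall_coe fun t ht => ?_
  rw [h.val_le_iff hinc]
  exact ((h'.val_le_iff hinc t).1 ht).trans (deg_mono fun e _ _ h => ⟨hdel e h.1, h.2⟩)

/-- The change of a potential when a single cell changes, written without subtraction. -/
theorem sum_add_eq_sum_add {ι : Type} {S : Finset ι} {i : ι} (hi : i ∈ S) {f g : ι → ℕ}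
    (h : ∀ j, j ≠ i → f j = g j) : ∑ j ∈ S, f j + g i = ∑ j ∈ S, g j + f i := by
  classical
  have : ∑ j ∈ S.erase i, f j = ∑ j ∈ S.erase i, g j :=
    Finset.sum_congr rfl fun j hj => h j (Finset.ne_of_mem_erase hj)
  rw [← Finset.add_sum_erase S f hi, ← Finset.add_sum_erase S g hi, this]
  omega

/-- What the procedures assume about a stored graph. -/
structure Store.WellFormed (G : Store V) (Ts Te : ℕ) : Prop where
  nodup_verts : G.verts.Nodup
  nodup_edges : G.edges.Nodup
  mem_verts : ∀ e ∈ G.edges, ∀ v ∈ e, v ∈ G.verts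
  loopless : ∀ e ∈ G.edges, ¬ e.IsDiag
  sup_mem : ∀ e ∈ G.edges, firstTime (G.times e) ∈ levels Ts Te

/-! ### The removal loop of `CoreT_Init` -/

/-- The invariant of the removal loop: `lv` are the levels that are still to be processed, and
`P e v` says that the deletion of `e` on account of the removal of `v` is pending. -/
structure InitInv (k : ℕ) (G : Store V) (sup : Sym2 V → Time) (inc : V → List (Sym2 V))
    (lv : List Time) (P : Sym2 V → V → Prop) (s : InitState V) : Prop where
  le_t : ∀ l ∈ lv, l ≤ s.t
  filed : ∀ v ∈ G.verts, s.removed v = false → v ∈ s.queue (min s.t (s.kth.val v))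
  entry : ∀ l, ∀ v ∈ s.queue l, l ∈ lv ∧ v ∈ G.verts ∧
    (s.removed v = false → l ≤ min s.t (s.kth.val v))
  valid : ∀ v ∈ G.verts, s.removed v = false → s.kth.ValidAt k sup inc s.kth.deleted v
  deleted : ∀ e ∈ G.edges, s.kth.deleted e = true → ∃ v ∈ e, s.removed v = true
  pending : ∀ e ∈ G.edges, ∀ v ∈ e, s.removed v = true → s.kth.deleted e = true ∨ P e v
  core_eq : ∀ v, s.removed v = false → s.core v = ⊤
  le_core : ∀ v, s.removed v = true → v ∈ G.verts ∧ s.t ≤ s.core v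
  outside : ∀ v, s.removed v = true → ∀ c : ℕ, WithTop.some c < s.core v →
    ¬ InCore k G.edges.toFinset sup (WithTop.some c) v
  inside : ∀ c : ℕ, s.t ≤ WithTop.some c → Cohesive k G.edges.toFinset sup (WithTop.some c)
    {v | v ∈ G.verts ∧ (s.removed v = false ∨ s.core v ≤ WithTop.some c)}

variable {G : Store V} {inc : V → List (Sym2 V)} {Ts Te : ℕ}

/-- A vertex may be filed several times. Entries of removed vertices are garbage, because `filed`
speaks only of unremoved ones. -/
theorem InitInv.skip {lv : List Time} {P : Sym2 V → V → Prop} {s : InitState V} {c : Time} {v : V}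
    {q : List V} (h : InitInv k G sup inc lv P s) (hq : s.queue c = v :: q)
    (hv : s.removed v = true) :
    InitInv k G sup inc lv P { s with queue := Function.update s.queue c q } where
  __ := h
  filed w hw hr := by
    have := h.filed w hw hr
    by_cases hc : min s.t (s.kth.val w) = c
    · rw [hc, hq, List.mem_cons] at this
      have hne : w ≠ v := by
        rintro rfl
        simp [hv] at hr
      simpa [hc] using this.resolve_left hne
    · simpa [hc] using this
  entry l w hw := by
    refine h.entry l w ?_
    by_cases hc : l = c
    · subst hc
      simp only [Function.update_self] at hw
      simp [hq, hw]
    · simpa [hc] using hw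

/-- The heart of the correctness of `CoreT_Init`: removing from the highest nonempty bucket
preserves both bounds on the core times. `outside` says that recorded core times are not too large,
`inside` that they are not too small. Edges at `v` whose deletion is not yet recorded become
pending. -/
theorem InitInv.remove {lv : List Time} {s : InitState V} {c : Time} {v : V} {q : List V}
    (hlv : ∀ l ∈ lv, l ≤ c)
    (hinc : IsSortedIncidence G.edges sup inc) (hG : G.WellFormed Ts Te)
    (h : InitInv k G sup inc lv (fun _ _ => False) s) (hq : s.queue c = v :: q)
    (hv : s.removed v = false) :
    min s.t (s.kth.val v) = c ∧ InitInv k G sup inc lv (fun e w => w = v ∧ e ∈ inc v)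
      { s with
        queue := Function.update s.queue c q
        t := min s.t (s.kth.val v)
        core := Function.update s.core v (min s.t (s.kth.val v))
        removed := Function.update s.removed v true } := by
  obtain ⟨hc, hvG, hle⟩ := h.entry c v (by simp [hq])
  -- The entry in bucket `c` is an underestimate, and the bucket where `v` is correctly filed is
  -- among the remaining levels, hence not above `c`.
  have hmin : min s.t (s.kth.val v) = c :=
    le_antisymm (hlv _ (h.entry _ v (h.filed v hvG hv)).1) (hle hv)
  have hct : c ≤ s.t := h.le_t c hc
  have hval : c ≤ s.kth.val v := hmin ▸ min_le_right _ _
  have hlev : ∀ w ∈ G.verts, s.removed w = false → min s.t (s.kth.val w) ≤ c := fun w hw hr =>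
    hlv _ (h.entry _ w (h.filed w hw hr)).1
  have hmin' : ∀ w ∈ G.verts, s.removed w = false →
      min c (s.kth.val w) = min s.t (s.kth.val w) := by
    intro w hw hr
    refine le_antisymm (min_le_min_right _ hct) (le_min (hlev w hw hr) (min_le_right _ _))
  have hrem : ∀ w, Function.update s.removed v true w = false ↔
      w ≠ v ∧ s.removed w = false := by
    intro w
    by_cases hw : w = v <;> simp [hw]
  have hrem' : ∀ w, Function.update s.removed v true w = true ↔
      w = v ∨ s.removed w = true := by
    intro w
    by_cases hw : w = v <;> simp [hw]
  rw [hmin]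
  refine ⟨rfl, ?_⟩
  constructor
  · exact hlv
  · intro w hw hr
    obtain ⟨hwv, hr⟩ := (hrem w).1 hr
    have := h.filed w hw hr
    dsimp only
    rw [hmin' w hw hr]
    by_cases hc : min s.t (s.kth.val w) = c
    · rw [hc, hq, List.mem_cons] at this
      simpa [hc] using this.resolve_left hwv
    · simpa [hc] using this
  · intro l w hw
    have hw' : w ∈ s.queue l := by
      dsimp only at hw
      by_cases hc : l = c
      · subst hc
        simp only [Function.update_self] at hw
        simp [hq, hw]
      · simpa [hc] using hw
    obtain ⟨h₁, h₂, h₃⟩ := h.entry l w hw'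
    refine ⟨h₁, h₂, fun hr => ?_⟩
    obtain ⟨hwv, hr⟩ := (hrem w).1 hr
    rw [hmin' w h₂ hr]
    exact h₃ hr
  · exact fun w hw hr => h.valid w hw ((hrem w).1 hr).2
  · intro e he hd
    obtain ⟨w, hw, hr⟩ := h.deleted e he hd
    exact ⟨w, hw, (hrem' w).2 (.inr hr)⟩
  · intro e he w hw hr
    obtain rfl | hr := (hrem' w).1 hr
    · exact .inr ⟨rfl, (hinc.mem _ _).2 ⟨he, hw⟩⟩
    · exact .inl ((h.pending e he w hw hr).resolve_right id)
  · intro w hr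
    obtain ⟨hwv, hr⟩ := (hrem w).1 hr
    simpa [hwv] using h.core_eq w hr
  · intro w hr
    dsimp only
    by_cases hwv : w = v
    · subst hwv
      simp [hvG]
    · have := h.le_core w (((hrem' w).1 hr).resolve_left hwv)
      rw [Function.update_of_ne hwv]
      exact ⟨this.1, hct.trans this.2⟩
  · intro w hr a ha
    dsimp only at ha
    by_cases hwv : w = v
    · subst hwv
      rw [Function.update_self] at ha
      rintro ⟨W, hW, hwW⟩
      -- A removed vertex of `W` would have core time at least `c > a`, and `outside` would bar it
      -- from the core at `a`. So every edge inside `W` is still undeleted and counts for `val`.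
      have hnot : ∀ u ∈ W, s.removed u = false := by
        intro u hu
        by_contra hr
        rw [Bool.not_eq_false] at hr
        exact h.outside u hr a (ha.trans_le (hct.trans (h.le_core u hr).2)) ⟨W, hW, hu⟩
      have : s.kth.val w ≤ WithTop.some a := by
        rw [(h.valid w hvG hv).val_le_iff hinc]
        refine (hW w hwW).trans (deg_mono fun e he _ hs => ⟨?_, hs.1⟩)
        by_contra hd
        rw [Bool.not_eq_false] at hd
        obtain ⟨u, hu, hr⟩ := h.deleted e (by simpa using he) hd
        simp [hnot u (hs.2 u hu)] at hr
      exact absurd (ha.trans_le (hval.trans this)) (lt_irrefl _)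
    · rw [Function.update_of_ne hwv] at ha
      exact h.outside w (((hrem' w).1 hr).resolve_left hwv) a ha
  · intro a ha
    dsimp only at ha
    -- The set does not change: `v` stays in it, now because its core time `c` is at most `a`.
    have hset : {w | w ∈ G.verts ∧ (Function.update s.removed v true w = false ∨
        Function.update s.core v c w ≤ WithTop.some a)} =
        {w | w ∈ G.verts ∧ (s.removed w = false ∨ s.core w ≤ WithTop.some a)} := by
      ext w
      by_cases hwv : w = v
      · subst hwv
        simp only [Set.mem_ofPred_eq, Function.update_self, hv, ha, true_or, or_true]
      · simp [hwv]
    dsimp only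
    rw [hset]
    by_cases hta : s.t ≤ WithTop.some a
    · exact h.inside a hta
    · push Not at hta
      -- For `a` between `c` and the old `t`, removed vertices have core time above `a`, so only the
      -- remaining vertices matter. All of these have `k`-degree time at most `a`, witnessed by live
      -- edges; no deletion is pending, so those edges lead to remaining vertices.
      have hiff : ∀ w, w ∈ {w | w ∈ G.verts ∧ (s.removed w = false ∨ s.core w ≤ WithTop.some a)} ↔
          w ∈ G.verts ∧ s.removed w = false := by
        intro w
        refine and_congr_right fun hw => ⟨fun h' => h'.elim id fun h' => ?_, .inl⟩
        by_contra hr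
        rw [Bool.not_eq_false] at hr
        exact absurd (hta.trans_le (h.le_core w hr).2) h'.not_gt
      intro w hw
      rw [hiff] at hw
      have hle := hlev w hw.1 hw.2
      have : s.kth.val w ≤ WithTop.some a := by
        obtain h' | h' := min_le_iff.1 (hle.trans ha)
        · exact absurd hta h'.not_gt
        · exact h'
      rw [(h.valid w hw.1 hw.2).val_le_iff hinc] at this
      refine this.trans (deg_mono fun e he _ hs => ⟨hs.2, fun u hu => ?_⟩)
      have he : e ∈ G.edges := by simpa using he
      rw [hiff]
      refine ⟨hG.mem_verts e he u hu, ?_⟩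
      by_contra hr
      rw [Bool.not_eq_false] at hr
      simpa [hs.1] using h.pending e he u hu hr

/-- The deletion of one edge changes data only at the other endpoint, whose `k`-degree time may
rise. It is filed anew under the capped value, and its earlier entries remain valid as
underestimates. -/
theorem InitInv.delete {lv : List Time} {s : InitState V} {v : V} {e : Sym2 V}
    {es : List (Sym2 V)} {K : Kth V}
    (hlv : ∀ l ∈ levels Ts Te, l ≤ s.t → l ∈ lv)
    (hinc : IsSortedIncidence G.edges sup inc) (hG : G.WellFormed Ts Te)
    (hsup : ∀ e ∈ G.edges, sup e ∈ levels Ts Te) (ht : s.t ∈ levels Ts Te)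
    (h : InitInv k G sup inc lv (fun e' w => w = v ∧ e' ∈ e :: es) s)
    (hv : s.removed v = true) (he : e ∈ G.edges) (hve : v ∈ e)
    (hd : s.kth.deleted e = false)
    (hK : K.deleted = Function.update s.kth.deleted e true)
    (hKu : K.ValidAt k sup inc K.deleted (other e v))
    (hKw : ∀ w, w ≠ other e v → s.kth.SameAt K w) :
    InitInv k G sup inc lv (fun e' w => w = v ∧ e' ∈ es)
      { s with
        kth := K
        queue := Function.update s.queue (min s.t (K.val (other e v)))
          (other e v :: s.queue (min s.t (K.val (other e v)))) } := by
  set u := other e v with hu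
  have huv : u ≠ v := other_ne (hG.loopless e he) v
  -- Otherwise `e` would have been deleted when `u` was removed.
  have hur : s.removed u = false := by
    by_contra hr
    rw [Bool.not_eq_false] at hr
    obtain h' | h' := h.pending e he u (other_mem e v) hr
    · simp [hd] at h'
    · exact huv h'.1
  have huG : u ∈ G.verts := hG.mem_verts e he u (other_mem e v)
  have hval : s.kth.val u ≤ K.val u := by
    refine (h.valid u huG hur).val_le_val hKu hinc fun e' he' => ?_
    rw [hK] at he'
    by_cases hee : e' = e
    · simp [hee] at he'
    · simpa [hee] using he'
  have hq : ∀ l w, w ∈ Function.update s.queue (min s.t (K.val u))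
      (u :: s.queue (min s.t (K.val u))) l ↔ (l = min s.t (K.val u) ∧ w = u) ∨ w ∈ s.queue l := by
    intro l w
    by_cases hl : l = min s.t (K.val u)
    · subst hl
      simp
    · simp [hl]
  have hmem : min s.t (K.val u) ∈ lv := by
    refine hlv _ ?_ (min_le_left _ _)
    rcases min_choice s.t (K.val u) with h' | h' <;> rw [h']
    exacts [ht, hKu.val_mem hinc hsup]
  exact
  { h with
    filed := by
      intro w hw hr
      dsimp only
      rw [hq]
      by_cases hwu : w = u
      · exact .inl ⟨by rw [hwu], hwu⟩
      · rw [(hKw w hwu).2.2]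
        exact .inr (h.filed w hw hr)
    entry := by
      intro l w hw
      dsimp only at hw ⊢
      rw [hq] at hw
      obtain ⟨rfl, rfl⟩ | hw := hw
      · exact ⟨hmem, huG, fun _ => le_rfl⟩
      · obtain ⟨h₁, h₂, h₃⟩ := h.entry l w hw
        refine ⟨h₁, h₂, fun hr => ?_⟩
        by_cases hwu : w = u
        · subst hwu
          exact (h₃ hr).trans (min_le_min_left _ hval)
        · rw [(hKw w hwu).2.2]
          exact h₃ hr
    valid := by
      intro w hw hr
      dsimp only at hr ⊢
      by_cases hwu : w = u
      · rw [hwu]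
        exact hKu
      · refine (h.valid w hw hr).of_sameAt (hKw w hwu) fun e' he' => ?_
        have : e' ≠ e := by
          rintro rfl
          have := (mem_iff_eq_or_other hve w).1 ((hinc.mem w e').1 he').2
          obtain rfl | this := this
          · simp [hv] at hr
          · exact hwu this
        simp [hK, this]
    deleted := by
      intro e' he' hd'
      dsimp only at hd' ⊢
      by_cases hee : e' = e
      · exact ⟨v, hee ▸ hve, hv⟩
      · simp only [hK, Function.update_of_ne hee] at hd'
        exact h.deleted e' he' hd'
    pending := by
      intro e' he' w hw hr
      dsimp only
      by_cases hee : e' = e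
      · simp [hK, hee]
      · rw [hK, Function.update_of_ne hee]
        refine (h.pending e' he' w hw hr).imp_right fun h' => ⟨h'.1, ?_⟩
        simpa [hee] using h'.2 }

end CoreT

/-! ### Running time and correctness of `CoreT_Init`. -/

namespace CoreT

open Timed

variable {V : Type} [LinearOrder V] {k : ℕ} {G : Store V} {Ts Te : ℕ}

theorem mem_levels_of_le {p r : List Time} {c l : Time} (h : levels Ts Te = p ++ c :: r)
    (hl : l ∈ levels Ts Te) (hc : l ≤ c) : l ∈ c :: r := by
  have hs := levels_sorted Ts Te
  rw [h] at hl hs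
  refine (List.mem_append.1 hl).resolve_left fun hp => ?_
  exact absurd ((List.pairwise_append.1 hs).2.2 l hp c (by simp)) hc.not_gt

theorem le_of_mem_levels {p r : List Time} {c l : Time} (h : levels Ts Te = p ++ c :: r)
    (hl : l ∈ c :: r) : l ≤ c := by
  have hs := levels_sorted Ts Te
  rw [h] at hs
  obtain rfl | hl := List.mem_cons.1 hl
  · exact le_rfl
  · exact ((List.pairwise_cons.1 (List.pairwise_append.1 hs).2.1).1 l hl).le

/-- The potential of a state of the removal loop, which pays for its running time. -/
def InitState.potential (G : Store V) (inc : V → List (Sym2 V)) (Ts Te : ℕ) (s : InitState V) : ℕ :=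
  4 * ∑ l ∈ (levels Ts Te).toFinset, (s.queue l).length +
    ∑ v ∈ G.verts.toFinset, (if s.removed v then 0 else 17 * (inc v).length + 5) +
    ∑ v ∈ G.verts.toFinset, (s.kth.rest v).length

/-- The weights in the potential: taking an entry from its bucket costs 4 steps. Removing a vertex
costs 5 more, and per incident edge 13 steps, including the 7 of `wp_drop`, plus 4 for the entry
that is filed, hence 17. Scanning is paid by the lengths of the unscanned lists. -/
theorem wp_initRound {sup : Sym2 V → Time} {inc : V → List (Sym2 V)}
    (hinc : IsSortedIncidence G.edges sup inc) (hG : G.WellFormed Ts Te)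
    (hsup : ∀ e ∈ G.edges, sup e ∈ levels Ts Te) {p r : List Time} {c : Time}
    (hlev : levels Ts Te = p ++ c :: r) {s : InitState V} {n B : ℕ}
    (hs : InitInv k G sup inc (c :: r) (fun _ _ => False) s)
    (hB : n + s.potential G inc Ts Te ≤ B) (hq : (s.queue c).isEmpty = false) :
    wp (do
      match ← read s.queue c with
      | [] => pure s
      | v :: q => do
        let queue ← write s.queue c q
        let s := { s with queue := queue }
        let rem ← read s.removed v
        if rem then
          pure s
        else
          let d ← read s.kth.val v
          let t := min s.t d
          let core ← write s.core v t
          let removed ← write s.removed v true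
          let es ← read inc v
          forEach es { s with t := t, core := core, removed := removed } fun e s => do
            let del ← read s.kth.deleted e
            if del then
              pure s
            else
              let u := other e v
              let deleted ← write s.kth.deleted e true
              let kth ← Kth.drop sup { s.kth with deleted := deleted } u e
              let d ← read kth.val u
              let queue ← push s.queue (min s.t d) u
              pure { s with kth := kth, queue := queue }) (n + 1) fun s' n' => n < n' ∧
        InitInv k G sup inc (c :: r) (fun _ _ => False) s' ∧
          n' + s'.potential G inc Ts Te ≤ B := by
  have hc : c ∈ levels Ts Te := by simp [hlev]
  simp only [wp_bind, wp_read]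
  rcases hqc : s.queue c with _ | ⟨v, q⟩
  · simp [hqc] at hq
  simp only [wp_bind, wp_read, wp_write]
  have hsumq := sum_add_eq_sum_add (S := (levels Ts Te).toFinset) (i := c) (by simpa using hc)
    (f := fun l => (Function.update s.queue c q l).length) (g := fun l => (s.queue l).length)
    (fun l hl => by simp [hl])
  simp only [hqc, Function.update_self, List.length_cons] at hsumq
  cases hv : s.removed v with
  | true =>
    simp only [if_true, wp_pure]
    refine ⟨by omega, hs.skip hqc hv, ?_⟩
    simp only [InitState.potential] at hB ⊢
    omega
  | false =>
    simp only [Bool.false_eq_true, if_false, wp_bind, wp_read, wp_write]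
    obtain ⟨ht, hs'⟩ := hs.remove (fun l hl => le_of_mem_levels hlev hl) hinc hG hqc hv
    have hvG := (hs.entry c v (by simp [hqc])).2.1
    have hsumr := sum_add_eq_sum_add (S := G.verts.toFinset) (i := v) (by simpa using hvG)
      (f := fun w => if Function.update s.removed v true w then 0 else 17 * (inc w).length + 5)
      (g := fun w => if s.removed w then 0 else 17 * (inc w).length + 5)
      (fun l hl => by simp [hl])
    simp only [hv, Function.update_self, Bool.false_eq_true, if_false, if_true] at hsumr
    refine wp_forEach (fun es s m => s.t = c ∧ s.removed v = true ∧
      InitInv k G sup inc (c :: r) (fun e w => w = v ∧ e ∈ es) s ∧ n < m ∧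
      m + s.potential G inc Ts Te + 17 * es.length + 1 ≤ B) ?_ ?_ ?_
    · refine ⟨ht, by simp, hs', by omega, ?_⟩
      simp only [InitState.potential] at hB ⊢
      omega
    · rintro p' e es s m hl ⟨ht, hv, hs, hnm, hm⟩
      have he : e ∈ inc v := by simp [hl]
      obtain ⟨heG, hve⟩ := (hinc.mem v e).1 he
      simp only [List.length_cons] at hm
      simp only [wp_bind, wp_read]
      cases hd : s.kth.deleted e with
      | true =>
        simp only [if_true, wp_pure]
        refine ⟨ht, hv, { hs with pending := ?_ }, by omega, by omega⟩
        intro e' he' w hw hr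
        by_cases hee : e' = e
        · exact .inl (hee ▸ hd)
        · refine (hs.pending e' he' w hw hr).imp_right fun h => ⟨h.1, ?_⟩
          simpa [hee] using h.2
      | false =>
        simp only [Bool.false_eq_true, if_false, wp_bind, wp_write]
        have huv : other e v ≠ v := other_ne (hG.loopless e heG) v
        have huG : other e v ∈ G.verts := hG.mem_verts e heG _ (other_mem e v)
        have hur : s.removed (other e v) = false := by
          by_contra hr
          rw [Bool.not_eq_false] at hr
          obtain h' | h' := hs.pending e heG _ (other_mem e v) hr
          · simp [hd] at h'
          · exact huv h'.1
        refine wp_drop (k := k) (del := s.kth.deleted) hinc (fun _ _ _ => rfl)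
          ((hinc.mem _ e).2 ⟨heG, other_mem e v⟩) hd rfl (hs.valid _ huG hur) ?_
        intro K l hK hKu hKw hml hl'
        simp only [wp_read, wp_push, wp_pure]
        have hs' := hs.delete (K := K) (fun l hl hle => mem_levels_of_le hlev hl (ht ▸ hle))
          hinc hG hsup (by rw [ht]; exact hc) hv heG hve hd hK (hK ▸ hKu) hKw
        refine ⟨ht, hv, hs', by omega, ?_⟩
        have hd : min s.t (K.val (other e v)) ∈ (levels Ts Te).toFinset := by
          rw [List.mem_toFinset, hlev]
          exact List.mem_append_right _ (hs'.entry _ (other e v) (by simp)).1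
        have hsumq := sum_add_eq_sum_add (S := (levels Ts Te).toFinset) hd
          (f := fun l => (Function.update s.queue (min s.t (K.val (other e v)))
            (other e v :: s.queue (min s.t (K.val (other e v)))) l).length)
          (g := fun l => (s.queue l).length) (fun l hl => by simp [hl])
        have hsumk := sum_add_eq_sum_add (S := G.verts.toFinset) (i := other e v)
          (by simpa using huG) (f := fun w => (K.rest w).length)
          (g := fun w => (s.kth.rest w).length) (fun w hw => by rw [(hKw w hw).1])
        simp only [Function.update_self, List.length_cons] at hsumq hsumk hl'
        simp only [InitState.potential] at hm ⊢
        omega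
    · rintro s m ⟨-, -, hs, hnm, hm⟩
      refine ⟨by omega, { hs with pending := ?_ }, ?_⟩
      · simpa using hs.pending
      · simp only [List.length_nil] at hm
        omega

theorem wp_init (hk : 1 ≤ k) (hG : G.WellFormed Ts Te) {n : ℕ} {Q : CoreTimes V → ℕ → Prop}
    (h : ∀ σ m, IsCoreTime k G.edges.toFinset (fun e => firstTime (G.times e)) σ.vert →
      (∀ e ∈ G.edges,
        σ.edge e = max (max (σ.vert e.inf) (σ.vert e.sup)) (firstTime (G.times e))) →
      m ≤ n + 60 * G.edges.length + 20 * G.verts.length + 5 * (levels Ts Te).length + 10 →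
      Q σ m) :
    wp (init k Ts Te G) n Q := by
  rw [init]
  simp only [wp_bind]
  refine wp_forEach (fun r sup m => (∀ e ∈ G.edges, e ∉ r → sup e = firstTime (G.times e)) ∧
    m + 3 * r.length = n + 3 * G.edges.length) ⟨fun e he he' => absurd he he', rfl⟩ ?_ ?_
  · rintro p e r sup m - ⟨h₁, hm⟩
    simp only [wp_bind, wp_read, wp_write]
    refine ⟨fun e' he' hr => ?_, by simp at hm; omega⟩
    by_cases hee : e' = e
    · simp [hee]
    · simpa [hee] using h₁ e' he' (by simp [hee, hr])
  rintro sup m₁ ⟨hsup, hm₁⟩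
  replace hsup : ∀ e ∈ G.edges, sup e = firstTime (G.times e) := fun e he => hsup e he (by simp)
  have hlev : ∀ e ∈ G.edges, sup e ∈ levels Ts Te := fun e he => hsup e he ▸ hG.sup_mem e he
  refine wp_sortedIncidence (levels_sorted Ts Te) hG.nodup_edges hG.loopless hlev ?_
  intro inc m₂ hinc hm₂
  refine wp_make hk hinc hG.nodup_verts ?_
  intro K m₃ hKd hKv hm₃
  refine wp_buckets K.val G.verts _ _ ?_
  have hsum := hinc.sum_length_le hG.nodup_edges G.verts.toFinset
  have hsumk : ∑ v ∈ G.verts.toFinset, (K.rest v).length ≤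
      ∑ v ∈ G.verts.toFinset, (inc v).length :=
    Finset.sum_le_sum fun v hv => (hKv v (by simpa using hv)).rest_length_le
  set s₀ : InitState V := ⟨fun c => (G.verts.filter fun a => K.val a = c).reverse,
    fun _ => false, K, ⊤, fun _ => ⊤⟩ with hs₀
  have hInv₀ : InitInv k G sup inc (levels Ts Te) (fun _ _ => False) s₀ := by
    constructor
    · exact fun _ _ => le_top
    · intro v hv _
      simp [hs₀, hv]
    · intro l v hv
      simp only [hs₀, List.mem_reverse, List.mem_filter, decide_eq_true_eq] at hv
      exact ⟨hv.2 ▸ (hKv v hv.1).val_mem hinc hlev, hv.1, fun _ => by simp [hs₀, hv.2]⟩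
    · intro v hv _
      have := hKv v hv
      rwa [← hKd] at this
    · intro e _ hd
      simp [hs₀, hKd] at hd
    all_goals simp [hs₀]
  -- Each vertex contributes 4 for its entry and 5 for its removal. The incidence lists have total
  -- length at most twice the number of edges, each position weighing 17 + 1.
  have hpot₀ : s₀.potential G inc Ts Te ≤ 9 * G.verts.length + 36 * G.edges.length := by
    have h₁ : ∑ l ∈ (levels Ts Te).toFinset, (s₀.queue l).length ≤ G.verts.length := by
      rw [List.sum_toFinset _ (levels_nodup Ts Te)]
      simpa [hs₀] using sum_length_buckets_le K.val G.verts (levels_nodup Ts Te)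
    have h₂ : ∑ v ∈ G.verts.toFinset, (if s₀.removed v then 0 else 17 * (inc v).length + 5) =
        17 * ∑ v ∈ G.verts.toFinset, (inc v).length + 5 * G.verts.length := by
      simp [hs₀, Finset.sum_add_distrib, Finset.mul_sum,
        List.toFinset_card_of_nodup hG.nodup_verts, mul_comm]
    rw [InitState.potential, h₂]
    change _ + ∑ v ∈ G.verts.toFinset, (K.rest v).length ≤ _
    omega
  refine wp_forEach (fun r s m => InitInv k G sup inc r (fun _ _ => False) s ∧
    m + s.potential G inc Ts Te + 2 * r.length ≤ m₃ + (4 * G.verts.length + 1) +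
      9 * G.verts.length + 36 * G.edges.length + 2 * (levels Ts Te).length)
    ⟨hInv₀, by omega⟩ ?_ ?_
  · rintro p c r s m hl ⟨hs, hm⟩
    -- The budget of this level; bounding the step counter by it also proves that the inner loop
    -- terminates.
    obtain ⟨B, hB⟩ : ∃ B, B = m + 1 + s.potential G inc Ts Te := ⟨_, rfl⟩
    refine wp_whileDo (fun s m' => InitInv k G sup inc (c :: r) (fun _ _ => False) s ∧
      m' + s.potential G inc Ts Te ≤ B) B (fun s m h => by omega) ⟨hs, hB.ge⟩ ?_ ?_
    · rintro s m hq ⟨hs, hm⟩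
      exact wp_initRound hinc hG hlev hl hs hm (by simpa using hq)
    · rintro s m' hq ⟨hs, hm'⟩
      refine ⟨{ hs with le_t := fun l hl => hs.le_t l (by simp [hl]), entry := ?_ }, ?_⟩
      · intro l v hv
        obtain ⟨h₁, h₂⟩ := hs.entry l v hv
        refine ⟨(List.mem_cons.1 h₁).resolve_left ?_, h₂⟩
        rintro rfl
        simp at hq
        simp [hq] at hv
      · simp only [List.length_cons] at hm
        omega
  · rintro s m ⟨hs, hm⟩
    -- An unremoved vertex would be filed in a bucket, but no level is left.
    have hall : ∀ v ∈ G.verts, s.removed v = true := by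
      intro v hv
      by_contra hr
      rw [Bool.not_eq_true] at hr
      simpa using (hs.entry _ v (hs.filed v hv hr)).1
    refine wp_forEach (fun r edge m' => (∀ e ∈ G.edges, e ∉ r →
        edge e = max (max (s.core e.inf) (s.core e.sup)) (firstTime (G.times e))) ∧
      m' + 5 * r.length = m + 1 + 5 * G.edges.length) ⟨fun e he he' => absurd he he', rfl⟩ ?_ ?_
    · rintro p e r edge m hl ⟨h₁, hm⟩
      simp only [wp_bind, wp_read, wp_write]
      refine ⟨fun e' he' hr => ?_, by simp at hm; omega⟩
      by_cases hee : e' = e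
      · subst hee
        rw [Function.update_self, hsup e' he']
      · simpa [hee] using h₁ e' he' (by simp [hee, hr])
    · rintro edge m' ⟨hedge, hm'⟩
      simp only [wp_pure]
      refine h _ _ (fun c v => ?_) (fun e he => hedge e he (by simp)) ?_
      · have hE : InCore k G.edges.toFinset (fun e => firstTime (G.times e)) (WithTop.some c) v ↔
            InCore k G.edges.toFinset sup (WithTop.some c) v := by
          constructor <;> exact fun h => h.mono fun e he hle => ⟨he, by
            simpa [hsup e (by simpa using he)] using hle⟩
        rw [hE]
        dsimp only
        constructor
        · intro hc
          have hr : s.removed v = true := by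
            by_contra hr
            rw [Bool.not_eq_true] at hr
            rw [hs.core_eq v hr] at hc
            exact absurd hc (by simp)
          obtain ⟨hv, ht⟩ := hs.le_core v hr
          exact ⟨_, hs.inside c (ht.trans hc), hv, .inr hc⟩
        · intro hc
          obtain ⟨e, he, hve, -⟩ := hc.exists_edge hk
          by_contra hlt
          push Not at hlt
          exact hs.outside v (hall v (hG.mem_verts e (by simpa using he) v hve)) c hlt hc
      · simp only [List.length_nil] at hm hm'
        omega

end CoreT

namespace CoreT

open Timed

variable {V : Type} [LinearOrder V] {k : ℕ} {G : Store V} {Ts Te : ℕ}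

/-! ### The propagation loop of `CoreT_Update` -/

/-- The invariant of the propagation loop: `lv` are the levels that are still to be processed, `key`
are the keys in the incidence lists, `τ` are the core times of the vertices that are to be computed,
`P e v` says that raising `e` on account of `v` is pending, and `R e v` that raising `v` on account
of `e` is pending. -/
structure UpdateInv (k : ℕ) (G : Store V) (sup key : Sym2 V → Time) (inc : V → List (Sym2 V))
    (τ : V → Time) (lv : List Time) (P R : Sym2 V → V → Prop) (s : UpdateState V) : Prop where
  nodup : ∀ l, (s.queue l).Nodup
  entry_vert : ∀ l v, Sum.inl v ∈ s.queue l → l ∈ lv ∧ v ∈ G.verts ∧ l ≤ s.vert v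
  entry_edge : ∀ l e, Sum.inr e ∈ s.queue l → l ∈ lv ∧ e ∈ G.edges ∧ l ≤ s.edge e
  vert_le : ∀ v, s.vert v ≤ τ v
  edge_le : ∀ e ∈ G.edges, s.edge e ≤ max (max (τ e.inf) (τ e.sup)) (sup e)
  sup_le : ∀ e ∈ G.edges, sup e ≤ s.edge e
  deleted : ∀ e ∈ G.edges, s.kth.deleted e = true → ∀ l ∈ lv, l ≤ s.edge e
  kept : ∀ e ∈ G.edges, s.kth.deleted e = false → s.edge e = key e
  valid : ∀ v ∈ G.verts, s.kth.ValidAt k key inc s.kth.deleted v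
  edge_pending : ∀ e ∈ G.edges, ∀ v ∈ e,
    s.vert v ≤ s.edge e ∨ Sum.inl v ∈ s.queue (s.vert v) ∨ P e v
  vert_pending : ∀ (v : V) (t : ℕ), s.vert v ≤ WithTop.some t →
    k ≤ deg G.edges.toFinset v (fun e => s.edge e ≤ WithTop.some t) ∨
      ∃ e ∈ G.edges, v ∈ e ∧ WithTop.some t < s.edge e ∧
        (Sum.inr e ∈ s.queue (s.edge e) ∨ R e v)

variable {sup key : Sym2 V → Time} {inc : V → List (Sym2 V)} {τ : V → Time}
  {lv : List Time} {P R : Sym2 V → V → Prop} {s : UpdateState V} {c : Time}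

theorem mem_update_tail {α : Type} {queue : Time → List α} {a : α} {q : List α}
    (hq : queue c = a :: q) {b : α} {l : Time} (h : b ∈ Function.update queue c q l) :
    b ∈ queue l := by
  by_cases hl : l = c
  · subst hl
    simp only [Function.update_self] at h
    simp [hq, h]
  · simpa [hl] using h

theorem mem_update_tail_of_ne {α : Type} {queue : Time → List α} {a : α} {q : List α}
    (hq : queue c = a :: q) {b : α} {l : Time} (h : b ∈ queue l) (hne : l = c → b ≠ a) :
    b ∈ Function.update queue c q l := by
  by_cases hl : l = c
  · subst hl
    rw [hq] at h
    simpa using (List.mem_cons.1 h).resolve_left (hne rfl)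
  · simpa [hl] using h

theorem nodup_update_tail {α : Type} {queue : Time → List α} {a : α} {q : List α}
    (hq : queue c = a :: q) (h : ∀ l, (queue l).Nodup) (l : Time) :
    (Function.update queue c q l).Nodup := by
  by_cases hl : l = c
  · subst hl
    have := h l
    rw [hq] at this
    simpa using (List.nodup_cons.1 this).2
  · simpa [hl] using h l

theorem mem_update_cons {α : Type} {queue : Time → List α} {a b : α} {l : Time} :
    b ∈ Function.update queue c (a :: queue c) l ↔ (l = c ∧ b = a) ∨ b ∈ queue l := by
  by_cases hl : l = c
  · subst hl
    simp
  · simp [hl]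

theorem nodup_update_cons {α : Type} {queue : Time → List α} {a : α} (ha : a ∉ queue c)
    (h : ∀ l, (queue l).Nodup) (l : Time) :
    (Function.update queue c (a :: queue c) l).Nodup := by
  by_cases hl : l = c
  · subst hl
    simpa using ⟨ha, h l⟩
  · simpa [hl] using h l

/-- An entry that leaves the queue turns into pending obligations at its incident edges. If the
value of `v` is no longer `c`, the entry is stale and the guard `s.vert v = c` makes the obligations
void. -/
theorem UpdateInv.popVert {v : V} {q : List (V ⊕ Sym2 V)}
    (hinc : IsSortedIncidence G.edges key inc)
    (h : UpdateInv k G sup key inc τ lv (fun _ _ => False) R s) (hq : s.queue c = Sum.inl v :: q) :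
    UpdateInv k G sup key inc τ lv (fun e w => s.vert v = c ∧ w = v ∧ e ∈ inc v) R
      { s with queue := Function.update s.queue c q } where
  __ := h
  nodup := nodup_update_tail hq h.nodup
  entry_vert l w hw := h.entry_vert l w (mem_update_tail hq hw)
  entry_edge l e he := h.entry_edge l e (mem_update_tail hq he)
  edge_pending e he w hw := by
    obtain h' | h' | h' := h.edge_pending e he w hw
    · exact .inl h'
    · by_cases hwv : s.vert w = c ∧ w = v
      · obtain ⟨hc, rfl⟩ := hwv
        exact .inr (.inr ⟨hc, rfl, (hinc.mem _ _).2 ⟨he, hw⟩⟩)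
      · refine .inr (.inl (mem_update_tail_of_ne hq h' fun hc => ?_))
        simpa using fun h => hwv ⟨hc, h⟩
    · exact h'.elim
  vert_pending w t ht := by
    refine (h.vert_pending w t ht).imp_right ?_
    rintro ⟨e, he, hw, hlt, h'⟩
    exact ⟨e, he, hw, hlt, h'.imp_left fun h' => mem_update_tail_of_ne hq h' (by simp)⟩

/-- The dual of `popVert`: the obligations now concern the two endpoints of the edge. -/
theorem UpdateInv.popEdge {e : Sym2 V} {q : List (V ⊕ Sym2 V)}
    (h : UpdateInv k G sup key inc τ lv P (fun _ _ => False) s) (hq : s.queue c = Sum.inr e :: q) :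
    UpdateInv k G sup key inc τ lv P (fun e' w => s.edge e = c ∧ e' = e ∧ w ∈ [e.inf, e.sup])
      { s with queue := Function.update s.queue c q } where
  __ := h
  nodup := nodup_update_tail hq h.nodup
  entry_vert l w hw := h.entry_vert l w (mem_update_tail hq hw)
  entry_edge l e he := h.entry_edge l e (mem_update_tail hq he)
  edge_pending e he w hw :=
    (h.edge_pending e he w hw).imp_right fun h' =>
      h'.imp_left fun h' => mem_update_tail_of_ne hq h' (by simp)
  vert_pending w t ht := by
    refine (h.vert_pending w t ht).imp_right ?_
    rintro ⟨e', he, hw, hlt, h' | h'⟩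
    · refine ⟨e', he, hw, hlt, ?_⟩
      by_cases hee : s.edge e' = c ∧ e' = e
      · obtain ⟨hc, rfl⟩ := hee
        refine .inr ⟨hc, rfl, ?_⟩
        simpa using (mem_iff_inf_or_sup e' w).1 hw
      · refine .inl (mem_update_tail_of_ne hq h' fun hc => ?_)
        simpa using fun h => hee ⟨hc, h⟩
    · exact h'.elim

/-- Pending obligations may be dropped as soon as the local condition that they protect holds. -/
theorem UpdateInv.mono {P' R' : Sym2 V → V → Prop}
    (h : UpdateInv k G sup key inc τ lv P R s)
    (hP : ∀ e ∈ G.edges, ∀ v ∈ e, P e v → s.vert v ≤ s.edge e ∨ P' e v)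
    (hR : ∀ e ∈ G.edges, ∀ v ∈ e, ∀ t : ℕ, WithTop.some t < s.edge e → R e v →
      s.vert v ≤ WithTop.some t →
      k ≤ deg G.edges.toFinset v (fun e => s.edge e ≤ WithTop.some t) ∨ R' e v) :
    UpdateInv k G sup key inc τ lv P' R' s where
  __ := h
  edge_pending e he v hv := by
    obtain h' | h' | h' := h.edge_pending e he v hv
    · exact .inl h'
    · exact .inr (.inl h')
    · exact (hP e he v hv h').imp_right .inr
  vert_pending v t ht := by
    obtain h' | ⟨e, he, hv, hlt, h' | h'⟩ := h.vert_pending v t ht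
    · exact .inl h'
    · exact .inr ⟨e, he, hv, hlt, .inl h'⟩
    · exact (hR e he v hv t hlt h' ht).imp_right fun h' => ⟨e, he, hv, hlt, .inr h'⟩

/-- The new value `c` is the tentative value of an endpoint, so it respects the upper bound coming
from `τ`. It is at least every remaining level, which is what permits the deletion of `e`. A vertex
that loses `e` from its count finds `e` in the queue as witness. -/
theorem UpdateInv.raiseEdge {v : V} {e : Sym2 V} {es : List (Sym2 V)} {K : Kth V}
    (hc : c ∈ lv) (hlv : ∀ l ∈ lv, l ≤ c) (hinc : IsSortedIncidence G.edges key inc)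
    (h : UpdateInv k G sup key inc τ lv (fun e' w => w = v ∧ e' ∈ e :: es) (fun _ _ => False) s)
    (hv : s.vert v = c) (he : e ∈ G.edges) (hve : v ∈ e)
    (hlt : s.edge e < c) (hu : s.vert (other e v) ≤ c)
    (hK : K.deleted = Function.update s.kth.deleted e true)
    (hKe : ∀ w ∈ e, K.ValidAt k key inc K.deleted w)
    (hKw : ∀ w, w ∉ e → s.kth.SameAt K w) :
    UpdateInv k G sup key inc τ lv (fun e' w => w = v ∧ e' ∈ es) (fun _ _ => False)
      { s with
        edge := Function.update s.edge e c
        queue := Function.update s.queue c (Sum.inr e :: s.queue c)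
        kth := K } where
  nodup := nodup_update_cons (fun hmem => (h.entry_edge c e hmem).2.2.not_gt hlt) h.nodup
  entry_vert l w hw := by
    rw [mem_update_cons] at hw
    exact h.entry_vert l w (hw.resolve_left (by simp))
  entry_edge l e' he' := by
    rw [mem_update_cons] at he'
    dsimp only
    obtain ⟨rfl, h'⟩ | h' := he'
    · cases h'
      exact ⟨hc, he, by simp⟩
    · obtain ⟨h₁, h₂, h₃⟩ := h.entry_edge l e' h'
      refine ⟨h₁, h₂, ?_⟩
      by_cases hee : e' = e
      · simpa [hee] using hlv l h₁
      · simpa [hee] using h₃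
  vert_le := h.vert_le
  edge_le e' he' := by
    dsimp only
    by_cases hee : e' = e
    · subst hee
      rw [Function.update_self, ← hv]
      refine (h.vert_le v).trans (le_max_of_le_left ?_)
      obtain rfl | rfl := (mem_iff_inf_or_sup e' v).1 hve
      exacts [le_max_left _ _, le_max_right _ _]
    · rw [Function.update_of_ne hee]
      exact h.edge_le e' he'
  sup_le e' he' := by
    dsimp only
    by_cases hee : e' = e
    · rw [hee, Function.update_self]
      exact (h.sup_le e he).trans hlt.le
    · rw [Function.update_of_ne hee]
      exact h.sup_le e' he'
  deleted e' he' hd l hl := by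
    dsimp only at hd ⊢
    by_cases hee : e' = e
    · rw [hee, Function.update_self]
      exact hlv l hl
    · rw [hK, Function.update_of_ne hee] at hd
      rw [Function.update_of_ne hee]
      exact h.deleted e' he' hd l hl
  kept e' he' hd := by
    dsimp only at hd ⊢
    by_cases hee : e' = e
    · simp [hK, hee] at hd
    · rw [hK, Function.update_of_ne hee] at hd
      rw [Function.update_of_ne hee]
      exact h.kept e' he' hd
  valid w hw := by
    dsimp only
    by_cases hwe : w ∈ e
    · exact hKe w hwe
    · refine (h.valid w hw).of_sameAt (hKw w hwe) fun e' he' => ?_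
      rw [hK, Function.update_of_ne]
      rintro rfl
      exact hwe ((hinc.mem _ _).1 he').2
  edge_pending e' he' w hw := by
    dsimp only
    by_cases hee : e' = e
    · subst hee
      rw [Function.update_self]
      left
      obtain rfl | rfl := (mem_iff_eq_or_other hve w).1 hw
      exacts [hv.le, hu]
    · rw [Function.update_of_ne hee, mem_update_cons]
      obtain h' | h' | h' := h.edge_pending e' he' w hw
      · exact .inl h'
      · exact .inr (.inl (.inr h'))
      · exact .inr (.inr ⟨h'.1, by simpa [hee] using h'.2⟩)
  vert_pending w t ht := by
    dsimp only at ht ⊢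
    obtain h' | ⟨e', he', hw, hlt', h' | h'⟩ := h.vert_pending w t ht
    · refine or_iff_not_imp_left.2 fun hlt' => ?_
      obtain ⟨e', he', hw, h₁, h₂⟩ := exists_of_deg_lt ((not_le.1 hlt').trans_le h')
      by_cases hee : e' = e
      · subst hee
        refine ⟨e', he, hw, not_le.1 h₂, .inl ?_⟩
        simp
      · simp only [Function.update_of_ne hee] at h₂
        exact absurd h₁ h₂
    · right
      by_cases hee : e' = e
      · subst hee
        refine ⟨e', he, hw, ?_, .inl ?_⟩
        · simpa using hlt'.trans hlt
        · simp
      · refine ⟨e', he', hw, by simpa [hee] using hlt', .inl ?_⟩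
        rw [Function.update_of_ne hee, mem_update_cons]
        exact .inr h'
    · exact h'.elim

/-- Raising to `min c val` never overshoots. If `τ v ≤ t` with `t < c`, then `v` has `k` core edges
at `t`, and their tentative values are at most `t`. Being below `c` they cannot have been deleted,
so their keys are current and `val ≤ t`. -/
theorem UpdateInv.val_le (hτ : IsCoreTime k G.edges.toFinset sup τ)
    (h : UpdateInv k G sup key inc τ lv P R s) (hinc : IsSortedIncidence G.edges key inc)
    (hc : c ∈ lv) {v : V} (hv : v ∈ G.verts) : min c (s.kth.val v) ≤ τ v := by
  refine le_of_forall_coe fun t ht => ?_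
  by_contra! hlt
  obtain ⟨hlt₁, hlt₂⟩ := lt_min_iff.1 hlt
  refine hlt₂.not_ge ?_
  rw [(h.valid v hv).val_le_iff hinc]
  refine (cohesive_inCore _ v ((hτ t v).1 ht)).trans (deg_mono fun e he _ hs => ?_)
  have he : e ∈ G.edges := by simpa using he
  have hle : s.edge e ≤ WithTop.some t := (h.edge_le e he).trans
    (max_le (max_le ((hτ t _).2 (hs.2 _ (inf_mem e))) ((hτ t _).2 (hs.2 _ (sup_mem e)))) hs.1)
  have hd : s.kth.deleted e = false := by
    by_contra hd
    rw [Bool.not_eq_false] at hd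
    exact ((h.deleted e he hd c hc).trans hle).not_gt hlt₁
  exact ⟨hd, h.kept e he hd ▸ hle⟩

/-- Raising a vertex only weakens the premise of its own counting condition. Its conditions towards
incident edges may break, but the new queue entry covers them. -/
theorem UpdateInv.raiseVert {v : V} (hτ : IsCoreTime k G.edges.toFinset sup τ)
    (hc : c ∈ lv) (hinc : IsSortedIncidence G.edges key inc)
    (h : UpdateInv k G sup key inc τ lv (fun _ _ => False) R s)
    (hv : v ∈ G.verts) (hmem : min c (s.kth.val v) ∈ lv) (hlt : s.vert v < min c (s.kth.val v)) :
    UpdateInv k G sup key inc τ lv (fun _ _ => False) R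
      { s with
        vert := Function.update s.vert v (min c (s.kth.val v))
        queue := Function.update s.queue (min c (s.kth.val v))
          (Sum.inl v :: s.queue (min c (s.kth.val v))) } where
  __ := h
  nodup := nodup_update_cons (fun hmem => (h.entry_vert _ v hmem).2.2.not_gt hlt) h.nodup
  entry_vert l w hw := by
    rw [mem_update_cons] at hw
    dsimp only
    obtain ⟨rfl, h'⟩ | h' := hw
    · cases h'
      exact ⟨hmem, hv, by simp⟩
    · obtain ⟨h₁, h₂, h₃⟩ := h.entry_vert l w h'
      refine ⟨h₁, h₂, ?_⟩
      by_cases hwv : w = v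
      · subst hwv
        rw [Function.update_self]
        exact h₃.trans hlt.le
      · rwa [Function.update_of_ne hwv]
  entry_edge l e he := by
    rw [mem_update_cons] at he
    exact h.entry_edge l e (he.resolve_left (by simp))
  vert_le w := by
    dsimp only
    by_cases hwv : w = v
    · subst hwv
      rw [Function.update_self]
      exact h.val_le hτ hinc hc hv
    · rw [Function.update_of_ne hwv]
      exact h.vert_le w
  edge_pending e he w hw := by
    dsimp only
    rw [mem_update_cons]
    by_cases hwv : w = v
    · subst hwv
      simp
    · rw [Function.update_of_ne hwv]
      exact (h.edge_pending e he w hw).imp_right fun h' => h'.imp_left .inr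
  vert_pending w t ht := by
    dsimp only at ht ⊢
    have ht' : s.vert w ≤ WithTop.some t := by
      by_cases hwv : w = v
      · subst hwv
        rw [Function.update_self] at ht
        exact hlt.le.trans ht
      · rwa [Function.update_of_ne hwv] at ht
    refine (h.vert_pending w t ht').imp_right ?_
    rintro ⟨e, he, hw, hlt, h'⟩
    refine ⟨e, he, hw, hlt, h'.imp_left fun h' => ?_⟩
    rw [mem_update_cons]
    exact .inr h'

/-- If `v` has a value at most `t` while `e` has value `c > t`, then the cap `c` in `min c val` is
not effective, so `val ≤ t`. The live edges, whose keys are their current values, then supply the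
count without the help of `e`. -/
theorem UpdateInv.settleVert {v : V} {e : Sym2 V} {vs : List V}
    (hinc : IsSortedIncidence G.edges key inc)
    (h : UpdateInv k G sup key inc τ lv P (fun e' w => e' = e ∧ w ∈ v :: vs) s)
    (hv : v ∈ G.verts) (he : s.edge e = c) (hle : min c (s.kth.val v) ≤ s.vert v) :
    UpdateInv k G sup key inc τ lv P (fun e' w => e' = e ∧ w ∈ vs) s := by
  refine h.mono (fun _ _ _ _ => .inr) fun e' he' w hw t hlt hR ht => ?_
  obtain ⟨rfl, hR⟩ := hR
  obtain rfl | hR := List.mem_cons.1 hR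
  · left
    have := (min_le_iff.1 (hle.trans ht)).resolve_left (by rw [← he]; exact hlt.not_ge)
    rw [(h.valid w hv).val_le_iff hinc] at this
    exact this.trans (deg_mono fun e he _ hs => by
      rw [h.kept e (by simpa using he) hs.1]
      exact hs.2)
  · exact .inr ⟨rfl, hR⟩

/-- With no queue entries and no obligations, every vertex of value at most `t` has `k` edges of
value at most `t`, whose support times and endpoint values are also at most `t`. These vertices form
a cohesive set, which gives `τ ≤ vert`; the reverse inequality is part of the invariant. -/
theorem UpdateInv.isCoreTime (hτ : IsCoreTime k G.edges.toFinset sup τ)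
    (h : UpdateInv k G sup key inc τ [] (fun _ _ => False) (fun _ _ => False) s) :
    IsCoreTime k G.edges.toFinset sup s.vert ∧
      ∀ e ∈ G.edges, s.edge e = max (max (s.vert e.inf) (s.vert e.sup)) (sup e) := by
  have hE : ∀ e ∈ G.edges, ∀ v ∈ e, s.vert v ≤ s.edge e := by
    intro e he v hv
    refine (h.edge_pending e he v hv).resolve_right ?_
    rintro (h' | h')
    · simpa using (h.entry_vert _ _ h').1
    · exact h'
  have hW : ∀ t : ℕ, Cohesive k G.edges.toFinset sup (WithTop.some t)
      {v | s.vert v ≤ WithTop.some t} := by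
    intro t v hv
    have hdeg := (h.vert_pending v t hv).resolve_right fun ⟨e, _, _, _, h'⟩ => by
      obtain h' | h' := h'
      · simpa using (h.entry_edge _ _ h').1
      · exact h'
    refine hdeg.trans (deg_mono fun e he _ hs => ?_)
    have he : e ∈ G.edges := by simpa using he
    exact ⟨(h.sup_le e he).trans hs, fun u hu => (hE e he u hu).trans hs⟩
  have hvert : s.vert = τ := by
    funext v
    exact le_antisymm (h.vert_le v) (le_of_forall_coe fun t ht => (hτ t v).2 ⟨_, hW t, ht⟩)
  refine ⟨hvert ▸ hτ, fun e he => le_antisymm ?_ ?_⟩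
  · rw [hvert]
    exact h.edge_le e he
  · exact max_le (max_le (hE e he _ (inf_mem e)) (hE e he _ (sup_mem e))) (h.sup_le e he)

end CoreT

/-! ### Amortised running time of the propagation loop. -/

namespace CoreT

open Timed

variable {V : Type} [LinearOrder V] {k : ℕ} {G : Store V} {Ts Te : ℕ}
  {sup key : Sym2 V → Time} {inc : V → List (Sym2 V)} {τ : V → Time}

/-- The steps that an entry of the queue pays for. -/
def entryWeight : V ⊕ Sym2 V → ℕ := Sum.elim (fun _ => 4) fun _ => 25

open Classical in
/-- The potential of a state of the propagation loop at level `c`, which pays for its running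
time. -/
noncomputable def UpdateState.potential (G : Store V) (inc : V → List (Sym2 V)) (Ts Te : ℕ)
    (c : Time) (s : UpdateState V) : ℕ :=
  ∑ l ∈ (levels Ts Te).toFinset, ((s.queue l).map entryWeight).sum +
    ∑ v ∈ G.verts.toFinset, (if c ≤ s.vert v ∧ Sum.inl v ∉ s.queue (s.vert v) then 0 else
      47 * (inc v).length + 2) +
    ∑ v ∈ G.verts.toFinset, (s.kth.rest v).length

theorem sum_weight_tail {queue : Time → List (V ⊕ Sym2 V)} {c : Time}
    {a : V ⊕ Sym2 V} {q : List (V ⊕ Sym2 V)} (hq : queue c = a :: q)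
    {L : Finset Time} (hc : c ∈ L) :
    ∑ l ∈ L, ((Function.update queue c q l).map entryWeight).sum + entryWeight a =
      ∑ l ∈ L, ((queue l).map entryWeight).sum := by
  have := sum_add_eq_sum_add (S := L) hc
    (f := fun l => ((Function.update queue c q l).map entryWeight).sum)
    (g := fun l => ((queue l).map entryWeight).sum) (fun l hl => by simp [hl])
  simp only [hq, Function.update_self, List.map_cons, List.sum_cons] at this
  omega

theorem sum_weight_cons {queue : Time → List (V ⊕ Sym2 V)} {c : Time}
    {a : V ⊕ Sym2 V} {L : Finset Time} (hc : c ∈ L) :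
    ∑ l ∈ L, ((Function.update queue c (a :: queue c) l).map entryWeight).sum =
      ∑ l ∈ L, ((queue l).map entryWeight).sum + entryWeight a := by
  have := sum_add_eq_sum_add (S := L) hc
    (f := fun l => ((Function.update queue c (a :: queue c) l).map entryWeight).sum)
    (g := fun l => ((queue l).map entryWeight).sum) (fun l hl => by simp [hl])
  simp only [Function.update_self, List.map_cons, List.sum_cons] at this
  omega

open Classical in
theorem sum_idle_congr {c : Time} {s s' : UpdateState V}
    (h : ∀ v, (c ≤ s'.vert v ∧ Sum.inl v ∉ s'.queue (s'.vert v)) ↔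
      (c ≤ s.vert v ∧ Sum.inl v ∉ s.queue (s.vert v))) :
    ∑ v ∈ G.verts.toFinset, (if c ≤ s'.vert v ∧ Sum.inl v ∉ s'.queue (s'.vert v) then 0 else
      47 * (inc v).length + 2) =
    ∑ v ∈ G.verts.toFinset, (if c ≤ s.vert v ∧ Sum.inl v ∉ s.queue (s.vert v) then 0 else
      47 * (inc v).length + 2) := by
  refine Finset.sum_congr rfl fun v _ => ?_
  simp only [h]

/-- The weight 47 per incident edge: at most 22 steps, including 14 for two applications of
`wp_drop`, plus 25 for the new queue entry. Each vertex is expanded at most once in the whole loop,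
because afterwards its value is at least the current level and later raises are capped by that
level. -/
theorem wp_raiseEdges (hinc : IsSortedIncidence G.edges key inc) (hG : G.WellFormed Ts Te)
    {p r : List Time} {c : Time} (hlev : levels Ts Te = p ++ c :: r) {v : V}
    (hvG : v ∈ G.verts) {s : UpdateState V} {n n₀ B : ℕ} (hv : s.vert v = c)
    (hs : UpdateInv k G sup key inc τ (c :: r) (fun e w => w = v ∧ e ∈ inc v)
      (fun _ _ => False) s) (hn : n₀ < n)
    (hB : n + s.potential G inc Ts Te c + 47 * (inc v).length + 1 ≤ B) :
    wp (forEach (inc v) s fun e s => do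
      let b ← read s.vert (other e v)
      let δ := max c b
      let old ← read s.edge e
      if old < δ then
        let edge ← write s.edge e δ
        let queue ← push s.queue δ (Sum.inr e)
        let del ← read s.kth.deleted e
        if del then
          pure { s with edge := edge, queue := queue }
        else
          let deleted ← write s.kth.deleted e true
          let kth ← Kth.drop edge { s.kth with deleted := deleted } e.inf e
          let kth ← Kth.drop edge kth e.sup e
          pure { s with edge := edge, queue := queue, kth := kth }
      else
        pure s) n fun s' n' => n₀ < n' ∧
      UpdateInv k G sup key inc τ (c :: r) (fun _ _ => False) (fun _ _ => False) s' ∧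
      n' + s'.potential G inc Ts Te c ≤ B := by
  have hc : c ∈ (levels Ts Te).toFinset := by simp [hlev]
  refine wp_forEach (fun es s m => s.vert v = c ∧
    UpdateInv k G sup key inc τ (c :: r) (fun e w => w = v ∧ e ∈ es) (fun _ _ => False) s ∧
    n₀ < m ∧ m + s.potential G inc Ts Te c + 47 * es.length + 1 ≤ B) ⟨hv, hs, hn, hB⟩ ?_ ?_
  · rintro p' e es s m hl ⟨hv, hs, hnm, hm⟩
    have hei : e ∈ inc v := by simp [hl]
    obtain ⟨he, hve⟩ := (hinc.mem v e).1 hei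
    have hloop := hG.loopless e he
    simp only [List.length_cons] at hm
    simp only [wp_bind, wp_read]
    -- Either the edge already dominates the other endpoint, or that endpoint waits in a remaining
    -- bucket. So if the edge must be raised at all, it is raised to exactly `c`.
    have hu : s.vert (other e v) ≤ s.edge e ∨ s.vert (other e v) ≤ c := by
      obtain h' | h' | h' := hs.edge_pending e he _ (other_mem e v)
      · exact .inl h'
      · exact .inr (le_of_mem_levels hlev (hs.entry_vert _ _ h').1)
      · exact absurd h'.1 (other_ne hloop v)
    split_ifs with hlt
    · have huc : s.vert (other e v) ≤ c := by
        obtain h' | h' := hu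
        · exact ((lt_max_iff.1 hlt).resolve_right h'.not_gt |>.le).trans' h'
        · exact h'
      rw [max_eq_left huc] at hlt ⊢
      simp only [wp_bind, wp_write, wp_push, wp_read]
      cases hd : s.kth.deleted e with
      -- A deleted edge already has value at least `c`, so the branch for deleted edges is never
      -- taken.
      | true => exact absurd (hs.deleted e he hd c (by simp)) hlt.not_ge
      | false =>
        simp only [Bool.false_eq_true, if_false, wp_bind, wp_write]
        -- The program passes the current edge values as keys; on live edges they coincide with the
        -- keys used for sorting.
        have hkey : ∀ e' ∈ G.edges, Function.update s.kth.deleted e true e' = false →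
            Function.update s.edge e c e' = key e' := by
          intro e' he' hd'
          by_cases hee : e' = e
          · simp [hee] at hd'
          · rw [Function.update_of_ne hee] at hd' ⊢
            exact hs.kept e' he' hd'
        have hne := inf_ne_sup hloop
        have hinf := hG.mem_verts e he _ (inf_mem e)
        have hsup := hG.mem_verts e he _ (sup_mem e)
        refine wp_drop (k := k) (del := s.kth.deleted) hinc
          (fun e' he' => hkey e' ((hinc.mem _ _).1 he').1)
          ((hinc.mem _ e).2 ⟨he, inf_mem e⟩) hd rfl (hs.valid _ hinf) ?_
        intro K₁ m₁ hK₁ hv₁ hw₁ hm₁ hm₁'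
        have hsame : s.kth.SameAt K₁ e.sup := hw₁ _ hne.symm
        refine wp_drop (k := k) (del := s.kth.deleted) hinc
          (fun e' he' hd' => hkey e' ((hinc.mem _ _).1 he').1 (by rwa [hK₁] at hd'))
          ((hinc.mem _ e).2 ⟨he, sup_mem e⟩) hd hK₁
          ((hs.valid _ hsup).of_sameAt hsame fun _ _ => rfl) ?_
        intro K₂ m₂ hK₂ hv₂ hw₂ hm₂ hm₂'
        simp only [wp_pure]
        have hs' := hs.raiseEdge (K := K₂) (by simp) (fun l hl => le_of_mem_levels hlev hl) hinc hv
          he hve hlt huc (hK₂.trans hK₁) (fun w hw => by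
            obtain rfl | rfl := (mem_iff_inf_or_sup e w).1 hw
            · refine Kth.ValidAt.of_sameAt hv₁ (hw₂ _ hne) fun e' _ => ?_
              rw [hK₂, hK₁]
            · exact hK₂ ▸ hv₂)
          (fun w hw => by
            rw [mem_iff_inf_or_sup, not_or] at hw
            have h₁ := hw₁ w hw.1
            have h₂ := hw₂ w hw.2
            exact ⟨h₂.1.trans h₁.1, fun e => (h₂.2.1 e).trans (h₁.2.1 e), h₂.2.2.trans h₁.2.2⟩)
        refine ⟨hv, hs', by omega, ?_⟩
        have h₁ := sum_weight_cons (queue := s.queue) (a := Sum.inr e) hc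
        have h₂ := sum_idle_congr (G := G) (inc := inc) (c := c) (s := s)
          (s' := { s with
            edge := Function.update s.edge e c
            queue := Function.update s.queue c (Sum.inr e :: s.queue c)
            kth := K₂ })
          (fun w => by simp only [mem_update_cons, reduceCtorEq, and_false, false_or])
        have h₃ := sum_add_eq_sum_add (S := G.verts.toFinset) (i := e.inf) (by simpa using hinf)
          (f := fun w => (K₁.rest w).length) (g := fun w => (s.kth.rest w).length)
          (fun w hw => by rw [(hw₁ w hw).1])
        have h₄ := sum_add_eq_sum_add (S := G.verts.toFinset) (i := e.sup) (by simpa using hsup)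
          (f := fun w => (K₂.rest w).length) (g := fun w => (K₁.rest w).length)
          (fun w hw => by rw [(hw₂ w hw).1])
        have h₅ : entryWeight (Sum.inr e : V ⊕ Sym2 V) = 25 := rfl
        simp only [UpdateState.potential] at hm ⊢
        dsimp only at h₂ h₃ h₄ hm₁' hm₂' ⊢
        rw [h₂]
        omega
    · simp only [wp_pure]
      refine ⟨hv, hs.mono ?_ ?_, by omega, by omega⟩
      · rintro e' he' w hw ⟨rfl, hmem⟩
        obtain rfl | hmem := List.mem_cons.1 hmem
        · left
          rw [hv]
          exact (le_max_left _ _).trans (not_lt.1 hlt)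
        · exact .inr ⟨rfl, hmem⟩
      · exact fun _ _ _ _ _ _ h => h.elim
  · rintro s m ⟨-, hs, hnm, hm⟩
    refine ⟨by omega, hs.mono ?_ ?_, by simp at hm; omega⟩
    · rintro e he w hw ⟨-, h⟩
      simp at h
    · exact fun _ _ _ _ _ _ h => h.elim

/-- The weight 25 of an edge entry: 4 steps to take it, then for each of the two endpoints 6 steps
and 4 for a new vertex entry, and 1 to leave the loop. -/
theorem wp_raiseVerts (hτ : IsCoreTime k G.edges.toFinset sup τ)
    (hinc : IsSortedIncidence G.edges key inc) (hG : G.WellFormed Ts Te)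
    (hkey : ∀ e ∈ G.edges, key e ∈ levels Ts Te)
    {p r : List Time} {c : Time} (hlev : levels Ts Te = p ++ c :: r) {e : Sym2 V}
    (he : e ∈ G.edges) {s : UpdateState V} {n n₀ B : ℕ} (hec : s.edge e = c)
    (hs : UpdateInv k G sup key inc τ (c :: r) (fun _ _ => False)
      (fun e' w => e' = e ∧ w ∈ [e.inf, e.sup]) s) (hn : n₀ < n)
    (hB : n + s.potential G inc Ts Te c + 21 ≤ B) :
    wp (forEach [e.inf, e.sup] s fun v s => do
      let d ← read s.kth.val v
      let δ := min c d
      let old ← read s.vert v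
      if old < δ then
        let vert ← write s.vert v δ
        let queue ← push s.queue δ (Sum.inl v)
        pure { s with vert := vert, queue := queue }
      else
        pure s) n fun s' n' => n₀ < n' ∧
      UpdateInv k G sup key inc τ (c :: r) (fun _ _ => False) (fun _ _ => False) s' ∧
      n' + s'.potential G inc Ts Te c ≤ B := by
  have hc : c ∈ levels Ts Te := by simp [hlev]
  refine wp_forEach (fun vs s m => s.edge e = c ∧
    UpdateInv k G sup key inc τ (c :: r) (fun _ _ => False) (fun e' w => e' = e ∧ w ∈ vs) s ∧
    n₀ < m ∧ m + s.potential G inc Ts Te c + 10 * vs.length + 1 ≤ B) ⟨hec, hs, hn, hB⟩ ?_ ?_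
  · rintro p' v vs s m hl ⟨hec, hs, hnm, hm⟩
    have hve : v ∈ e := by
      rw [mem_iff_inf_or_sup]
      have : v ∈ [e.inf, e.sup] := by simp [hl]
      simpa using this
    have hv := hG.mem_verts e he v hve
    simp only [List.length_cons] at hm
    simp only [wp_bind, wp_read]
    split_ifs with hlt
    · simp only [wp_bind, wp_write, wp_push, wp_pure]
      have hmem : min c (s.kth.val v) ∈ c :: r := by
        refine mem_levels_of_le hlev ?_ (min_le_left _ _)
        rcases min_choice c (s.kth.val v) with h' | h' <;> rw [h']
        exacts [hc, (hs.valid v hv).val_mem hinc hkey]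
      have hmem' : min c (s.kth.val v) ∈ (levels Ts Te).toFinset := by
        rw [List.mem_toFinset, hlev]
        exact List.mem_append_right _ hmem
      have hs' := (hs.raiseVert hτ (by simp) hinc hv hmem hlt).settleVert hinc hv hec (by simp)
      refine ⟨hec, hs', by omega, ?_⟩
      have h₁ := sum_weight_cons (queue := s.queue) (a := Sum.inl v) hmem'
      -- The raised vertex still owes its expansion: before, its value was below `c`; now it is
      -- queued.
      have h₂ := sum_idle_congr (G := G) (inc := inc) (c := c) (s := s)
        (s' := { s with
          vert := Function.update s.vert v (min c (s.kth.val v))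
          queue := Function.update s.queue (min c (s.kth.val v))
            (Sum.inl v :: s.queue (min c (s.kth.val v))) })
        (fun w => by
          dsimp only
          rw [mem_update_cons]
          by_cases hw : w = v
          · subst hw
            simp only [Function.update_self, true_and, true_or, not_true, and_false, false_iff,
              not_and_or]
            exact .inl (hlt.trans_le (min_le_left _ _)).not_ge
          · simp [hw])
      have h₅ : entryWeight (Sum.inl v : V ⊕ Sym2 V) = 4 := rfl
      simp only [UpdateState.potential] at hm ⊢
      dsimp only at h₂ ⊢
      rw [h₂]
      omega
    · simp only [wp_pure]
      exact ⟨hec, hs.settleVert hinc hv hec (not_lt.1 hlt), by omega, by omega⟩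
  · rintro s m ⟨-, hs, hnm, hm⟩
    refine ⟨by omega, hs.mono ?_ ?_, by simp at hm; omega⟩
    · exact fun _ _ _ _ h => h.elim
    · rintro e he w hw _ _ ⟨-, h⟩
      simp at h

theorem wp_updateRound (hτ : IsCoreTime k G.edges.toFinset sup τ)
    (hinc : IsSortedIncidence G.edges key inc) (hG : G.WellFormed Ts Te)
    (hkey : ∀ e ∈ G.edges, key e ∈ levels Ts Te)
    {p r : List Time} {c : Time} (hlev : levels Ts Te = p ++ c :: r)
    {s : UpdateState V} {n B : ℕ}
    (hs : UpdateInv k G sup key inc τ (c :: r) (fun _ _ => False) (fun _ _ => False) s)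
    (hB : n + s.potential G inc Ts Te c ≤ B) (hq : (s.queue c).isEmpty = false) :
    wp (do
      match ← read s.queue c with
      | [] => pure s
      | Sum.inl v :: q => do
        let queue ← write s.queue c q
        let s := { s with queue := queue }
        let a ← read s.vert v
        if a ≠ c then
          pure s
        else
          let es ← read inc v
          forEach es s fun e s => do
            let b ← read s.vert (other e v)
            let δ := max a b
            let old ← read s.edge e
            if old < δ then
              let edge ← write s.edge e δ
              let queue ← push s.queue δ (Sum.inr e)
              let del ← read s.kth.deleted e
              if del then
                pure { s with edge := edge, queue := queue }
              else
                let deleted ← write s.kth.deleted e true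
                let kth ← Kth.drop edge { s.kth with deleted := deleted } e.inf e
                let kth ← Kth.drop edge kth e.sup e
                pure { s with edge := edge, queue := queue, kth := kth }
            else
              pure s
      | Sum.inr e :: q => do
        let queue ← write s.queue c q
        let s := { s with queue := queue }
        let a ← read s.edge e
        if a ≠ c then
          pure s
        else
          forEach [e.inf, e.sup] s fun v s => do
            let d ← read s.kth.val v
            let δ := min c d
            let old ← read s.vert v
            if old < δ then
              let vert ← write s.vert v δ
              let queue ← push s.queue δ (Sum.inl v)
              pure { s with vert := vert, queue := queue }
            else
              pure s) (n + 1) fun s' n' => n < n' ∧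
      UpdateInv k G sup key inc τ (c :: r) (fun _ _ => False) (fun _ _ => False) s' ∧
      n' + s'.potential G inc Ts Te c ≤ B := by
  have hc : c ∈ (levels Ts Te).toFinset := by simp [hlev]
  simp only [wp_bind, wp_read]
  rcases hqc : s.queue c with _ | ⟨v | e, q⟩
  · simp [hqc] at hq
  · simp only [wp_bind, wp_read, wp_write]
    have hs' := hs.popVert hinc hqc
    have hvG := (hs.entry_vert c v (by simp [hqc])).2.1
    have hsum := sum_weight_tail hqc hc
    have h₅ : entryWeight (Sum.inl v : V ⊕ Sym2 V) = 4 := rfl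
    have hmem : ∀ w l, (l = c → w ≠ v) →
        (Sum.inl w ∈ Function.update s.queue c q l ↔ Sum.inl w ∈ s.queue l) := fun w l hne =>
      ⟨mem_update_tail hqc, fun h => mem_update_tail_of_ne hqc h (by simpa using hne)⟩
    split_ifs with hvc
    · simp only [wp_pure]
      refine ⟨by omega, hs'.mono ?_ ?_, ?_⟩
      · exact fun _ _ _ _ h => absurd h.1 hvc
      · exact fun _ _ _ _ _ _ h => h.elim
      · have h₂ := sum_idle_congr (G := G) (inc := inc) (c := c) (s := s)
          (s' := { s with queue := Function.update s.queue c q })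
          (fun w => by
            dsimp only
            rw [hmem w _ (fun h => by rintro rfl; exact hvc h)])
        simp only [UpdateState.potential] at hB ⊢
        dsimp only at h₂ ⊢
        rw [h₂]
        omega
    · rw [not_ne_iff] at hvc
      rw [hvc]
      simp only [wp_bind, wp_read]
      refine wp_raiseEdges hinc hG hlev hvG hvc (hs'.mono ?_ ?_) (by omega) ?_
      · exact fun _ _ _ _ h => .inr h.2
      · exact fun _ _ _ _ _ _ h => h.elim
      · classical
        -- Buckets have no repetitions, so the entry just taken was the only one of `v` in its
        -- current bucket. The weight of `v` is released and pays for the expansion.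
        have h₂ := sum_add_eq_sum_add (S := G.verts.toFinset) (i := v) (by simpa using hvG)
          (f := fun w => if c ≤ s.vert w ∧ Sum.inl w ∉ Function.update s.queue c q (s.vert w)
            then 0 else 47 * (inc w).length + 2)
          (g := fun w => if c ≤ s.vert w ∧ Sum.inl w ∉ s.queue (s.vert w)
            then 0 else 47 * (inc w).length + 2)
          (fun w hw => by rw [hmem w _ fun _ => hw])
        have hnd := hs.nodup c
        rw [hqc, List.nodup_cons] at hnd
        simp only [hvc, le_refl, hqc, Function.update_self, hnd.1, List.mem_cons, true_or,
          not_true_eq_false, and_false, if_false, not_false_eq_true, and_self, if_true] at h₂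
        simp only [UpdateState.potential] at hB ⊢
        convert_to _ ≤ B
        omega
  · simp only [wp_bind, wp_read, wp_write]
    have hs' := hs.popEdge hqc
    have he := (hs.entry_edge c e (by simp [hqc])).2.1
    have hsum := sum_weight_tail hqc hc
    have h₅ : entryWeight (Sum.inr e : V ⊕ Sym2 V) = 25 := rfl
    have h₂ := sum_idle_congr (G := G) (inc := inc) (c := c) (s := s)
      (s' := { s with queue := Function.update s.queue c q })
      (fun w => by
        dsimp only
        rw [not_iff_not.2 ⟨mem_update_tail hqc,
          fun h => mem_update_tail_of_ne hqc h (by simp)⟩])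
    have hpot : n + 1 + 1 + 1 + 1 +
        ({ s with queue := Function.update s.queue c q } : UpdateState V).potential G inc Ts Te c +
          21 ≤ B := by
      simp only [UpdateState.potential] at hB ⊢
      dsimp only at h₂ ⊢
      rw [h₂]
      omega
    split_ifs with hec
    · simp only [wp_pure]
      refine ⟨by omega, hs'.mono ?_ ?_, by omega⟩
      · exact fun _ _ _ _ h => h.elim
      · exact fun _ _ _ _ _ _ h _ => absurd h.1 hec
    · rw [not_ne_iff] at hec
      refine wp_raiseVerts hτ hinc hG hkey hlev he hec (hs'.mono ?_ ?_) (by omega) hpot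
      · exact fun _ _ _ _ h => h.elim
      · exact fun _ _ _ _ _ _ h _ => .inr h.2

end CoreT

/-! ### `CoreT_Update` as a whole. -/

namespace CoreT

open Timed

variable {V : Type} [LinearOrder V] {k : ℕ} {G : Store V} {Ts Te : ℕ}

theorem max_mem_levels {a b : Time} (ha : a ∈ levels Ts Te) (hb : b ∈ levels Ts Te) :
    max a b ∈ levels Ts Te := by
  rcases max_choice a b with h | h <;> rw [h]
  exacts [ha, hb]

/-- The edge set stays that of `G` throughout the propagation. Edges left without timestamps have
support time `⊤`, so they play no part in cores at finite times and can be discarded at the end. -/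
theorem wp_update (hk : 1 ≤ k) (hG : G.WellFormed Ts Te) {snap : ℕ → List (Sym2 V)} {x : ℕ}
    {σ : CoreTimes V} {n : ℕ} {Q : CoreTimes V × Store V → ℕ → Prop}
    (nodup : (snap x).Nodup) (hsub : ∀ e ∈ snap x, e ∈ G.edges)
    (htail : ∀ e ∈ snap x, firstTime (G.times e).tail ∈ levels Ts Te ∧
      firstTime (G.times e) ≤ firstTime (G.times e).tail)
    (hσ : IsCoreTime k G.edges.toFinset (fun e => firstTime (G.times e)) σ.vert)
    (hσe : ∀ e ∈ G.edges,
      σ.edge e = max (max (σ.vert e.inf) (σ.vert e.sup)) (firstTime (G.times e)))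
    (h : ∀ (σ' : CoreTimes V) (G' : Store V) (m : ℕ), G'.verts = G.verts →
      (∀ e, G'.times e = if e ∈ snap x then (G.times e).tail else G.times e) → G'.edges.Nodup →
      (∀ e, e ∈ G'.edges ↔ e ∈ G.edges ∧ G'.times e ≠ []) →
      IsCoreTime k G'.edges.toFinset (fun e => firstTime (G'.times e)) σ'.vert →
      (∀ e ∈ G'.edges,
        σ'.edge e = max (max (σ'.vert e.inf) (σ'.vert e.sup)) (firstTime (G'.times e))) →
      m ≤ n + 150 * G.edges.length + 10 * G.verts.length + 5 * (levels Ts Te).length + 10 →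
      Q (σ', G') m) :
    wp (update k Ts Te snap x σ G) n Q := by
  have hgone : (snap x).length ≤ G.edges.length := by
    rw [← List.toFinset_card_of_nodup nodup, ← List.toFinset_card_of_nodup hG.nodup_edges]
    exact Finset.card_le_card fun e he => by simpa using hsub e (by simpa using he)
  rw [update]
  simp only [wp_bind, wp_read]
  let T : Sym2 V → List ℕ := fun e => if e ∈ snap x then (G.times e).tail else G.times e
  have hsupT : ∀ e ∈ G.edges, firstTime (T e) ∈ levels Ts Te ∧
      firstTime (G.times e) ≤ firstTime (T e) := by
    intro e he
    by_cases hx : e ∈ snap x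
    · simpa only [T, hx, if_true] using htail e hx
    · simpa only [T, hx, if_false, le_refl, and_true] using hG.sup_mem e he
  refine wp_forEach (fun r s m =>
    (∀ e, s.1 e = if e ∈ snap x ∧ e ∉ r then (G.times e).tail else G.times e) ∧
    (∀ e ∈ G.edges, s.2.1 e = if e ∈ snap x ∧ e ∉ r then max (σ.edge e) (firstTime (T e)) else
      σ.edge e) ∧
    (∀ l, (s.2.2 l).Nodup) ∧ (∀ l v, Sum.inl v ∉ s.2.2 l) ∧
    (∀ l e, Sum.inr e ∈ s.2.2 l ↔
      e ∈ snap x ∧ e ∉ r ∧ σ.edge e < firstTime (T e) ∧ l = firstTime (T e)) ∧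
    ∑ l ∈ (levels Ts Te).toFinset, ((s.2.2 l).map entryWeight).sum + 25 * r.length ≤
      25 * (snap x).length ∧
    m + 7 * r.length ≤ n + 1 + 7 * (snap x).length) ?_ ?_ ?_
  · refine ⟨?_, ?_, ?_, ?_, ?_, ?_, ?_⟩ <;> simp +contextual
  · rintro p e r ⟨times, edge, queue⟩ m hl ⟨h₁, h₂, h₃, h₄, h₅, h₆, hm⟩
    dsimp only at h₁ h₂ h₃ h₄ h₅ h₆
    have hex : e ∈ snap x := by simp [hl]
    have her : e ∉ r := by
      rw [hl] at nodup
      exact (List.nodup_cons.1 (List.nodup_append.1 nodup).2.1).1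
    have heG := hsub e hex
    have hTe : T e = (G.times e).tail := by simp [T, hex]
    have ht : times e = G.times e := by simp [h₁]
    have hed : edge e = σ.edge e := by simp [h₂ e heG]
    simp only [List.length_cons] at h₆ hm
    simp only [wp_bind, wp_read, wp_write]
    rw [ht, hed, ← hTe]
    have g₁ : ∀ e', Function.update times e (T e) e' =
        if e' ∈ snap x ∧ e' ∉ r then (G.times e').tail else G.times e' := by
      intro e'
      by_cases hee : e' = e
      · subst hee
        simp [hex, her, hTe]
      · rw [Function.update_of_ne hee, h₁]
        simp [hee]
    split_ifs with hlt
    · simp only [wp_bind, wp_write, wp_push, wp_pure]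
      refine ⟨g₁, ?_, ?_, ?_, ?_, ?_, by omega⟩
      · intro e' he'
        by_cases hee : e' = e
        · subst hee
          simp [hex, her, max_eq_right hlt.le]
        · rw [Function.update_of_ne hee, h₂ e' he']
          simp [hee]
      · exact nodup_update_cons (by simp [h₅]) h₃
      · intro l v
        rw [mem_update_cons]
        simp [h₄]
      · intro l e'
        rw [mem_update_cons, h₅]
        by_cases hee : e' = e
        · subst hee
          simp [hex, her, hlt]
        · simp [hee]
      · have := sum_weight_cons (queue := queue) (a := Sum.inr e) (c := firstTime (T e))
          (L := (levels Ts Te).toFinset) (by simpa using (hsupT e heG).1)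
        have h₅ : entryWeight (Sum.inr e : V ⊕ Sym2 V) = 25 := rfl
        omega
    · simp only [wp_pure]
      refine ⟨g₁, ?_, h₃, h₄, ?_, by omega, by omega⟩
      · intro e' he'
        rw [h₂ e' he']
        by_cases hee : e' = e
        · subst hee
          simp [hex, her, max_eq_left (not_lt.1 hlt)]
        · simp [hee]
      · intro l e'
        rw [h₅]
        by_cases hee : e' = e
        · subst hee
          simp [hlt]
        · simp [hee]
  rintro ⟨times, edge, queue⟩ m₁ ⟨h₁, h₂, h₃, h₄, h₅, h₆, hm₁⟩
  simp only [List.not_mem_nil, not_false_eq_true, and_true, true_and, List.length_nil, mul_zero,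
    add_zero] at h₁ h₂ h₃ h₄ h₅ h₆ hm₁
  obtain rfl : times = T := funext h₁
  have hedge : ∀ e ∈ G.edges, edge e = max (σ.edge e) (firstTime (T e)) := by
    intro e he
    rw [h₂ e he]
    split_ifs with hx
    · rfl
    · rw [max_eq_left]
      simp only [T, hx, if_false, hσe e he]
      exact le_max_right _ _
  have hσlev : ∀ v, σ.vert v ∈ levels Ts Te := fun v =>
    hσ.mem_levels hk (fun e he => hG.sup_mem e (by simpa using he)) v
  have hlev : ∀ e ∈ G.edges, edge e ∈ levels Ts Te := by
    intro e he
    rw [hedge e he, hσe e he]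
    exact max_mem_levels (max_mem_levels (max_mem_levels (hσlev _) (hσlev _)) (hG.sup_mem e he))
      (hsupT e he).1
  dsimp only
  refine wp_sortedIncidence (levels_sorted Ts Te) hG.nodup_edges hG.loopless hlev ?_
  intro inc m₂ hinc hm₂
  refine wp_make hk hinc hG.nodup_verts ?_
  intro K m₃ hKd hKv hm₃
  -- The target of the propagation. It dominates the old core times because support times have only
  -- grown.
  obtain ⟨τ, hτ⟩ := exists_isCoreTime k G.edges.toFinset fun e => firstTime (T e)
  have hle : ∀ v, σ.vert v ≤ τ v := fun v => le_of_forall_coe fun t ht => by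
    rw [hσ]
    exact ((hτ t v).1 ht).mono fun e he hs =>
      ⟨he, (hsupT e (by simpa using he)).2.trans hs⟩
  have hInv₀ : UpdateInv k G (fun e => firstTime (T e)) edge inc τ (levels Ts Te)
      (fun _ _ => False) (fun _ _ => False) ⟨queue, σ.vert, edge, K⟩ := by
    constructor
    · exact h₃
    · exact fun l v hv => absurd hv (h₄ l v)
    · intro l e he
      obtain ⟨hx, hlt, rfl⟩ := (h₅ l e).1 he
      have heG := hsub e hx
      exact ⟨(hsupT e heG).1, heG, (le_max_right _ _).trans (hedge e heG).ge⟩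
    · exact hle
    · intro e he
      dsimp only
      rw [hedge e he, hσe e he]
      refine max_le (max_le_max (max_le_max (hle _) (hle _)) (hsupT e he).2) (le_max_right _ _)
    · exact fun e he => (le_max_right _ _).trans (hedge e he).ge
    · intro e _ hd
      simp [hKd] at hd
    · exact fun _ _ _ => rfl
    · intro v hv
      have := hKv v hv
      rwa [← hKd] at this
    · intro e he v hv
      left
      dsimp only
      rw [hedge e he, hσe e he]
      refine le_max_of_le_left (le_max_of_le_left ?_)
      obtain rfl | rfl := (mem_iff_inf_or_sup e v).1 hv
      exacts [le_max_left _ _, le_max_right _ _]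
    · intro v t ht
      -- The counting condition held for the old values. If it fails now, some counted edge was
      -- raised above `t` by the loss of its earliest timestamp, and exactly such edges were queued.
      have hdeg : k ≤ deg G.edges.toFinset v fun e => σ.edge e ≤ WithTop.some t := by
        refine (cohesive_inCore _ v ((hσ t v).1 ht)).trans (deg_mono fun e he _ hs => ?_)
        rw [hσe e (by simpa using he)]
        exact max_le (max_le ((hσ t _).2 (hs.2 _ (inf_mem e))) ((hσ t _).2 (hs.2 _ (sup_mem e))))
          hs.1
      refine or_iff_not_imp_left.2 fun hlt => ?_
      obtain ⟨e, he, hve, hσt, hnt⟩ := exists_of_deg_lt ((not_le.1 hlt).trans_le hdeg)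
      have he : e ∈ G.edges := by simpa using he
      dsimp only at hnt ⊢
      have hlt' : σ.edge e < firstTime (T e) := by
        rw [hedge e he, max_le_iff, not_and] at hnt
        exact hσt.trans_lt (not_le.1 (hnt hσt))
      have hx : e ∈ snap x := by
        by_contra hx
        refine hlt'.not_ge ?_
        simp only [T, hx, if_false, hσe e he]
        exact le_max_right _ _
      refine ⟨e, he, hve, not_le.1 hnt, .inl ((h₅ _ _).2 ⟨hx, hlt', ?_⟩)⟩
      rw [hedge e he, max_eq_right hlt'.le]
  have hsum := hinc.sum_length_le hG.nodup_edges G.verts.toFinset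
  -- Each queued edge contributes 25. The incidence lists have total length at most twice the number
  -- of edges, each position weighing 47 + 1; hence 96.
  have hpot₀ : UpdateState.potential G inc Ts Te ⊤ ⟨queue, σ.vert, edge, K⟩ ≤
      25 * (snap x).length + 96 * G.edges.length + 2 * G.verts.length := by
    have hsumk : ∑ v ∈ G.verts.toFinset, (K.rest v).length ≤
        ∑ v ∈ G.verts.toFinset, (inc v).length :=
      Finset.sum_le_sum fun v hv => (hKv v (by simpa using hv)).rest_length_le
    have hsumi : ∑ v ∈ G.verts.toFinset, (47 * (inc v).length + 2) =
        47 * ∑ v ∈ G.verts.toFinset, (inc v).length + 2 * G.verts.length := by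
      simp [Finset.sum_add_distrib, Finset.mul_sum,
        List.toFinset_card_of_nodup hG.nodup_verts, mul_comm]
    classical
    have hsumi' : ∑ v ∈ G.verts.toFinset, (if ⊤ ≤ σ.vert v ∧ Sum.inl v ∉ queue (σ.vert v) then 0
        else 47 * (inc v).length + 2) ≤ ∑ v ∈ G.verts.toFinset, (47 * (inc v).length + 2) :=
      Finset.sum_le_sum fun v _ => by split_ifs <;> omega
    rw [UpdateState.potential]
    convert_to _ + (∑ v ∈ G.verts.toFinset, (if ⊤ ≤ σ.vert v ∧ Sum.inl v ∉ queue (σ.vert v) then 0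
        else 47 * (inc v).length + 2)) + ∑ v ∈ G.verts.toFinset, (K.rest v).length ≤ _
    dsimp only
    omega
  refine wp_forEach (fun r s m => UpdateInv k G (fun e => firstTime (T e)) edge inc τ r
      (fun _ _ => False) (fun _ _ => False) s ∧
    ∃ c, (∀ l ∈ r, l ≤ c) ∧ m + s.potential G inc Ts Te c + 2 * r.length ≤ m₃ +
      25 * (snap x).length + 96 * G.edges.length + 2 * G.verts.length +
      2 * (levels Ts Te).length)
    ⟨hInv₀, ⊤, fun _ _ => le_top, by omega⟩ ?_ ?_
  · rintro p c r s m hl ⟨hs, c', hc', hm⟩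
    -- Passing to a lower level can only release vertex weights.
    have hidle : s.potential G inc Ts Te c ≤ s.potential G inc Ts Te c' := by
      rw [UpdateState.potential, UpdateState.potential]
      refine Nat.add_le_add_right (Nat.add_le_add_left (Finset.sum_le_sum fun v _ => ?_) _) _
      have := hc' c (by simp)
      by_cases hv : c' ≤ s.vert v ∧ Sum.inl v ∉ s.queue (s.vert v)
      · rw [if_pos hv, if_pos ⟨this.trans hv.1, hv.2⟩]
      · rw [if_neg hv]
        split_ifs <;> omega
    obtain ⟨B, hB⟩ : ∃ B, B = m + 1 + s.potential G inc Ts Te c := ⟨_, rfl⟩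
    refine wp_whileDo (fun s m' => UpdateInv k G (fun e => firstTime (T e)) edge inc τ (c :: r)
      (fun _ _ => False) (fun _ _ => False) s ∧
      m' + s.potential G inc Ts Te c ≤ B) B (fun s m h => by omega) ⟨hs, hB.ge⟩ ?_ ?_
    · rintro s m hq ⟨hs, hm⟩
      exact wp_updateRound hτ hinc hG hlev hl hs hm (by simpa using hq)
    · rintro s m' hq ⟨hs, hm'⟩
      simp only [Bool.not_eq_eq_eq_not, Bool.not_false, List.isEmpty_iff] at hq
      refine ⟨{ hs with entry_vert := ?_, entry_edge := ?_, deleted := ?_ }, c,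
        fun l hl' => le_of_mem_levels hl (List.mem_cons_of_mem _ hl'), ?_⟩
      · intro l v hv
        obtain ⟨h₁, h₂⟩ := hs.entry_vert l v hv
        refine ⟨(List.mem_cons.1 h₁).resolve_left ?_, h₂⟩
        rintro rfl
        simp [hq] at hv
      · intro l e he
        obtain ⟨h₁, h₂⟩ := hs.entry_edge l e he
        refine ⟨(List.mem_cons.1 h₁).resolve_left ?_, h₂⟩
        rintro rfl
        simp [hq] at he
      · exact fun e he hd l hl => hs.deleted e he hd l (List.mem_cons_of_mem _ hl)
      · simp only [List.length_cons] at hm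
        omega
  · rintro s m ⟨hs, c, -, hm⟩
    obtain ⟨hvert, hedge'⟩ := hs.isCoreTime hτ
    refine wp_forEach (fun r es m' => es.Nodup ∧
      (∀ e, e ∈ es ↔ e ∈ G.edges ∧ e ∉ r ∧ T e ≠ []) ∧
      m' + 2 * r.length = m + 1 + 2 * G.edges.length) ⟨by simp, by simp +contextual, rfl⟩ ?_ ?_
    · rintro p e r es m hl ⟨g₁, g₂, hm⟩
      have her : e ∉ r := by
        have := hG.nodup_edges
        rw [hl] at this
        exact (List.nodup_cons.1 (List.nodup_append.1 this).2.1).1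
      have heG : e ∈ G.edges := by simp [hl]
      simp only [List.length_cons] at hm
      simp only [wp_bind, wp_read, wp_pure]
      split_ifs with hT
      · refine ⟨g₁, fun e' => ?_, by omega⟩
        rw [List.isEmpty_iff] at hT
        rw [g₂]
        by_cases hee : e' = e
        · subst hee
          simp [hT]
        · simp [hee]
      · refine ⟨List.nodup_cons.2 ⟨by simp [g₂], g₁⟩, fun e' => ?_, by omega⟩
        rw [List.isEmpty_iff] at hT
        rw [List.mem_cons, g₂]
        by_cases hee : e' = e
        · subst hee
          simp [hT, heG, her]
        · simp [hee]
    · rintro es m' ⟨g₁, g₂, hm'⟩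
      simp only [wp_pure]
      refine h _ _ _ rfl h₁ g₁ (fun e => by simp [g₂]) (fun c v => ?_) (fun e he => ?_) ?_
      · rw [show _ ↔ _ from hvert c v]
        constructor
        · refine fun h => h.mono fun e he hs => ⟨?_, hs⟩
          simp only [List.mem_toFinset] at he ⊢
          rw [g₂]
          refine ⟨he, by simp, fun hT => ?_⟩
          rw [hT] at hs
          simp [firstTime] at hs
        · refine fun h => h.mono fun e he hs => ⟨?_, hs⟩
          simp only [List.mem_toFinset] at he ⊢
          exact ((g₂ e).1 he).1
      · exact hedge' e ((g₂ e).1 he).1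
      · simp only [List.length_nil] at hm hm'
        omega

end CoreT

/-! ### Temporal `k`-cores and core times -/

namespace TemporalGraph

open CoreT

variable {V : Type} {G H H' : TemporalGraph V} {k ts te : ℕ}

/-- `H` is an induced subgraph of the projected graph over `[ts, te]` in which every vertex has at
least `k` neighbours. -/
def IsCandidate (G : TemporalGraph V) (k ts te : ℕ) (H : TemporalGraph V) : Prop :=
  H.IsInducedSubgraph (G.proj ts te) ∧ ∀ v ∈ H.verts, k ≤ (H.neighbors v).ncard

theorem mem_proj_edges {a : Sym2 V × ℕ} :
    a ∈ (G.proj ts te).edges ↔ a ∈ G.edges ∧ ts ≤ a.2 ∧ a.2 ≤ te := by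
  simp [proj]

theorem finite_neighbors (H : TemporalGraph V) (v : V) : (H.neighbors v).Finite := by
  refine (H.verts.finite_toSet).subset ?_
  rintro u ⟨t, ht⟩
  exact H.incident _ ht u (Sym2.mem_mk_right v u)

variable [LinearOrder V]

/-- The map `u ↦ s(v, u)` is injective, so counting distinct neighbours is counting static edges at
`v`. The hypothesis `hE` ties `E` and `sup` to the edges of the time interval; it is the bridge
between temporal graphs and cohesive sets. -/
theorem ncard_neighbors {E : Finset (Sym2 V)} {sup : Sym2 V → Time} {c : Time}
    (hE : ∀ e, (e ∈ E ∧ sup e ≤ c) ↔ ∃ t, ts ≤ t ∧ t ≤ te ∧ (e, t) ∈ G.edges)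
    (hH : H.IsInducedSubgraph (G.proj ts te)) (v : V) :
    (H.neighbors v).ncard = deg E v fun e => sup e ≤ c ∧ ∀ u ∈ e, u ∈ H.verts := by
  classical
  rw [← Set.ncard_image_of_injective (H.neighbors v) (f := fun u => s(v, u))
    (fun a b h => Sym2.congr_right.1 h), deg, ← Set.ncard_coe_finset]
  congr 1
  ext e
  simp only [Set.mem_image, Finset.coe_filter, Set.mem_ofPred_eq, neighbors]
  constructor
  · rintro ⟨u, ⟨t, ht⟩, rfl⟩
    obtain ⟨h₁, h₂⟩ := (hH.2 _).1 ht
    rw [mem_proj_edges] at h₁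
    obtain ⟨h₃, h₄⟩ := (hE _).2 ⟨t, h₁.2.1, h₁.2.2, h₁.1⟩
    exact ⟨h₃, Sym2.mem_mk_left v u, h₄, h₂⟩
  · rintro ⟨he, hv, hs, hu⟩
    obtain ⟨t, h₁, h₂, h₃⟩ := (hE e).1 ⟨he, hs⟩
    obtain ⟨u, rfl⟩ := Sym2.mem_iff_exists.1 hv
    exact ⟨u, ⟨t, (hH.2 _).2 ⟨mem_proj_edges.2 ⟨h₃, h₁, h₂⟩, hu⟩⟩, rfl⟩

theorem isCandidate_iff {E : Finset (Sym2 V)} {sup : Sym2 V → Time} {c : Time}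
    (hE : ∀ e, (e ∈ E ∧ sup e ≤ c) ↔ ∃ t, ts ≤ t ∧ t ≤ te ∧ (e, t) ∈ G.edges) :
    G.IsCandidate k ts te H ↔
      H.IsInducedSubgraph (G.proj ts te) ∧ Cohesive k E sup c {v | v ∈ H.verts} := by
  refine and_congr_right fun hH => forall₂_congr fun v hv => ?_
  rw [ncard_neighbors hE hH]
  rfl

/-- The graph on the vertices that are in the core is the greatest candidate. -/
theorem isCandidate_of_inCore {E : Finset (Sym2 V)} {sup : Sym2 V → Time} {c : Time}
    (hE : ∀ e, (e ∈ E ∧ sup e ≤ c) ↔ ∃ t, ts ≤ t ∧ t ≤ te ∧ (e, t) ∈ G.edges)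
    (hv : ∀ v, v ∈ H.verts ↔ InCore k E sup c v)
    (hH : H.IsInducedSubgraph (G.proj ts te)) :
    G.IsCandidate k ts te H ∧ ∀ H', G.IsCandidate k ts te H' → H' ≤ H := by
  have hset : {v | v ∈ H.verts} = {v | InCore k E sup c v} := Set.ext hv
  refine ⟨(isCandidate_iff hE).2 ⟨hH, hset ▸ cohesive_inCore c⟩, fun H' h' => ?_⟩
  obtain ⟨h₁, h₂⟩ := (isCandidate_iff hE).1 h'
  have hverts : H'.verts ⊆ H.verts := fun v hv' => (hv v).2 ⟨_, h₂, hv'⟩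
  refine ⟨hverts, fun a ha => (hH.2 a).2 ?_⟩
  obtain ⟨h₃, h₄⟩ := (h₁.2 a).1 ha
  exact ⟨h₃, fun v hv => hverts (h₄ v hv)⟩

theorem le_antisymm' (h : H ≤ H') (h' : H' ≤ H) : H = H' :=
  TemporalGraph.ext (h.1.antisymm h'.1) (h.2.antisymm h'.2)

/-- A greatest candidate is the only maximal one, so "the" temporal `k`-core is well defined. -/
theorem isTemporalKCore_iff (h : G.IsCandidate k ts te H ∧ ∀ H', G.IsCandidate k ts te H' → H' ≤ H) :
    G.IsTemporalKCore k ts te H' ↔ H' = H := by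
  constructor
  · intro h'
    exact le_antisymm' (h.2 _ h'.1) (h'.2 h.1 (h.2 _ h'.1))
  · rintro rfl
    exact ⟨h.1, fun H'' h'' _ => h.2 _ h''⟩

/-- Support times play no role for a single interval, so the constant `⊥` with `c = ⊤` is used.
Positivity of `k` keeps the core inside the vertex set of `G`. -/
theorem exists_greatest (hk : 1 ≤ k) (G : TemporalGraph V) (ts te : ℕ) :
    ∃ H, G.IsCandidate k ts te H ∧ ∀ H', G.IsCandidate k ts te H' → H' ≤ H := by
  classical
  let E : Finset (Sym2 V) := (G.proj ts te).edges.image Prod.fst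
  have hE : ∀ e, (e ∈ E ∧ (fun _ => ⊥ : Sym2 V → Time) e ≤ ⊤) ↔
      ∃ t, ts ≤ t ∧ t ≤ te ∧ (e, t) ∈ G.edges := by
    intro e
    simp only [E, Finset.mem_image, mem_proj_edges, bot_le, and_true, Prod.exists,
      exists_and_right, exists_eq_right]
    exact exists_congr fun t => by tauto
  have hsub : ∀ v, InCore k E (fun _ => ⊥) ⊤ v → v ∈ G.verts := by
    intro v hv
    obtain ⟨e, he, hve, -⟩ := hv.exists_edge hk
    obtain ⟨t, -, -, ht⟩ := (hE e).1 ⟨he, bot_le⟩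
    exact G.incident _ ht v hve
  let H : TemporalGraph V :=
  { verts := G.verts.filter fun v => InCore k E (fun _ => ⊥) ⊤ v
    edges := (G.proj ts te).edges.filter fun a => ∀ v ∈ a.1, InCore k E (fun _ => ⊥) ⊤ v
    incident := fun a ha v hv => by
      have := (Finset.mem_filter.1 ha).2 v hv
      exact Finset.mem_filter.2 ⟨hsub v this, this⟩
    loopless := fun a ha => (G.proj ts te).loopless a (Finset.mem_filter.1 ha).1 }
  have hv : ∀ v, v ∈ H.verts ↔ InCore k E (fun _ => ⊥) ⊤ v := fun v => by
    simpa [H] using hsub v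
  refine ⟨H, isCandidate_of_inCore hE hv ⟨fun v hv' => hsub v ((hv v).1 hv'), fun a => ?_⟩⟩
  simp only [hv]
  simp [H]

theorem IsTemporalKCore.isGreatest (hk : 1 ≤ k) (h : G.IsTemporalKCore k ts te H) :
    G.IsCandidate k ts te H ∧ ∀ H', G.IsCandidate k ts te H' → H' ≤ H := by
  obtain ⟨H₀, h₀⟩ := exists_greatest hk G ts te
  obtain rfl := (isTemporalKCore_iff h₀).1 h
  exact h₀

/-! ### Tightest time intervals -/

/-- `o` is the interval from the earliest to the latest timestamp in `F`. -/
def IsTightest (o : Option (ℕ × ℕ)) (F : Sym2 V × ℕ → Prop) : Prop :=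
  match o with
  | none => ∀ a, ¬ F a
  | some (x, y) => (∃ e, F (e, x)) ∧ (∃ e, F (e, y)) ∧ ∀ a, F a → x ≤ a.2 ∧ a.2 ≤ y

theorem IsTightest.congr {o : Option (ℕ × ℕ)} {F F' : Sym2 V × ℕ → Prop} (h : IsTightest o F)
    (hF : ∀ a, F' a ↔ F a) : IsTightest o F' := by
  have : F' = F := funext fun a => propext (hF a)
  exact this ▸ h

theorem IsTightest.unique {o o' : Option (ℕ × ℕ)} {F : Sym2 V × ℕ → Prop} (h : IsTightest o F)
    (h' : IsTightest o' F) : o = o' := by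
  rcases o with _ | ⟨x, y⟩ <;> rcases o' with _ | ⟨x', y'⟩
  · rfl
  · obtain ⟨⟨e, he⟩, -⟩ := h'
    exact absurd he (h _)
  · obtain ⟨⟨e, he⟩, -⟩ := h
    exact absurd he (h' _)
  · obtain ⟨⟨e₁, h₁⟩, ⟨e₂, h₂⟩, h₃⟩ := h
    obtain ⟨⟨e₁', h₁'⟩, ⟨e₂', h₂'⟩, h₃'⟩ := h'
    have := h₃ _ h₁'
    have := h₃ _ h₂'
    have := h₃' _ h₁
    have := h₃' _ h₂
    simp only at *
    rw [show x = x' by omega, show y = y' by omega]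

theorem IsTightest.extend {o : Option (ℕ × ℕ)} {l : List (Sym2 V × ℕ)} (a : Sym2 V × ℕ)
    (h : IsTightest o (· ∈ l)) : IsTightest (CoreT.extend a.2 o) (· ∈ a :: l) := by
  obtain ⟨e, t⟩ := a
  rcases o with _ | ⟨x, y⟩
  · refine ⟨⟨e, by simp⟩, ⟨e, by simp⟩, fun a ha => ?_⟩
    obtain rfl | ha := List.mem_cons.1 ha
    · exact ⟨le_rfl, le_rfl⟩
    · exact absurd ha (h a)
  · obtain ⟨⟨e₁, h₁⟩, ⟨e₂, h₂⟩, h₃⟩ := h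
    refine ⟨?_, ?_, fun a ha => ?_⟩
    · rcases min_choice x t with h | h <;> rw [h]
      exacts [⟨e₁, by simp [h₁]⟩, ⟨e, by simp⟩]
    · rcases max_choice y t with h | h <;> rw [h]
      exacts [⟨e₂, by simp [h₂]⟩, ⟨e, by simp⟩]
    · obtain rfl | ha := List.mem_cons.1 ha
      · exact ⟨min_le_right _ _, le_max_right _ _⟩
      · exact ⟨min_le_of_left_le (h₃ a ha).1, le_max_of_le_left (h₃ a ha).2⟩

/-- The shared tightest interval lies in `[ts', te']`, because edges of `H'` attain its ends. So all
edges of `H` lie in `[ts', te']`, and the vertices of `H` induce a candidate there. For two graphs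
without edges the argument is vacuous but still valid. -/
theorem IsTemporalKCore.verts_subset (hk : 1 ≤ k) {ts' te' : ℕ} {o : Option (ℕ × ℕ)}
    (h : G.IsTemporalKCore k ts te H) (h' : G.IsTemporalKCore k ts' te' H')
    (ho : IsTightest o (· ∈ H.edges)) (ho' : IsTightest o (· ∈ H'.edges)) :
    H.verts ⊆ H'.verts := by
  classical
  have hsub : ∀ a ∈ H.edges, ts' ≤ a.2 ∧ a.2 ≤ te' := by
    intro a ha
    rcases o with _ | ⟨x, y⟩
    · exact absurd ha (ho a)
    · obtain ⟨⟨e₁, h₁⟩, ⟨e₂, h₂⟩, -⟩ := ho'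
      have g₁ := (mem_proj_edges.1 ((h'.1.1.2 _).1 h₁).1).2
      have g₂ := (mem_proj_edges.1 ((h'.1.1.2 _).1 h₂).1).2
      have g₃ := ho.2.2 a ha
      exact ⟨g₁.1.trans g₃.1, g₃.2.trans g₂.2⟩
  let H₁ : TemporalGraph V :=
  { verts := H.verts
    edges := (G.proj ts' te').edges.filter fun a => ∀ v ∈ a.1, v ∈ H.verts
    incident := fun a ha v hv => (Finset.mem_filter.1 ha).2 v hv
    loopless := fun a ha => (G.proj ts' te').loopless a (Finset.mem_filter.1 ha).1 }
  have h₁ : G.IsCandidate k ts' te' H₁ := by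
    refine ⟨⟨h.1.1.1, fun a => by simp [H₁]⟩, fun v hv => (h.1.2 v hv).trans ?_⟩
    refine Set.ncard_le_ncard ?_ (finite_neighbors H₁ v)
    rintro u ⟨t, ht⟩
    obtain ⟨g₁, g₂⟩ := (h.1.1.2 _).1 ht
    exact ⟨t, Finset.mem_filter.2 ⟨mem_proj_edges.2 ⟨(mem_proj_edges.1 g₁).1, hsub _ ht⟩, g₂⟩⟩
  exact ((h'.isGreatest hk).2 _ h₁).1

/-- Temporal `k`-cores with the same tightest time interval are equal. -/
theorem IsTemporalKCore.eq_of_isTightest (hk : 1 ≤ k) {ts' te' : ℕ} {o : Option (ℕ × ℕ)}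
    (h : G.IsTemporalKCore k ts te H) (h' : G.IsTemporalKCore k ts' te' H')
    (ho : IsTightest o (· ∈ H.edges)) (ho' : IsTightest o (· ∈ H'.edges)) : H = H' := by
  have hv := (h.verts_subset hk h' ho ho').antisymm (h'.verts_subset hk h ho' ho)
  have hsub : ∀ {ts te ts' te' : ℕ} {H H' : TemporalGraph V}, G.IsTemporalKCore k ts te H →
      G.IsTemporalKCore k ts' te' H' → IsTightest o (· ∈ H.edges) →
      IsTightest o (· ∈ H'.edges) → H.verts = H'.verts → H.edges ⊆ H'.edges := by
    intro ts te ts' te' H H' h h' ho ho' hv a ha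
    obtain ⟨g₁, g₂⟩ := (h.1.1.2 a).1 ha
    refine (h'.1.1.2 a).2 ⟨mem_proj_edges.2 ⟨(mem_proj_edges.1 g₁).1, ?_⟩, hv ▸ g₂⟩
    rcases o with _ | ⟨x, y⟩
    · exact absurd ha (ho a)
    · obtain ⟨⟨e₁, h₁⟩, ⟨e₂, h₂⟩, -⟩ := ho'
      have g₁ := (mem_proj_edges.1 ((h'.1.1.2 _).1 h₁).1).2
      have g₂ := (mem_proj_edges.1 ((h'.1.1.2 _).1 h₂).1).2
      have g₃ := ho.2.2 a ha
      exact ⟨g₁.1.trans g₃.1, g₃.2.trans g₂.2⟩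
  exact TemporalGraph.ext hv ((hsub h h' ho ho' hv).antisymm (hsub h' h ho' ho hv.symm))

end TemporalGraph

namespace CoreT

open Timed TemporalGraph

variable {V : Type} [LinearOrder V] {k Ts Te x : ℕ}

/-! ### Stored graphs that represent a projected graph -/

/-- The store `S` represents the projected graph of `G` over `[x, Te]`, where its vertices are those
of the projected graph over `[Ts, Te]`. -/
structure Store.Represents (S : Store V) (G : TemporalGraph V) (Ts Te x : ℕ) : Prop where
  nodup_verts : S.verts.Nodup
  mem_verts : ∀ v, v ∈ S.verts ↔ ∃ a ∈ (G.proj Ts Te).edges, v ∈ a.1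
  nodup_edges : S.edges.Nodup
  mem_edges : ∀ e, e ∈ S.edges ↔ S.times e ≠ []
  sorted : ∀ e, (S.times e).Pairwise (· < ·)
  mem_times : ∀ e t, t ∈ S.times e ↔ (e, t) ∈ (G.proj x Te).edges

/-- The core times `σ` are correct for the stored graph. -/
def CoreTimes.Correct (σ : CoreTimes V) (k : ℕ) (S : Store V) : Prop :=
  IsCoreTime k S.edges.toFinset (fun e => firstTime (S.times e)) σ.vert ∧
    ∀ e ∈ S.edges, σ.edge e = max (max (σ.vert e.inf) (σ.vert e.sup)) (firstTime (S.times e))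

theorem firstTime_le_iff {l : List ℕ} (hl : l.Pairwise (· < ·)) (c : ℕ) :
    firstTime l ≤ WithTop.some c ↔ ∃ t ∈ l, t ≤ c := by
  cases l with
  | nil => simp [firstTime]
  | cons t l =>
    rw [firstTime, WithTop.coe_le_coe]
    refine ⟨fun h => ⟨t, by simp, h⟩, ?_⟩
    rintro ⟨u, hu, huc⟩
    obtain rfl | hu := List.mem_cons.1 hu
    · exact huc
    · exact ((List.pairwise_cons.1 hl).1 u hu).le.trans huc

theorem firstTime_mem {l : List ℕ} {t : ℕ} (h : firstTime l = WithTop.some t) : t ∈ l := by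
  cases l with
  | nil => simp [firstTime] at h
  | cons u l =>
    rw [firstTime, WithTop.coe_inj] at h
    simp [h]

variable {S : Store V} {G : TemporalGraph V}

namespace Store.Represents

theorem exists_time (h : S.Represents G Ts Te x) {e : Sym2 V} (he : e ∈ S.edges) :
    ∃ t, (e, t) ∈ (G.proj x Te).edges := by
  obtain ⟨t, ht⟩ := List.exists_mem_of_ne_nil _ ((h.mem_edges e).1 he)
  exact ⟨t, (h.mem_times e t).1 ht⟩

theorem wellFormed (h : S.Represents G Ts Te x) (hx : Ts ≤ x) : S.WellFormed Ts Te where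
  nodup_verts := h.nodup_verts
  nodup_edges := h.nodup_edges
  mem_verts e he v hv := by
    obtain ⟨t, ht⟩ := h.exists_time he
    rw [mem_proj_edges] at ht
    exact (h.mem_verts v).2 ⟨(e, t), mem_proj_edges.2 ⟨ht.1, hx.trans ht.2.1, ht.2.2⟩, hv⟩
  loopless e he := by
    obtain ⟨t, ht⟩ := h.exists_time he
    exact (G.proj x Te).loopless _ ht
  sup_mem e he := by
    rw [mem_levels]
    intro t ht
    have := mem_proj_edges.1 ((h.mem_times e t).1 (firstTime_mem ht))
    exact ⟨hx.trans this.2.1, this.2.2⟩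

/-- This is the hypothesis `hE` of the core lemmas for support times read off from the store; it
needs `te ≤ Te` because later timestamps are not stored. -/
theorem edge_iff (h : S.Represents G Ts Te x) {te : ℕ} (hte : te ≤ Te) (e : Sym2 V) :
    (e ∈ S.edges.toFinset ∧ firstTime (S.times e) ≤ WithTop.some te) ↔
      ∃ t, x ≤ t ∧ t ≤ te ∧ (e, t) ∈ G.edges := by
  rw [firstTime_le_iff (h.sorted e), List.mem_toFinset, h.mem_edges]
  constructor
  · rintro ⟨-, t, ht, hc⟩
    have := mem_proj_edges.1 ((h.mem_times e t).1 ht)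
    exact ⟨t, this.2.1, hc, this.1⟩
  · rintro ⟨t, h₁, h₂, h₃⟩
    have := (h.mem_times e t).2 (mem_proj_edges.2 ⟨h₃, h₁, h₂.trans hte⟩)
    exact ⟨List.ne_nil_of_mem this, t, this, h₂⟩

theorem length_edges_le (h : S.Represents G Ts Te x) (hx : Ts ≤ x) :
    S.edges.length ≤ (G.proj Ts Te).edges.card := by
  rw [← List.toFinset_card_of_nodup h.nodup_edges]
  refine (Finset.card_le_card (t := (G.proj Ts Te).edges.image Prod.fst) fun e he => ?_).trans
    Finset.card_image_le
  obtain ⟨t, ht⟩ := h.exists_time (by simpa using he)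
  rw [mem_proj_edges] at ht
  exact Finset.mem_image.2 ⟨(e, t), mem_proj_edges.2 ⟨ht.1, hx.trans ht.2.1, ht.2.2⟩, rfl⟩

theorem length_verts_le (h : S.Represents G Ts Te x) :
    S.verts.length ≤ 2 * (G.proj Ts Te).edges.card := by
  rw [← List.toFinset_card_of_nodup h.nodup_verts]
  refine (Finset.card_le_card (t := (G.proj Ts Te).edges.biUnion fun a => {a.1.inf, a.1.sup})
    fun v hv => ?_).trans ?_
  · obtain ⟨a, ha, hva⟩ := (h.mem_verts v).1 (by simpa using hv)
    rw [Finset.mem_biUnion]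
    exact ⟨a, ha, by simpa using (mem_iff_inf_or_sup a.1 v).1 hva⟩
  · refine Finset.card_biUnion_le.trans ((Finset.sum_le_sum fun a _ => Finset.card_le_two).trans ?_)
    simp [mul_comm]

theorem length_pairs_le (h : S.Represents G Ts Te x) (hx : Ts ≤ x) :
    (S.edges.flatMap fun e => (S.times e).map fun t => (e, t)).length ≤
      (G.proj Ts Te).edges.card := by
  have hnd : (S.edges.flatMap fun e => (S.times e).map fun t => (e, t)).Nodup := by
    rw [List.nodup_flatMap]
    refine ⟨fun e _ => List.Nodup.map (fun a b h => (Prod.mk.inj h).2)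
      ((h.sorted e).imp fun h => ne_of_lt h), h.nodup_edges.imp fun {e e'} hee => ?_⟩
    intro a ha ha'
    simp only [List.mem_map] at ha ha'
    obtain ⟨t, -, rfl⟩ := ha
    obtain ⟨t', -, ha'⟩ := ha'
    exact hee (Prod.mk.inj ha').1.symm
  rw [← List.toFinset_card_of_nodup hnd]
  refine Finset.card_le_card fun a ha => ?_
  simp only [List.mem_toFinset, List.mem_flatMap, List.mem_map] at ha
  obtain ⟨e, -, t, ht, rfl⟩ := ha
  have := mem_proj_edges.1 ((h.mem_times e t).1 ht)
  exact mem_proj_edges.2 ⟨this.1, hx.trans this.2.1, this.2.2⟩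

end Store.Represents

/-- Guarantees that listing from end time `x` onwards misses no vertex. -/
theorem CoreTimes.Correct.le_vert {σ : CoreTimes V} (hσ : σ.Correct k S) (hk : 1 ≤ k)
    (h : S.Represents G Ts Te x) {v : V} {t : ℕ} (ht : σ.vert v ≤ WithTop.some t) : x ≤ t := by
  obtain ⟨e, he, -, hs⟩ := ((hσ.1 t v).1 ht).exists_edge hk
  obtain ⟨u, hu, hut⟩ := (firstTime_le_iff (h.sorted e) t).1 hs
  exact (mem_proj_edges.1 ((h.mem_times e u).1 hu)).2.1.trans hut

/-- The reported subgraph `A` is the temporal `k`-core over `[ts, te]`. -/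
def IsAnswer (G : TemporalGraph V) (k ts te : ℕ) (A : Answer V) : Prop :=
  ∃ H, G.IsTemporalKCore k ts te H ∧ (∀ v, v ∈ A.1 ↔ v ∈ H.verts) ∧ ∀ a, a ∈ A.2 ↔ a ∈ H.edges

/-- Core times determine the temporal `k`-cores. -/
theorem CoreTimes.Correct.isAnswer {σ : CoreTimes V} (hσ : σ.Correct k S) (hk : 1 ≤ k)
    (h : S.Represents G Ts Te x) (hx : Ts ≤ x) {te : ℕ} (hte : te ≤ Te) {A : Answer V}
    (hv : ∀ v, v ∈ A.1 ↔ v ∈ S.verts ∧ σ.vert v ≤ WithTop.some te)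
    (he : ∀ a : Sym2 V × ℕ, a ∈ A.2 ↔ a.1 ∈ S.edges ∧ a.2 ∈ S.times a.1 ∧
      max (σ.edge a.1) (WithTop.some a.2) ≤ WithTop.some te) : IsAnswer G k x te A := by
  have hE := h.edge_iff hte
  have hcore : ∀ v, v ∈ A.1 ↔
      InCore k S.edges.toFinset (fun e => firstTime (S.times e)) (WithTop.some te) v := by
    intro v
    rw [hv, hσ.1, and_iff_right_iff_imp]
    intro hc
    obtain ⟨e, he, hve, hs⟩ := hc.exists_edge hk
    exact (h.wellFormed hx).mem_verts e (by simpa using he) v hve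
  -- The core time of an edge is the maximum of its support time and its endpoints' core times. For
  -- a timestamp at most `te` the support time is no constraint, so only the endpoints matter.
  have hmem : ∀ a, a ∈ A.2 ↔ a ∈ (G.proj x te).edges ∧ ∀ v ∈ a.1, v ∈ A.1 := by
    rintro ⟨e, t⟩
    rw [he]
    dsimp only
    constructor
    · rintro ⟨h₁, h₂, h₃⟩
      obtain ⟨h₄, h₅⟩ := max_le_iff.1 h₃
      rw [hσ.2 e h₁, max_le_iff, max_le_iff] at h₄
      have := mem_proj_edges.1 ((h.mem_times e t).1 h₂)
      refine ⟨mem_proj_edges.2 ⟨this.1, this.2.1, WithTop.coe_le_coe.1 h₅⟩, fun v hv => ?_⟩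
      rw [hcore, ← hσ.1]
      obtain rfl | rfl := (mem_iff_inf_or_sup e v).1 hv
      exacts [h₄.1.1, h₄.1.2]
    · rintro ⟨h₁, h₂⟩
      obtain ⟨h₃, h₄, h₅⟩ := mem_proj_edges.1 h₁
      have h₆ := (h.mem_times e t).2 (mem_proj_edges.2 ⟨h₃, h₄, h₅.trans hte⟩)
      have h₇ := (h.mem_edges e).2 (List.ne_nil_of_mem h₆)
      refine ⟨h₇, h₆, max_le ?_ (WithTop.coe_le_coe.2 h₅)⟩
      rw [hσ.2 e h₇]
      refine max_le (max_le ?_ ?_) ((hE e).2 ⟨t, h₄, h₅, h₃⟩).2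
      · rw [hσ.1, ← hcore]
        exact h₂ _ (inf_mem e)
      · rw [hσ.1, ← hcore]
        exact h₂ _ (sup_mem e)
  let H : TemporalGraph V :=
  { verts := A.1.toFinset
    edges := A.2.toFinset
    incident := fun a ha v hv => by
      simp only [List.mem_toFinset] at ha ⊢
      exact ((hmem a).1 ha).2 v hv
    loopless := fun a ha => by
      simp only [List.mem_toFinset] at ha
      exact (G.proj x te).loopless a ((hmem a).1 ha).1 }
  have hH : H.IsInducedSubgraph (G.proj x te) := by
    refine ⟨fun v hv => ?_, fun a => by simpa [H] using hmem a⟩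
    simp only [H, List.mem_toFinset, hcore] at hv
    obtain ⟨e, he, hve, -⟩ := hv.exists_edge hk
    obtain ⟨t, ht⟩ := h.exists_time (by simpa using he)
    exact G.incident _ (mem_proj_edges.1 ht).1 v hve
  refine ⟨H, ?_, by simp [H], by simp [H]⟩
  rw [isTemporalKCore_iff (isCandidate_of_inCore hE (by simpa [H] using hcore) hH)]

end CoreT

namespace CoreT

open Timed TemporalGraph

variable {V : Type} [LinearOrder V] {k Ts Te x : ℕ} {S : Store V} {G : TemporalGraph V}

/-! ### `CoreT_List` -/

/-- The report is correct when the intervals `[ts, te]` with `D ts te` have been processed. -/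
structure Report.Correct (R : Report V) (G : TemporalGraph V) (k : ℕ) (D : ℕ → ℕ → Prop) :
    Prop where
  sound : ∀ A ∈ R.out, ∃ ts te, D ts te ∧ IsAnswer G k ts te A
  complete : ∀ ts te, D ts te → ∃ A ∈ R.out, IsAnswer G k ts te A
  seen : ∀ o, R.seen o = true ↔ ∃ A ∈ R.out, IsTightest o (· ∈ A.2)
  distinct : R.out.Pairwise fun A B => A.2.toFinset ≠ B.2.toFinset

theorem IsAnswer.of_isTightest (hk : 1 ≤ k) {ts te ts' te' : ℕ} {A B : Answer V}
    {o : Option (ℕ × ℕ)} (hA : IsAnswer G k ts te A) (hB : IsAnswer G k ts' te' B)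
    (ho : IsTightest o (· ∈ A.2)) (ho' : IsTightest o (· ∈ B.2)) : IsAnswer G k ts te B := by
  obtain ⟨H, h₁, h₂, h₃⟩ := hA
  obtain ⟨H', h₁', h₂', h₃'⟩ := hB
  obtain rfl := h₁.eq_of_isTightest hk h₁' (ho.congr fun a => (h₃ a).symm)
    (ho'.congr fun a => (h₃' a).symm)
  exact ⟨H, h₁, h₂', h₃'⟩

/-- A marked interval belongs to a core reported before, and cores with the same tightest interval
are equal. -/
theorem Report.Correct.skip (hk : 1 ≤ k) {R : Report V} {D : ℕ → ℕ → Prop}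
    (h : R.Correct G k D) {ts te : ℕ} {A : Answer V} {o : Option (ℕ × ℕ)}
    (hA : IsAnswer G k ts te A) (ho : IsTightest o (· ∈ A.2)) (hseen : R.seen o = true) :
    R.Correct G k (fun a b => D a b ∨ a = ts ∧ b = te) where
  __ := h
  sound B hB := by
    obtain ⟨a, b, h₁, h₂⟩ := h.sound B hB
    exact ⟨a, b, .inl h₁, h₂⟩
  complete a b hab := by
    obtain hab | ⟨rfl, rfl⟩ := hab
    · exact h.complete a b hab
    · obtain ⟨B, hB, ho'⟩ := (h.seen o).1 hseen
      obtain ⟨a', b', -, hB'⟩ := h.sound B hB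
      exact ⟨B, hB, hA.of_isTightest hk hB' ho ho'⟩

theorem Report.Correct.add {R : Report V} {D : ℕ → ℕ → Prop}
    (h : R.Correct G k D) {ts te : ℕ} {A : Answer V} {o : Option (ℕ × ℕ)}
    (hA : IsAnswer G k ts te A) (ho : IsTightest o (· ∈ A.2)) (hseen : R.seen o = false) :
    Report.Correct ⟨Function.update R.seen o true, A :: R.out⟩ G k
      (fun a b => D a b ∨ a = ts ∧ b = te) where
  sound B hB := by
    obtain rfl | hB := List.mem_cons.1 hB
    · exact ⟨ts, te, .inr ⟨rfl, rfl⟩, hA⟩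
    · obtain ⟨a, b, h₁, h₂⟩ := h.sound B hB
      exact ⟨a, b, .inl h₁, h₂⟩
  complete a b hab := by
    obtain hab | ⟨rfl, rfl⟩ := hab
    · obtain ⟨B, hB, h'⟩ := h.complete a b hab
      exact ⟨B, List.mem_cons_of_mem _ hB, h'⟩
    · exact ⟨A, by simp, hA⟩
  seen o' := by
    dsimp only
    by_cases hoo : o' = o
    · subst hoo
      simp only [Function.update_self, true_iff]
      exact ⟨A, by simp, ho⟩
    · rw [Function.update_of_ne hoo, h.seen]
      constructor
      · rintro ⟨B, hB, h'⟩
        exact ⟨B, List.mem_cons_of_mem _ hB, h'⟩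
      · rintro ⟨B, hB, h'⟩
        obtain rfl | hB := List.mem_cons.1 hB
        · exact absurd (h'.unique ho) hoo
        · exact ⟨B, hB, h'⟩
  distinct := by
    refine List.pairwise_cons.2 ⟨fun B hB hAB => ?_, h.distinct⟩
    -- Equal edge sets have equal tightest intervals, which would have been marked already.
    have : R.seen o = true := (h.seen o).2 ⟨B, hB, ho.congr fun a => by
      simpa using (Finset.ext_iff.1 hAB a).symm⟩
    simp [hseen] at this

theorem Report.Correct.congr {R : Report V} {D D' : ℕ → ℕ → Prop} (h : R.Correct G k D)
    (hD : ∀ a b, D a b ↔ D' a b) : R.Correct G k D' := by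
  have : D = D' := funext fun a => funext fun b => propext (hD a b)
  exact this ▸ h

/-- The nested loop is a bucket sort of the flattened list of pairs: 4 steps per static edge and 3
per temporal edge. -/
theorem wp_pairBuckets (σ : CoreTimes V) (S : Store V) (n : ℕ)
    (Q : (Time → List (Sym2 V × ℕ)) → ℕ → Prop)
    (h : Q (fun c => ((S.edges.flatMap fun e => (S.times e).map fun t => (e, t)).filter
        fun a => max (σ.edge a.1) (WithTop.some a.2) = c).reverse)
      (n + 4 * S.edges.length +
        3 * (S.edges.flatMap fun e => (S.times e).map fun t => (e, t)).length + 1)) :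
    wp (forEach S.edges ((fun _ => []) : Time → List (Sym2 V × ℕ)) fun e b => do
      let c ← read σ.edge e
      let l ← read S.times e
      forEach l b fun t b => push b (max c (WithTop.some t)) (e, t)) n Q := by
  set pairs := S.edges.flatMap fun e => (S.times e).map fun t => (e, t) with hpairs
  refine wp_forEach (fun r b m => ∃ p,
    pairs = p ++ (r.flatMap fun e => (S.times e).map fun t => (e, t)) ∧
    b = (fun c => (p.filter fun a => max (σ.edge a.1) (WithTop.some a.2) = c).reverse) ∧
    m + 4 * r.length + 3 * (r.flatMap fun e => (S.times e).map fun t => (e, t)).length =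
      n + 4 * S.edges.length + 3 * pairs.length) ⟨[], rfl, rfl, rfl⟩ ?_ ?_
  · rintro _ e r b m - ⟨p, hl, rfl, hm⟩
    simp only [wp_bind, wp_read]
    refine wp_forEach (fun ts b m => ∃ p,
      pairs = p ++ (ts.map fun t => (e, t)) ++
        (r.flatMap fun e => (S.times e).map fun t => (e, t)) ∧
      b = (fun c => (p.filter fun a => max (σ.edge a.1) (WithTop.some a.2) = c).reverse) ∧
      m + 1 + 4 * r.length + 3 * (ts.length +
        (r.flatMap fun e => (S.times e).map fun t => (e, t)).length) =
        n + 4 * S.edges.length + 3 * pairs.length) ⟨p, ?_, rfl, ?_⟩ ?_ ?_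
    · simpa using hl
    · simp only [List.flatMap_cons, List.length_append, List.length_map, List.length_cons] at hm
      omega
    · rintro _ t ts b m - ⟨p, hl, rfl, hm⟩
      simp only [wp_push]
      refine ⟨p ++ [(e, t)], by simp [hl], ?_, by simp only [List.length_cons] at hm; omega⟩
      funext c
      by_cases hc : max (σ.edge e) (WithTop.some t) = c
      · subst hc
        simp [List.filter_append]
      · simp only [List.filter_append, List.filter_cons, hc, Function.update_of_ne (Ne.symm hc)]
        simp
    · rintro b m ⟨p, hl, rfl, hm⟩
      refine ⟨p, by simpa using hl, rfl, ?_⟩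
      simp only [List.length_nil] at hm
      omega
  · rintro b m ⟨p, hl, rfl, hm⟩
    simp only [List.flatMap_nil, List.append_nil] at hl
    subst hl
    simp only [List.length_nil, List.flatMap_nil, mul_zero, add_zero] at hm
    exact hm ▸ h

theorem wp_list (hk : 1 ≤ k) {σ : CoreTimes V} {R : Report V} {D : ℕ → ℕ → Prop}
    (hS : S.Represents G Ts Te x) (hx : Ts ≤ x) (hσ : σ.Correct k S) (hR : R.Correct G k D)
    {n : ℕ} {Q : Report V → ℕ → Prop}
    (h : ∀ R' m, R'.Correct G k (fun a b => D a b ∨ a = x ∧ x ≤ b ∧ b ≤ Te) →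
      m ≤ n + 4 * S.edges.length + 5 * S.verts.length +
        4 * (S.edges.flatMap fun e => (S.times e).map fun t => (e, t)).length +
        7 * (Te + 1 - x) + 3 → Q R' m) :
    wp (list Te x σ S R) n Q := by
  rw [list]
  simp only [wp_bind]
  refine wp_buckets σ.vert S.verts _ _ ?_
  refine wp_pairBuckets σ S _ _ ?_
  set pairs := S.edges.flatMap fun e => (S.times e).map fun t => (e, t) with hpairs
  let val : Sym2 V × ℕ → Time := fun a => max (σ.edge a.1) (WithTop.some a.2)
  have hmem_pairs : ∀ a : Sym2 V × ℕ, a ∈ pairs ↔ a.1 ∈ S.edges ∧ a.2 ∈ S.times a.1 := by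
    rintro ⟨e, t⟩
    simp only [hpairs, List.mem_flatMap, List.mem_map, Prod.mk.injEq]
    constructor
    · rintro ⟨e', he', t', ht', rfl, rfl⟩
      exact ⟨he', ht'⟩
    · exact fun h => ⟨e, h.1, t, h.2, rfl, rfl⟩
  have hnd : ((interval x Te).map WithTop.some : List Time).Nodup :=
    List.Nodup.map WithTop.coe_injective List.nodup_range'
  have hsumV := sum_length_buckets_le σ.vert S.verts hnd
  have hsumE := sum_length_buckets_le val pairs hnd
  simp only [List.map_map] at hsumV hsumE
  have hlen : (interval x Te).length = Te + 1 - x := by simp [interval]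
  -- Each end time costs up to 7 steps: the loop head, three reads, the ends of two inner loops and
  -- one write. The two sums pay one step for every vertex and pair still in its bucket.
  refine wp_forEach (fun r (s : Answer V × Option (ℕ × ℕ) × Report V) m =>
    (∀ v, v ∈ s.1.1 ↔ v ∈ S.verts ∧ ∃ t ∈ interval x Te, t ∉ r ∧ σ.vert v = WithTop.some t) ∧
    (∀ a, a ∈ s.1.2 ↔ a ∈ pairs ∧ ∃ t ∈ interval x Te, t ∉ r ∧ val a = WithTop.some t) ∧
    IsTightest s.2.1 (· ∈ s.1.2) ∧
    s.2.2.Correct G k (fun a b => D a b ∨ a = x ∧ b ∈ interval x Te ∧ b ∉ r) ∧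
    m + 7 * r.length +
      (r.map ((fun c => (S.verts.filter fun a => σ.vert a = c).length) ∘ WithTop.some)).sum +
      (r.map ((fun c => (pairs.filter fun a => val a = c).length) ∘ WithTop.some)).sum ≤
      n + 4 * S.verts.length + 1 + 4 * S.edges.length + 3 * pairs.length + 1 +
        7 * (Te + 1 - x) + S.verts.length + pairs.length) ?_ ?_ ?_
  · refine ⟨?_, ?_, ?_, hR.congr ?_, by omega⟩
    · intro v
      simp only [List.not_mem_nil, false_iff]
      rintro ⟨-, t, h₁, h₂, -⟩
      exact h₂ h₁
    · intro a
      simp only [List.not_mem_nil, false_iff]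
      rintro ⟨-, t, h₁, h₂, -⟩
      exact h₂ h₁
    · intro a
      simp
    · intro a b
      tauto
  · rintro p te r ⟨⟨vs, es⟩, o, R⟩ m hl ⟨h₁, h₂, h₃, h₄, hm⟩
    dsimp only at h₁ h₂ h₃ h₄
    have hnd' : (p ++ te :: r).Nodup := hl ▸ List.nodup_range'
    have hte : te ∈ interval x Te := by simp [hl]
    have hter : te ∉ r := (List.nodup_cons.1 (List.nodup_append.1 hnd').2.1).1
    have hsorted : (p ++ te :: r).Pairwise (· < ·) := hl ▸ List.pairwise_lt_range'
    have hmem : ∀ t, (t ∈ interval x Te ∧ t ∉ r) ↔ x ≤ t ∧ t ≤ te := by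
      intro t
      have := (List.pairwise_append.1 hsorted)
      constructor
      · rintro ⟨ht, htr⟩
        refine ⟨(mem_interval.1 ht).1, ?_⟩
        rw [hl, List.mem_append, List.mem_cons] at ht
        obtain ht | rfl | ht := ht
        · exact (this.2.2 t ht te (by simp)).le
        · exact le_rfl
        · exact absurd ht htr
      · rintro ⟨ht, htt⟩
        refine ⟨mem_interval.2 ⟨ht, htt.trans (mem_interval.1 hte).2⟩, fun htr => ?_⟩
        exact ((List.pairwise_cons.1 this.2.1).1 t htr).not_ge htt
    have hor : ∀ t, (t ∈ interval x Te ∧ t ∉ r) ↔ (t ∈ interval x Te ∧ t ∉ te :: r) ∨ t = te := by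
      intro t
      rw [List.mem_cons]
      by_cases h : t = te
      · simp [h, hte, hter]
      · simp [h]
    have hex : ∀ c : Time, (∃ t ∈ interval x Te, t ∉ r ∧ c = WithTop.some t) ↔
        (∃ t ∈ interval x Te, t ∉ te :: r ∧ c = WithTop.some t) ∨ c = WithTop.some te := by
      intro c
      simp only [← and_assoc]
      constructor
      · rintro ⟨t, ht, rfl⟩
        exact ((hor t).1 ht).imp (fun h => ⟨t, h, rfl⟩) fun h => by rw [h]
      · rintro (⟨t, ht, rfl⟩ | rfl)
        · exact ⟨t, (hor t).2 (.inl ht), rfl⟩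
        · exact ⟨te, (hor te).2 (.inr rfl), rfl⟩
    simp only [List.length_cons, List.map_cons, List.sum_cons, Function.comp_apply] at hm
    simp only [wp_bind, wp_read]
    refine wp_forEach (fun q vs' m' =>
      (∀ v, v ∈ vs' ∨ v ∈ q ↔ v ∈ vs ∨ v ∈ (S.verts.filter fun a => σ.vert a = WithTop.some te).reverse) ∧
      m' + q.length = m + 2 + (S.verts.filter fun a => σ.vert a = WithTop.some te).reverse.length)
      ⟨fun v => Iff.rfl, rfl⟩ ?_ ?_
    · rintro _ v q vs' m' - ⟨g₁, g₂⟩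
      simp only [wp_pure]
      refine ⟨fun w => ?_, by simp only [List.length_cons] at g₂; omega⟩
      rw [← g₁]
      simp only [List.mem_cons]
      tauto
    rintro vs' m₁ ⟨g₁, g₂⟩
    simp only [List.not_mem_nil, or_false, List.mem_reverse, List.mem_filter,
      decide_eq_true_eq, List.length_nil, add_zero, List.length_reverse] at g₁ g₂
    refine wp_forEach (fun q (s : List (Sym2 V × ℕ) × Option (ℕ × ℕ)) m' =>
      (∀ a, a ∈ s.1 ∨ a ∈ q ↔ a ∈ es ∨ a ∈ (pairs.filter fun a => val a = WithTop.some te).reverse) ∧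
      IsTightest s.2 (· ∈ s.1) ∧
      m' + q.length = m₁ + 2 + (pairs.filter fun a => val a = WithTop.some te).reverse.length)
      ⟨fun v => Iff.rfl, h₃, rfl⟩ ?_ ?_
    · rintro _ a q ⟨es', o'⟩ m' - ⟨g₁, g₂, g₃⟩
      simp only [wp_pure]
      refine ⟨fun w => ?_, g₂.extend a, by simp only [List.length_cons] at g₃; omega⟩
      rw [← g₁]
      simp only [List.mem_cons]
      tauto
    rintro ⟨es', o'⟩ m₂ ⟨g₃, g₄, g₅⟩
    simp only [List.not_mem_nil, or_false, List.mem_reverse, List.mem_filter,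
      decide_eq_true_eq, List.length_nil, add_zero, List.length_reverse] at g₃ g₄ g₅
    have hv' : ∀ v, v ∈ vs' ↔
        v ∈ S.verts ∧ ∃ t ∈ interval x Te, t ∉ r ∧ σ.vert v = WithTop.some t := by
      intro v
      rw [hex, g₁, h₁]
      exact and_or_left.symm
    have he' : ∀ a, a ∈ es' ↔
        a ∈ pairs ∧ ∃ t ∈ interval x Te, t ∉ r ∧ val a = WithTop.some t := by
      intro v
      rw [hex, g₃, h₂]
      exact and_or_left.symm
    -- Having been added at some end time so far means having value at most `te`, since no value
    -- lies below `x`.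
    have hle : ∀ c : Time, (∀ t : ℕ, c = WithTop.some t → x ≤ t) →
        ((∃ t ∈ interval x Te, t ∉ r ∧ c = WithTop.some t) ↔ c ≤ WithTop.some te) := by
      intro c hc
      simp only [← and_assoc, hmem]
      constructor
      · rintro ⟨t, ht, rfl⟩
        exact WithTop.coe_le_coe.2 ht.2
      · intro h
        obtain ⟨t, rfl⟩ := WithTop.ne_top_iff_exists.1 (ne_top_of_le_ne_top (by simp) h)
        exact ⟨t, ⟨hc t rfl, WithTop.coe_le_coe.1 h⟩, rfl⟩
    have hA : IsAnswer G k x te (vs', es') := by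
      refine hσ.isAnswer hk hS hx (mem_interval.1 hte).2 (fun v => ?_) (fun a => ?_)
      · rw [hv', hle _ fun t ht => hσ.le_vert hk hS ht.le]
      · rw [he', hmem_pairs, and_assoc]
        refine and_congr_right fun _ => and_congr_right fun hat => hle _ fun t ht => ?_
        have := (mem_proj_edges.1 ((hS.mem_times _ _).1 hat)).2.1
        exact this.trans (WithTop.coe_le_coe.1 ((le_max_right _ _).trans ht.le))
    have hD : ∀ a b, (D a b ∨ a = x ∧ b ∈ interval x Te ∧ b ∉ te :: r) ∨ a = x ∧ b = te ↔
        D a b ∨ a = x ∧ b ∈ interval x Te ∧ b ∉ r := by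
      intro a b
      rw [hor, or_assoc, ← and_or_left]
    dsimp only
    cases hseen : R.seen o' with
    | true =>
      simp only [if_true, wp_pure]
      exact ⟨hv', he', g₄, (h₄.skip hk hA g₄ hseen).congr hD, by omega⟩
    | false =>
      simp only [Bool.false_eq_true, if_false, wp_bind, wp_write, wp_pure]
      exact ⟨hv', he', g₄, (h₄.add hA g₄ hseen).congr hD, by omega⟩
  · rintro ⟨A, o, R⟩ m ⟨-, -, -, h₄, hm⟩
    simp only [wp_pure]
    refine h _ _ (h₄.congr fun a b => ?_) ?_
    · simp [mem_interval]
    · simp only [List.length_nil, List.map_nil, List.sum_nil] at hm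
      omega

end CoreT

namespace CoreT

open Timed TemporalGraph

variable {V : Type} [LinearOrder V] {k Ts Te x : ℕ} {S : Store V} {G : TemporalGraph V}
  {snap : ℕ → List (Sym2 V)}

/-! ### Storing the projected graph -/

/-- The invariant of `refine`: exactly the temporal edges in `X` have been stored. -/
structure RefineInv (X : Sym2 V → ℕ → Prop) (s : Store V × (V → Bool)) : Prop where
  nodup_verts : s.1.verts.Nodup
  mem_verts : ∀ v, v ∈ s.1.verts ↔ ∃ e ∈ s.1.edges, v ∈ e
  marked : ∀ v, s.2 v = true ↔ v ∈ s.1.verts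
  nodup_edges : s.1.edges.Nodup
  mem_edges : ∀ e, e ∈ s.1.edges ↔ s.1.times e ≠ []
  sorted : ∀ e, (s.1.times e).Pairwise (· < ·)
  mem_times : ∀ e t, t ∈ s.1.times e ↔ X e t

theorem RefineInv.congr {X X' : Sym2 V → ℕ → Prop} {s : Store V × (V → Bool)}
    (h : RefineInv X s) (hX : ∀ e t, X e t ↔ X' e t) : RefineInv X' s where
  __ := h
  mem_times e t := (h.mem_times e t).trans (hX e t)

/-- Timestamps arrive in descending order (hypothesis `ht`), so prepending keeps each list
ascending; an empty list signals that the static edge is new. -/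
theorem wp_storeEdge {X : Sym2 V → ℕ → Prop} {s : Store V × (V → Bool)} (h : RefineInv X s)
    {e : Sym2 V} {t : ℕ} (ht : ∀ u, X e u → t < u) {n : ℕ} {Q : Store V × (V → Bool) → ℕ → Prop}
    (hQ : ∀ s', RefineInv (fun e' u => X e' u ∨ e' = e ∧ u = t) s' → ∀ m ≤ n + 9, Q s' m) :
    wp (do
      let l ← read s.1.times e
      let times ← write s.1.times e (t :: l)
      let edges := if l.isEmpty then e :: s.1.edges else s.1.edges
      forEach [e.inf, e.sup] (⟨s.1.verts, edges, times⟩, s.2) fun v s => do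
        let old ← read s.2 v
        if old then
          pure s
        else
          let mark ← write s.2 v true
          pure (⟨v :: s.1.verts, s.1.edges, s.1.times⟩, mark)) n Q := by
  simp only [wp_bind, wp_read, wp_write]
  set edges := if (s.1.times e).isEmpty = true then e :: s.1.edges else s.1.edges with hedges
  have hnd : edges.Nodup := by
    rw [hedges]
    split_ifs with hl
    · rw [List.isEmpty_iff] at hl
      exact List.nodup_cons.2 ⟨fun he => (h.mem_edges e).1 he hl, h.nodup_edges⟩
    · exact h.nodup_edges
  have hmem : ∀ e', e' ∈ edges ↔ e' ∈ s.1.edges ∨ e' = e := by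
    intro e'
    rw [hedges]
    split_ifs with hl
    · rw [List.mem_cons, or_comm]
    · rw [List.isEmpty_iff] at hl
      refine ⟨.inl, ?_⟩
      rintro (he | rfl)
      exacts [he, (h.mem_edges _).2 hl]
  refine wp_forEach (fun vs s' m => s'.1.edges = edges ∧
    s'.1.times = Function.update s.1.times e (t :: s.1.times e) ∧ s'.1.verts.Nodup ∧
    (∀ v, s'.2 v = true ↔ v ∈ s'.1.verts) ∧
    (∀ v, (v ∈ s'.1.verts ∨ v ∈ vs) ↔ v ∈ s.1.verts ∨ v ∈ e) ∧ m + 3 * vs.length ≤ n + 8)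
    ⟨rfl, rfl, h.nodup_verts, h.marked, ?_, by simp⟩ ?_ ?_
  · intro v
    simp [mem_iff_inf_or_sup]
  · rintro p v vs ⟨S', mark⟩ m - ⟨h₁, h₂, h₃, h₄, h₅, hm⟩
    dsimp only at h₁ h₂ h₃ h₄ h₅
    simp only [List.length_cons] at hm
    simp only [wp_bind, wp_read]
    cases hv : mark v with
    | true =>
      simp only [if_true, wp_pure]
      refine ⟨h₁, h₂, h₃, h₄, fun w => ?_, by omega⟩
      rw [← h₅, List.mem_cons]
      have := (h₄ v).1 hv
      constructor
      · tauto
      · rintro (h | rfl | h)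
        exacts [.inl h, .inl this, .inr h]
    | false =>
      simp only [Bool.false_eq_true, if_false, wp_bind, wp_write, wp_pure]
      refine ⟨h₁, h₂, List.nodup_cons.2 ⟨fun h => ?_, h₃⟩, fun w => ?_, fun w => ?_, by omega⟩
      · simp [(h₄ v).2 h] at hv
      · by_cases hw : w = v
        · simp [hw]
        · simp [hw, h₄]
      · rw [← h₅, List.mem_cons, List.mem_cons]
        tauto
  · rintro ⟨⟨verts, edges', times⟩, mark⟩ m ⟨h₁, h₂, h₃, h₄, h₅, hm⟩
    dsimp only at h₁ h₂ h₃ h₄ h₅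
    subst h₁ h₂
    simp only [List.not_mem_nil, or_false] at h₅
    refine hQ _ ⟨h₃, fun v => ?_, h₄, hnd, fun e' => ?_, fun e' => ?_, fun e' u => ?_⟩ _ ?_
    · dsimp only
      rw [h₅, h.mem_verts]
      constructor
      · rintro (⟨e', he', hv⟩ | hv)
        exacts [⟨e', (hmem e').2 (.inl he'), hv⟩, ⟨e, (hmem e).2 (.inr rfl), hv⟩]
      · rintro ⟨e', he', hv⟩
        obtain he' | rfl := (hmem e').1 he'
        exacts [.inl ⟨e', he', hv⟩, .inr hv]
    · dsimp only
      rw [hmem, h.mem_edges]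
      by_cases hee : e' = e
      · simp [hee]
      · simp [hee]
    · dsimp only
      by_cases hee : e' = e
      · subst hee
        rw [Function.update_self]
        exact List.pairwise_cons.2 ⟨fun u hu => ht u ((h.mem_times _ u).1 hu), h.sorted _⟩
      · rw [Function.update_of_ne hee]
        exact h.sorted e'
    · dsimp only
      by_cases hee : e' = e
      · subst hee
        rw [Function.update_self, List.mem_cons, h.mem_times]
        tauto
      · rw [Function.update_of_ne hee, h.mem_times]
        tauto
    · simp only [List.length_nil] at hm
      omega

theorem wp_refine (hsnap : Lists snap G) {n : ℕ} {Q : Store V → ℕ → Prop}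
    (h : ∀ S m, S.Represents G Ts Te Ts →
      m ≤ n + 3 * (Te + 1 - Ts) + 10 * (G.proj Ts Te).edges.card + 1 → Q S m) :
    wp (refine snap Ts Te) n Q := by
  rw [refine, wp_bind]
  have hmem : ∀ t, t ∈ (interval Ts Te).reverse ↔ Ts ≤ t ∧ t ≤ Te := by simp [mem_interval]
  have hnd : (interval Ts Te).reverse.Nodup := List.nodup_reverse.2 List.nodup_range'
  have hlen : (interval Ts Te).reverse.length = Te + 1 - Ts := by simp [interval]
  -- The snapshots partition the temporal edges by timestamp.
  have hsum : ((interval Ts Te).reverse.map fun t => (snap t).length).sum ≤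
      (G.proj Ts Te).edges.card := by
    rw [← List.sum_toFinset _ hnd, Finset.card_eq_sum_card_fiberwise (f := Prod.snd)
      (t := (interval Ts Te).reverse.toFinset)]
    · refine Finset.sum_le_sum fun t ht => ?_
      rw [← List.toFinset_card_of_nodup (hsnap t).1]
      refine Finset.card_le_card_of_injOn (fun e => (e, t)) (fun e he => ?_)
        fun a _ b _ h => (Prod.mk.inj h).1
      rw [List.mem_toFinset, hmem] at ht
      simp only [List.coe_toFinset, Set.mem_ofPred_eq] at he
      rw [Finset.mem_coe, Finset.mem_filter]
      exact ⟨mem_proj_edges.2 ⟨((hsnap t).2 e).1 he, ht⟩, rfl⟩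
    · intro a ha
      rw [Finset.mem_coe, List.mem_toFinset, hmem]
      exact (mem_proj_edges.1 ha).2
  have hsorted : (interval Ts Te).reverse.Pairwise (· > ·) :=
    List.pairwise_reverse.2 List.pairwise_lt_range'
  refine wp_forEach (fun r s m =>
    RefineInv (fun e t => (e, t) ∈ (G.proj Ts Te).edges ∧ t ∉ r) s ∧
    m + 3 * r.length + 10 * (r.map fun t => (snap t).length).sum ≤
      n + 3 * (Te + 1 - Ts) + 10 * (G.proj Ts Te).edges.card) ⟨?_, by omega⟩ ?_ ?_
  · constructor <;> simp only [List.nodup_nil, List.not_mem_nil, false_and, exists_false,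
      implies_true, Bool.false_eq_true, ne_eq, not_true_eq_false, List.Pairwise.nil, false_iff,
      not_and, not_not, iff_self]
    intro e t ht
    rw [hmem]
    exact (mem_proj_edges.1 ht).2
  · rintro p t r s m hl ⟨hs, hm⟩
    have ht : Ts ≤ t ∧ t ≤ Te := (hmem t).1 (by simp [hl])
    have htr : t ∉ r := by
      rw [hl] at hnd
      exact (List.nodup_cons.1 (List.nodup_append.1 hnd).2.1).1
    have hlt : ∀ u, u ∈ (interval Ts Te).reverse → u ∉ t :: r → t < u := by
      intro u hu hur
      rw [hl] at hsorted hu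
      exact (List.pairwise_append.1 hsorted).2.2 u ((List.mem_append.1 hu).resolve_right hur) t
        (by simp)
    simp only [List.length_cons, List.map_cons, List.sum_cons] at hm
    simp only [wp_bind, wp_read]
    refine wp_forEach (fun es s m =>
      RefineInv (fun e u => (e, u) ∈ (G.proj Ts Te).edges ∧ u ∉ r ∧ ¬ (u = t ∧ e ∈ es)) s ∧
      m + 10 * es.length + 1 + 3 * r.length + 10 * (r.map fun t => (snap t).length).sum ≤
        n + 3 * (Te + 1 - Ts) + 10 * (G.proj Ts Te).edges.card) ⟨hs.congr ?_, by omega⟩ ?_ ?_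
    · intro e u
      simp only [List.mem_cons, not_or]
      constructor
      · rintro ⟨h₁, h₂, h₃⟩
        exact ⟨h₁, h₃, fun h => h₂ h.1⟩
      · rintro ⟨h₁, h₂, h₃⟩
        refine ⟨h₁, fun hut => ?_, h₂⟩
        subst hut
        exact h₃ ⟨rfl, ((hsnap u).2 e).2 (mem_proj_edges.1 h₁).1⟩
    · rintro q e es s m hes ⟨hs, hm⟩
      have hesnap : e ∈ snap t := by simp [hes]
      have hees : e ∉ es := by
        have := (hsnap t).1
        rw [hes] at this
        exact (List.nodup_cons.1 (List.nodup_append.1 this).2.1).1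
      simp only [List.length_cons] at hm
      refine wp_storeEdge hs ?_ ?_
      · rintro u ⟨h₁, h₂, h₃⟩
        refine hlt u ((hmem u).2 (mem_proj_edges.1 h₁).2) ?_
        rw [List.mem_cons, not_or]
        exact ⟨fun hut => h₃ ⟨hut, by simp⟩, h₂⟩
      · intro s' hs' m' hm'
        refine ⟨hs'.congr fun e' u => ?_, by omega⟩
        simp only [List.mem_cons]
        constructor
        · rintro (⟨h₁, h₂, h₃⟩ | ⟨rfl, rfl⟩)
          · exact ⟨h₁, h₂, fun h => h₃ ⟨h.1, .inr h.2⟩⟩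
          · exact ⟨mem_proj_edges.2 ⟨((hsnap _).2 _).1 hesnap, ht⟩, htr, fun h => hees h.2⟩
        · rintro ⟨h₁, h₂, h₃⟩
          by_cases h : e' = e ∧ u = t
          · exact .inr h
          · exact .inl ⟨h₁, h₂, by tauto⟩
    · rintro s m ⟨hs, hm⟩
      refine ⟨hs.congr fun e u => by simp, ?_⟩
      simp only [List.length_nil] at hm
      omega
  · rintro ⟨S, mark⟩ m ⟨hs, hm⟩
    simp only [wp_pure]
    simp only [List.length_nil, List.map_nil, List.sum_nil] at hm
    refine h S _ ⟨hs.nodup_verts, fun v => ?_, hs.nodup_edges, hs.mem_edges, hs.sorted,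
      fun e t => ?_⟩ (by omega)
    · rw [hs.mem_verts]
      constructor
      · rintro ⟨e, he, hv⟩
        obtain ⟨t, ht⟩ := List.exists_mem_of_ne_nil _ ((hs.mem_edges e).1 he)
        exact ⟨(e, t), ((hs.mem_times e t).1 ht).1, hv⟩
      · rintro ⟨⟨e, t⟩, ha, hv⟩
        have := (hs.mem_times e t).2 ⟨ha, by simp⟩
        exact ⟨e, (hs.mem_edges e).2 (List.ne_nil_of_mem this), hv⟩
    · rw [hs.mem_times]
      simp

theorem firstTime_le_tail {l : List ℕ} (hl : l.Pairwise (· < ·)) :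
    firstTime l ≤ firstTime l.tail := by
  rcases l with _ | ⟨a, _ | ⟨b, l⟩⟩
  · simp
  · simp [firstTime]
  · exact WithTop.coe_le_coe.2 ((List.pairwise_cons.1 hl).1 b (by simp)).le

theorem firstTime_tail_mem_levels {l : List ℕ} (hl : ∀ t ∈ l, Ts ≤ t ∧ t ≤ Te) :
    firstTime l.tail ∈ levels Ts Te := by
  rw [mem_levels]
  exact fun t ht => hl t (List.mem_of_mem_tail (firstTime_mem ht))

theorem mem_tail_iff {l : List ℕ} (hl : l.Pairwise (· < ·)) (hx : x ∈ l) (hle : ∀ t ∈ l, x ≤ t)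
    (t : ℕ) : t ∈ l.tail ↔ t ∈ l ∧ t ≠ x := by
  rcases l with _ | ⟨a, l⟩
  · simp at hx
  · have hlt := (List.pairwise_cons.1 hl).1
    have hax : x = a := by
      obtain h | h := List.mem_cons.1 hx
      · exact h
      · exact absurd (hlt x h) (hle a (by simp)).not_gt
    subst hax
    simp only [List.tail_cons, List.mem_cons]
    constructor
    · exact fun h => ⟨.inr h, (hlt t h).ne'⟩
    · rintro ⟨h | h, hne⟩
      exacts [absurd h hne, h]

/-- Removing the edges with timestamp `x` leads from `[x, Te]` to `[x + 1, Te]`. -/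
theorem Store.Represents.succ (hsnap : Lists snap G) (h : S.Represents G Ts Te x) (hx : x ≤ Te)
    {S' : Store V} (hverts : S'.verts = S.verts)
    (htimes : ∀ e, S'.times e = if e ∈ snap x then (S.times e).tail else S.times e)
    (hnd : S'.edges.Nodup) (hmem : ∀ e, e ∈ S'.edges ↔ e ∈ S.edges ∧ S'.times e ≠ []) :
    S'.Represents G Ts Te (x + 1) where
  nodup_verts := hverts ▸ h.nodup_verts
  mem_verts := hverts ▸ h.mem_verts
  nodup_edges := hnd
  mem_edges e := by
    rw [hmem, h.mem_edges, and_iff_right_iff_imp]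
    intro hne hnil
    refine hne ?_
    rw [htimes, hnil]
    simp
  sorted e := by
    rw [htimes]
    split_ifs
    exacts [(h.sorted e).sublist (List.tail_sublist _), h.sorted e]
  mem_times e t := by
    have hle : ∀ t ∈ S.times e, x ≤ t := fun t ht =>
      (mem_proj_edges.1 ((h.mem_times e t).1 ht)).2.1
    -- The listed edges are exactly those whose list contains `x`, which is then its first entry, so
    -- taking the tail removes precisely `x`.
    have hxs : x ∈ S.times e ↔ e ∈ snap x := by
      rw [h.mem_times, mem_proj_edges, (hsnap x).2]
      exact ⟨fun h => h.1, fun h => ⟨h, le_rfl, hx⟩⟩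
    have : t ∈ S'.times e ↔ t ∈ S.times e ∧ t ≠ x := by
      rw [htimes]
      split_ifs with hes
      · exact mem_tail_iff (h.sorted e) (hxs.2 hes) hle t
      · rw [iff_self_and]
        rintro ht rfl
        exact hes (hxs.1 ht)
    rw [this, h.mem_times, mem_proj_edges, mem_proj_edges]
    dsimp only
    constructor
    · rintro ⟨⟨h₁, h₂, h₃⟩, h₄⟩
      exact ⟨h₁, by omega, h₃⟩
    · rintro ⟨h₁, h₂, h₃⟩
      exact ⟨⟨h₁, by omega, h₃⟩, by omega⟩

/-! ### The whole run -/

theorem wp_call {α : Type} (name : Procedure) (p : Timed α) (n : ℕ)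
    (Q : α × Procedure × ℕ → ℕ → Prop) :
    wp (call name p) n Q ↔ wp p n fun a m => Q (a, name, m - n) m := by
  simp only [call, wp_bind, wp_get, wp_pure]

/-- The sole purpose of the density hypothesis: the number of levels becomes linear in the number of
temporal edges, which in particular is positive, so additive constants are absorbed as well. -/
theorem card_interval_le (hdense : ∀ t, Ts ≤ t → t ≤ Te → ∃ e, (e, t) ∈ G.edges) :
    Te + 1 - Ts ≤ (G.proj Ts Te).edges.card := by
  rw [← Nat.card_Icc]
  refine (Finset.card_le_card (t := (G.proj Ts Te).edges.image Prod.snd) fun t ht => ?_).trans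
    Finset.card_image_le
  rw [Finset.mem_Icc] at ht
  obtain ⟨e, he⟩ := hdense t ht.1 ht.2
  exact Finset.mem_image.2 ⟨(e, t), mem_proj_edges.2 ⟨he, ht⟩, rfl⟩

theorem wp_run (hk : 1 ≤ k) (hT : Ts ≤ Te) (hsnap : Lists snap G)
    {Q : Result V → ℕ → Prop}
    (h : ∀ r m, (∃ R : Report V, r.out = R.out ∧
        R.Correct G k fun ts te => Ts ≤ ts ∧ ts ≤ te ∧ te ≤ Te) →
      r.calls.map Prod.fst = [Procedure.init, Procedure.list] ++
        (List.replicate (Te - Ts) [Procedure.update, Procedure.list]).flatten →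
      ((∀ t, Ts ≤ t → t ≤ Te → ∃ e, (e, t) ∈ G.edges) →
        (∀ c ∈ r.calls, c.2 ≤ 250 * (G.proj Ts Te).edges.card) ∧
        m ≤ 250 * ((Te - Ts + 1) * (G.proj Ts Te).edges.card)) → Q r m) :
    wp (run k Ts Te snap) 0 Q := by
  set M := (G.proj Ts Te).edges.card with hM
  have hlev := levels_length Ts Te
  rw [run]
  simp only [wp_bind, wp_call]
  refine wp_refine hsnap fun S m₁ hS hm₁ => ?_
  have hE := hS.length_edges_le le_rfl
  have hV := hS.length_verts_le
  have hP := hS.length_pairs_le le_rfl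
  refine wp_init hk (hS.wellFormed le_rfl) fun σ m₂ hσ hσe hm₂ => ?_
  have hcorrect : σ.Correct k S := ⟨hσ, hσe⟩
  have hR₀ : (⟨fun _ => false, []⟩ : Report V).Correct G k fun _ _ => False := by
    constructor <;> simp
  refine wp_list hk hS le_rfl hcorrect hR₀ fun R m₃ hR hm₃ => ?_
  -- Here `x` is the last start time that has been processed. Storing and the first two calls
  -- together fit into one share of `250 * M`, and so does each later pair of calls; the extra `+ 1`
  -- reserves the final step of the loop.
  refine wp_forEach (fun r s m => ∃ x, r = interval (x + 1) Te ∧ Ts ≤ x ∧ x ≤ Te ∧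
    s.G.Represents G Ts Te x ∧ s.σ.Correct k s.G ∧
    (s.R.Correct G k fun ts te => Ts ≤ ts ∧ ts ≤ x ∧ ts ≤ te ∧ te ≤ Te) ∧
    s.calls.map Prod.fst = [Procedure.init, Procedure.list] ++
      (List.replicate (x - Ts) [Procedure.update, Procedure.list]).flatten ∧
    ((∀ t, Ts ≤ t → t ≤ Te → ∃ e, (e, t) ∈ G.edges) →
      (∀ c ∈ s.calls, c.2 ≤ 250 * M) ∧ m + 1 ≤ 250 * ((x - Ts + 1) * M))) ?_ ?_ ?_
  · refine ⟨Ts, rfl, le_rfl, hT, hS, hcorrect, hR.congr fun a b => ?_, by simp, fun hdense => ?_⟩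
    · constructor
      · rintro (h | ⟨rfl, h⟩)
        · exact h.elim
        · exact ⟨le_rfl, le_rfl, h⟩
      · rintro ⟨h₁, h₂, h₃⟩
        obtain rfl : a = Ts := le_antisymm h₂ h₁
        exact .inr ⟨rfl, h₃⟩
    · have := card_interval_le hdense
      simp only [List.mem_cons, List.not_mem_nil, or_false, forall_eq_or_imp, forall_eq]
      refine ⟨⟨by omega, by omega⟩, ?_⟩
      simp only [Nat.sub_self, zero_add, one_mul]
      omega
  · rintro p y r ⟨σ, S, R, calls⟩ m - ⟨x, hr, hxs, hxe, hS, hσ, hR, hcalls, htime⟩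
    dsimp only at hS hσ hR hcalls htime
    have hE := hS.length_edges_le hxs
    have hV := hS.length_verts_le
    have hx : x + 1 ≤ Te := by
      by_contra hlt
      rw [interval, show Te + 1 - (x + 1) = 0 by omega] at hr
      simp at hr
    have hcons : interval (x + 1) Te = (x + 1) :: interval (x + 1 + 1) Te := by
      rw [interval, interval, show Te + 1 - (x + 1) = Te + 1 - (x + 1 + 1) + 1 by omega]
      rfl
    rw [hcons] at hr
    obtain ⟨rfl, rfl⟩ := List.cons.inj hr
    simp only [wp_bind, wp_call, Nat.add_sub_cancel]
    refine wp_update hk (hS.wellFormed hxs) (hsnap x).1 ?_ ?_ hσ.1 hσ.2 ?_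
    · intro e he
      rw [hS.mem_edges]
      refine List.ne_nil_of_mem (a := x) ((hS.mem_times e x).2 ?_)
      exact mem_proj_edges.2 ⟨((hsnap x).2 e).1 he, le_rfl, hxe⟩
    · intro e _
      refine ⟨firstTime_tail_mem_levels fun t ht => ?_, firstTime_le_tail (hS.sorted e)⟩
      have := mem_proj_edges.1 ((hS.mem_times e t).1 ht)
      exact ⟨hxs.trans this.2.1, this.2.2⟩
    intro σ' S' m₄ h₁ h₂ h₃ h₄ h₅ h₆ hm₄
    have hS' := hS.succ hsnap hxe h₁ h₂ h₃ h₄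
    have hE' := hS'.length_edges_le (by omega)
    have hV' := hS'.length_verts_le
    have hP' := hS'.length_pairs_le (by omega)
    have hσ' : σ'.Correct k S' := ⟨h₅, h₆⟩
    refine wp_list hk hS' (by omega) hσ' hR fun R' m₅ hR' hm₅ => ?_
    simp only [wp_pure]
    refine ⟨x + 1, rfl, by omega, hx, hS', hσ', hR'.congr fun a b => by omega, ?_,
      fun hdense => ?_⟩
    · rw [List.map_append, hcalls, show x + 1 - Ts = x - Ts + 1 by omega,
        List.replicate_succ', List.flatten_append]
      simp
    · obtain ⟨g₁, g₂⟩ := htime hdense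
      have := card_interval_le hdense
      refine ⟨fun c hc => ?_, ?_⟩
      · obtain hc | hc := List.mem_append.1 hc
        · exact g₁ c hc
        · simp only [List.mem_cons, List.not_mem_nil, or_false] at hc
          obtain rfl | rfl := hc
          · dsimp only
            omega
          · dsimp only
            omega
      · rw [show x + 1 - Ts + 1 = (x - Ts + 1) + 1 by omega, add_one_mul, mul_add]
        omega
  · rintro s m ⟨x, hr, hxs, hxe, -, -, hR, hcalls, htime⟩
    have hx : x = Te := by
      by_contra hne
      rw [interval, show Te + 1 - (x + 1) = Te - x - 1 + 1 by omega] at hr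
      simp [List.range'_succ] at hr
    subst hx
    simp only [wp_pure]
    refine h _ _ ⟨s.R, rfl, hR.congr fun a b => by omega⟩ hcalls htime

end CoreT

/-! ### The theorem. -/

theorem mainTheorem5 :
    ∃ C : ℕ, ∀ (V : Type) [LinearOrder V] (G : TemporalGraph V) (k Ts Te : ℕ)
      (snap : ℕ → List (Sym2 V)), 1 ≤ k → Ts ≤ Te → CoreT.Lists snap G →
      ∃ (r : CoreT.Result V) (steps : ℕ),
        (CoreT.run k Ts Te snap).run 0 = some (r, steps) ∧
        -- every temporal `k`-core of a subinterval is reported, nothing else, and each one once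
        (r.out.map fun A => (A.1.toFinset, A.2.toFinset)).Nodup ∧
        (∀ (W : Finset V) (F : Finset (Sym2 V × ℕ)),
          (W, F) ∈ r.out.map (fun A => (A.1.toFinset, A.2.toFinset)) ↔
            ∃ (ts te : ℕ) (H : TemporalGraph V), Ts ≤ ts ∧ ts ≤ te ∧ te ≤ Te ∧
              G.IsTemporalKCore k ts te H ∧ H.verts = W ∧ H.edges = F) ∧
        -- the procedure calls
        r.calls.map Prod.fst = [CoreT.Procedure.init, CoreT.Procedure.list] ++
          (List.replicate (Te - Ts)
            [CoreT.Procedure.update, CoreT.Procedure.list]).flatten ∧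
        -- the running time, if every timestamp of the query interval occurs
        ((∀ t, Ts ≤ t → t ≤ Te → ∃ e, (e, t) ∈ G.edges) →
          (∀ c ∈ r.calls, c.2 ≤ C * (G.proj Ts Te).edges.card) ∧
          steps ≤ C * ((Te - Ts + 1) * (G.proj Ts Te).edges.card)) := by
  refine ⟨250, fun V _ G k Ts Te snap hk hT hsnap => ?_⟩
  obtain ⟨r, m, hrun, ⟨R, hout, hR⟩, hcalls, htime⟩ :=
    CoreT.wp_run (Q := fun r m => (∃ R : CoreT.Report V, r.out = R.out ∧
        R.Correct G k fun ts te => Ts ≤ ts ∧ ts ≤ te ∧ te ≤ Te) ∧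
      r.calls.map Prod.fst = [CoreT.Procedure.init, CoreT.Procedure.list] ++
        (List.replicate (Te - Ts) [CoreT.Procedure.update, CoreT.Procedure.list]).flatten ∧
      ((∀ t, Ts ≤ t → t ≤ Te → ∃ e, (e, t) ∈ G.edges) →
        (∀ c ∈ r.calls, c.2 ≤ 250 * (G.proj Ts Te).edges.card) ∧
        m ≤ 250 * ((Te - Ts + 1) * (G.proj Ts Te).edges.card))) hk hT hsnap
      fun r m h₁ h₂ h₃ => ⟨h₁, h₂, h₃⟩
  -- Uniqueness of the temporal `k`-core identifies the graph behind a reported answer with any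
  -- given core of that interval.
  have hanswer : ∀ {ts te : ℕ} {A : CoreT.Answer V} {H : TemporalGraph V},
      CoreT.IsAnswer G k ts te A → G.IsTemporalKCore k ts te H →
      H.verts = A.1.toFinset ∧ H.edges = A.2.toFinset := by
    rintro ts te A H ⟨H', h', hv, he⟩ h
    obtain rfl := (TemporalGraph.isTemporalKCore_iff (h'.isGreatest hk)).1 h
    exact ⟨by ext v; simp [hv], by ext a; simp [he]⟩
  refine ⟨r, m, hrun, ?_, fun W F => ?_, hcalls, htime⟩
  · rw [hout]
    -- Reported answers differ already in their edge sets.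
    exact List.pairwise_map.2 (hR.distinct.imp fun h h' => h (Prod.mk.inj h').2)
  · rw [hout, List.mem_map]
    constructor
    · rintro ⟨A, hA, hWF⟩
      obtain ⟨rfl, rfl⟩ := Prod.mk.inj hWF
      obtain ⟨ts, te, ⟨h₁, h₂, h₃⟩, hans⟩ := hR.sound A hA
      obtain ⟨H, hH, -⟩ := id hans
      exact ⟨ts, te, H, h₁, h₂, h₃, hH, hanswer hans hH⟩
    · rintro ⟨ts, te, H, h₁, h₂, h₃, hH, rfl, rfl⟩
      obtain ⟨A, hA, hans⟩ := hR.complete ts te ⟨h₁, h₂, h₃⟩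
      obtain ⟨h₄, h₅⟩ := hanswer hans hH
      exact ⟨A, hA, by rw [h₄, h₅]⟩
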